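/- **Setting.** Let $d\ge 1$. For $x,y\in[0,1]^d$ let $\|x-y\|_{T}=\min_{z\in\mathbb{Z}^d}\|x-y+z\|$ be the Euclidean distance on the unit torus. Let $0\le r_n\le 1/2$ for all $n$. For each $n$ let $X_1,\dots,X_n$ be i.i.d. uniform on $[0,1]^d$, and let $G_n$ be the graph on $\{1,\dots,n\}$ in which distinct $i,j$ are joined if and only if $\|X_i-X_j\|_T\le r_n$. Let $\xi_{ij}$ be the indicator that $i$ and $j$ are joined, $D_i$ the degree of $i$, and $\delta_i$ the number of edges between neighbours of $i$. Let $M$ be the smallest index among the vertices of maximal degree, and set $$W_1=\frac{\delta_M}{\binom{D_M}{2}},\qquad W_2=\frac{\sum_{i<j<k}\xi_{ki}\xi_{kj}\xi_{ij}}{\sum_{i<j<k}\xi_{ki}\xi_{kj}}.$$ For $m\ge 1$ let $w_m=\mathbb{P}\{\|X-Y\|\le 1\}$, where $X,Y$ are independent and uniform in the unit ball of $\mathbb{R}^m$. For an estimate $W$ let $\Delta_n=\operatorname{argmin}_{m\ge 1}|W-w_m|$ (with ties broken arbitrarily, and with an arbitrary value if the infimum is not attained). **Theorem.** (i) If $r_n\le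 1/3$ for all sufficiently large $n$ and $$\lim_{n\to\infty} n\,r_n^{d(1-\epsilon)}=\infty\quad\text{for all }\epsilon>0,$$ then $W_1\to w_d$ in probability, and thus $\Delta_n\to d$ in probability for $W=W_1$, as $n\to\infty$. A sufficient condition for the displayed limit for all $\epsilon>0$ is that $n r_n^d\ge L(n)$ for all sufficiently large $n$, for some slowly varying function $L$ (that is, $L$ is positive and measurable on some $[A,\infty)$, and $L(cx)/L(x)\to 1$ as $x\to\infty$ for every $c>0$). (ii) If $r_n\to 0$ and $n^{3/2}r_n^d\to\infty$, then $W_2\to w_d$ in probability, and thus $\Delta_n\to d$ in probability for $W=W_2$, as $n\to\infty$. -/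

import Mathlib

open MeasureTheory ProbabilityTheory Filter Topology

/-- The unit cube `[0,1]^d`, the fundamental domain of the torus. -/
def unitCube (d : ℕ) : Set (EuclideanSpace ℝ (Fin d)) :=
  {x | ∀ i, x i ∈ Set.Icc (0 : ℝ) 1}

/-- Euclidean distance on the torus: the minimum over integer vectors `z` of `‖x - y + z‖`. -/
noncomputable def torusDist {d : ℕ} (x y : EuclideanSpace ℝ (Fin d)) : ℝ :=
  ⨅ z : Fin d → ℤ, ‖x - y + WithLp.toLp 2 (fun i => (z i : ℝ))‖

/-- The geometric graph on the torus with vertex set `Fin n`: distinct `i`, `j` are joined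
when the torus distance of `x i` and `x j` is at most `r`. -/
def torusGraph {d n : ℕ} (r : ℝ) (x : Fin n → EuclideanSpace ℝ (Fin d)) :
    SimpleGraph (Fin n) :=
  SimpleGraph.fromRel (fun i j => torusDist (x i) (x j) ≤ r)

/-- `w_d = P(‖X - Y‖ ≤ 1)` for independent `X`, `Y`, both uniform in the unit ball of `ℝ^d`. -/
noncomputable def ballProb (d : ℕ) : ℝ :=
  ((cond (volume : Measure (EuclideanSpace ℝ (Fin d))) (Metric.closedBall 0 1)).prod
    (cond (volume : Measure (EuclideanSpace ℝ (Fin d))) (Metric.closedBall 0 1))).real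
      {p | ‖p.1 - p.2‖ ≤ 1}

open scoped Classical in
/-- The degree `D_i` of the vertex `i`. -/
noncomputable def vertexDegree {n : ℕ} (G : SimpleGraph (Fin n)) (i : Fin n) : ℕ :=
  G.degree i

open scoped Classical in
/-- `δ_i`: the number of edges between neighbours of the vertex `i`; an edge `{j, k}` is
counted once, as the pair with `j < k`. -/
noncomputable def neighborEdges {n : ℕ} (G : SimpleGraph (Fin n)) (i : Fin n) : ℕ :=
  (Finset.univ.filter (fun p : Fin n × Fin n =>
    p.1 < p.2 ∧ G.Adj i p.1 ∧ G.Adj i p.2 ∧ G.Adj p.1 p.2)).card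

open scoped Classical in
/-- The set of vertices of maximal degree. -/
noncomputable def maxDegreeVertices {n : ℕ} (G : SimpleGraph (Fin n)) : Finset (Fin n) :=
  Finset.univ.filter (fun i => ∀ j, vertexDegree G j ≤ vertexDegree G i)

open scoped Classical in
/-- `W₁ = δ_M / (D_M choose 2)`, with `M` the smallest vertex of maximal degree. It is `0`
for the graph without vertices and when `D_M < 2`. -/
noncomputable def maxDegreeClustering {n : ℕ} (G : SimpleGraph (Fin n)) : ℝ :=
  if h : (maxDegreeVertices G).Nonempty then
    (neighborEdges G ((maxDegreeVertices G).min' h) : ℝ) /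
      ((vertexDegree G ((maxDegreeVertices G).min' h)).choose 2 : ℝ)
  else 0

open scoped Classical in
/-- The indicator `ξ_{ij}` that `i` and `j` are joined. -/
noncomputable def edgeIndicator {n : ℕ} (G : SimpleGraph (Fin n)) (i j : Fin n) : ℝ :=
  if G.Adj i j then 1 else 0

/-- `W₂ = (∑_{i<j<k} ξ_{ki} ξ_{kj} ξ_{ij}) / (∑_{i<j<k} ξ_{ki} ξ_{kj})`
(`0` when the denominator vanishes). -/
noncomputable def globalClustering {n : ℕ} (G : SimpleGraph (Fin n)) : ℝ :=
  (∑ k, ∑ j ∈ Finset.Iio k, ∑ i ∈ Finset.Iio j,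
      edgeIndicator G k i * edgeIndicator G k j * edgeIndicator G i j) /
    (∑ k, ∑ j ∈ Finset.Iio k, ∑ i ∈ Finset.Iio j, edgeIndicator G k i * edgeIndicator G k j)

/-- The set of dimensions `m ≥ 1` that minimize `|w - w_m|`. -/
def dimensionArgmin (w : ℝ) : Set ℕ :=
  {m | 1 ≤ m ∧ ∀ k, 1 ≤ k → |w - ballProb m| ≤ |w - ballProb k|}

/-- `D` is a value of `argmin_m |w - w_m|`: ties are broken arbitrarily, and `D` is arbitrary
when the infimum is not attained (as `w_m → 0`, this happens for `w ≤ 0`). -/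
def IsDimensionEstimate (w : ℝ) (D : ℕ) : Prop :=
  (dimensionArgmin w).Nonempty → D ∈ dimensionArgmin w

/-- A slowly varying function: positive and measurable on some `[A, ∞)`, with
`L (c x) / L x → 1` as `x → ∞` for every `c > 0`. -/
def IsSlowlyVarying (L : ℝ → ℝ) : Prop :=
  (∃ A : ℝ, (∀ x, A ≤ x → 0 < L x) ∧ Measurable (fun x : Set.Ici A => L x)) ∧
    ∀ c : ℝ, 0 < c → Tendsto (fun x => L (c * x) / L x) atTop (𝓝 1)

/-- A function that no single coordinate influences is constant. -/
theorem eq_of_update_eq {ι E : Type*} [Fintype ι] [DecidableEq ι] {f : (ι → E) → ℝ}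
    (h : ∀ i x t, f (Function.update x i t) = f x)
    (x y : ι → E) : f x = f y := by
  have : ∀ s : Finset ι, f (s.piecewise x y) = f y := by
    intro s
    induction s using Finset.induction with
    | empty => simp
    | insert a s _ ih => rw [Finset.piecewise_insert, h, ih]
  simpa using this Finset.univ

section ProductMeasure

variable {ι E : Type*} [Fintype ι] [DecidableEq ι] [MeasurableSpace E]

/-- Resampling one coordinate of a product measure preserves it. -/
theorem measurePreserving_pi_update (ν : ι → Measure E) [∀ i, IsProbabilityMeasure (ν i)] (j : ι) :
    MeasurePreserving (fun q : E × (ι → E) => Function.update q.2 j q.1)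
      ((ν j).prod (Measure.pi ν)) (Measure.pi ν) := by
  have hm : Measurable (fun q : E × (ι → E) => Function.update q.2 j q.1) := by
    refine measurable_pi_iff.2 fun i => ?_
    by_cases h : i = j
    · subst h; simpa using measurable_fst
    · simpa [Function.update_of_ne h, Function.comp_def] using
        (measurable_pi_apply i).comp measurable_snd
  refine ⟨hm, (Measure.pi_eq fun s hs => ?_).symm⟩
  rw [Measure.map_apply hm (MeasurableSet.univ_pi hs)]
  have : (fun q : E × (ι → E) => Function.update q.2 j q.1) ⁻¹' (Set.univ.pi s)
      = s j ×ˢ Set.univ.pi (Function.update s j Set.univ) := by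
    ext ⟨t, x⟩
    simp only [Set.mem_preimage, Set.mem_pi, Set.mem_univ, true_implies, Set.mem_prod]
    constructor
    · intro h
      refine ⟨by simpa using h j, fun i => ?_⟩
      by_cases hi : i = j
      · subst hi; simp
      · simpa [Function.update_of_ne hi] using h i
    · rintro ⟨h1, h2⟩ i
      by_cases hi : i = j
      · subst hi; simpa using h1
      · simpa [Function.update_of_ne hi] using h2 i
  rw [this, Measure.prod_prod, Measure.pi_pi, ← Finset.mul_prod_erase _ _ (Finset.mem_univ j),
    ← Finset.mul_prod_erase _ (fun i => ν i (s i)) (Finset.mem_univ j)]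
  simp only [Function.update_self, measure_univ, one_mul]
  congr 1
  refine Finset.prod_congr rfl fun i hi => ?_
  rw [Function.update_of_ne (Finset.ne_of_mem_erase hi)]

theorem integrable_of_bounded {α : Type*} [MeasurableSpace α] {m : Measure α} [IsFiniteMeasure m]
    {f : α → ℝ} (hf : Measurable f) {C : ℝ} (hC : ∀ x, |f x| ≤ C) : Integrable f m :=
  Integrable.of_bound hf.aestronglyMeasurable C (Eventually.of_forall hC)

variable (ν : ι → Measure E) [∀ i, IsProbabilityMeasure (ν i)]

theorem integral_pi_update {F : (ι → E) → ℝ} (hF : Measurable F) {C : ℝ} (hC : ∀ x, |F x| ≤ C)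
    (j : ι) :
    ∫ x, F x ∂Measure.pi ν = ∫ t, ∫ x, F (Function.update x j t) ∂Measure.pi ν ∂ν j := by
  have h := measurePreserving_pi_update ν j
  rw [← h.map_eq, integral_map h.measurable.aemeasurable hF.aestronglyMeasurable, h.map_eq,
    integral_prod]
  exact integrable_of_bounded (hF.comp h.measurable) fun x => hC _

theorem integral_pi_update' {F : (ι → E) → ℝ} (hF : Measurable F) {C : ℝ} (hC : ∀ x, |F x| ≤ C)
    (j : ι) :
    ∫ x, F x ∂Measure.pi ν = ∫ x, ∫ t, F (Function.update x j t) ∂ν j ∂Measure.pi ν := by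
  have h := measurePreserving_pi_update ν j
  rw [← h.map_eq, integral_map h.measurable.aemeasurable hF.aestronglyMeasurable, h.map_eq,
    integral_prod_symm]
  exact integrable_of_bounded (hF.comp h.measurable) fun x => hC _

theorem measurable_integral_update {F : (ι → E) → ℝ} (hF : Measurable F) (j : ι) :
    Measurable (fun x => ∫ t, F (Function.update x j t) ∂ν j) := by
  have h := (measurePreserving_pi_update ν j).measurable
  have : StronglyMeasurable (fun q : (ι → E) × E => F (Function.update q.1 j q.2)) :=
    (hF.comp (h.comp measurable_swap)).stronglyMeasurable
  exact (this.integral_prod_right).measurable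

theorem abs_integral_le_of_bounded {α : Type*} [MeasurableSpace α] {m : Measure α}
    [IsProbabilityMeasure m] {f : α → ℝ} {C : ℝ} (hC : ∀ x, |f x| ≤ C) : |∫ x, f x ∂m| ≤ C := by
  have := norm_integral_le_of_norm_le_const (μ := m) (f := f) (C := C) (Eventually.of_forall hC)
  simpa using this

/-- Hoeffding's lemma, for an oscillation bound around a reference value. -/
theorem integral_exp_le_of_abs_sub_le {α : Type*} [MeasurableSpace α] {m : Measure α}
    [IsProbabilityMeasure m] {g : α → ℝ} (hg : Measurable g) {a c : ℝ}
    (h : ∀ t, |g t - a| ≤ c) (l : ℝ) :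
    ∫ t, Real.exp (l * g t) ∂m ≤
      Real.exp (l * ∫ t, g t ∂m) * Real.exp (l ^ 2 * c ^ 2 / 2) := by
  have hb : ∀ᵐ t ∂m, g t ∈ Set.Icc (a - c) (a + c) := Eventually.of_forall fun t => by
    have := abs_le.1 (h t); constructor <;> linarith
  have hmgf := (hasSubgaussianMGF_of_mem_Icc hg.aemeasurable hb).mgf_le l
  have hcc : (((‖(a + c) - (a - c)‖₊ / 2) ^ 2 : NNReal) : ℝ) = c ^ 2 := by
    push_cast
    rw [Real.norm_eq_abs, div_pow, sq_abs]; ring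
  rw [hcc, mgf] at hmgf
  have e : ∀ t, Real.exp (l * g t) =
      Real.exp (l * ∫ t, g t ∂m) * Real.exp (l * (g t - ∫ t, g t ∂m)) := fun t => by
    rw [← Real.exp_add]; congr 1; ring
  simp_rw [e]
  rw [integral_const_mul]
  gcongr
  refine hmgf.trans (le_of_eq ?_)
  congr 1; ring

theorem mgf_le_of_bounded_differences (S : Finset ι) (c : ι → ℝ) (l : ℝ) (f : (ι → E) → ℝ)
    (hf : Measurable f) (C : ℝ) (hC : ∀ x, |f x| ≤ C)
    (hc : ∀ i x t, |f (Function.update x i t) - f x| ≤ c i)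
    (hS : ∀ i, i ∉ S → ∀ x t, f (Function.update x i t) = f x) :
    ∫ x, Real.exp (l * f x) ∂Measure.pi ν ≤
      Real.exp (l * ∫ x, f x ∂Measure.pi ν) * Real.exp (l ^ 2 * (∑ i ∈ S, c i ^ 2) / 2) := by
  induction S using Finset.induction generalizing f with
  | empty =>
    have hconst := eq_of_update_eq (f := f) fun i => hS i (Finset.notMem_empty i)
    obtain ⟨x0⟩ : Nonempty (ι → E) := nonempty_of_isProbabilityMeasure (Measure.pi ν)
    have : f = fun _ => f x0 := funext fun x => hconst x x0
    rw [this]; simp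
  | insert j S hj ih =>
    set g : (ι → E) → ℝ := fun x => ∫ t, f (Function.update x j t) ∂ν j with hg
    have hgm : Measurable g := measurable_integral_update ν hf j
    have hint : ∀ x, Integrable (fun t => f (Function.update x j t)) (ν j) := fun x =>
      integrable_of_bounded (hf.comp (measurable_update x)) fun t => hC _
    have hgC : ∀ x, |g x| ≤ C := fun x => abs_integral_le_of_bounded fun t => hC _
    have hgupd : ∀ x s, g (Function.update x j s) = g x := fun x s => by simp [hg]
    have hgc : ∀ i x t, |g (Function.update x i t) - g x| ≤ c i := by
      intro i x t
      by_cases hij : i = j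
      · subst hij; rw [hgupd]; simpa using (abs_nonneg _).trans (hc i x t)
      · simp only [hg]
        rw [← integral_sub (hint _) (hint _)]
        refine abs_integral_le_of_bounded fun s => ?_
        rw [Function.update_comm hij]; exact hc i _ t
    have hgS : ∀ i, i ∉ S → ∀ x t, g (Function.update x i t) = g x := by
      intro i hi x t
      by_cases hij : i = j
      · subst hij; exact hgupd x t
      · simp only [hg]
        congr 1; ext s
        rw [Function.update_comm hij]; exact hS i (by simp [hij, hi]) _ t
    have hI := ih g hgm hgC hgc hgS
    have hexp : ∀ x, |Real.exp (l * f x)| ≤ Real.exp (|l| * C) := fun x => by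
      rw [Real.abs_exp, Real.exp_le_exp]
      refine (le_abs_self _).trans ?_
      rw [abs_mul]; gcongr; exact hC x
    have hexp' : ∀ x, |Real.exp (l * g x)| ≤ Real.exp (|l| * C) := fun x => by
      rw [Real.abs_exp, Real.exp_le_exp]
      refine (le_abs_self _).trans ?_
      rw [abs_mul]; gcongr; exact hgC x
    have hfe : Measurable (fun x => Real.exp (l * f x)) := (hf.const_mul l).exp
    rw [integral_pi_update' ν hfe hexp j, integral_pi_update' ν hf hC j, Finset.sum_insert hj]
    calc ∫ x, ∫ t, Real.exp (l * f (Function.update x j t)) ∂ν j ∂Measure.pi ν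
        ≤ ∫ x, Real.exp (l * g x) * Real.exp (l ^ 2 * c j ^ 2 / 2) ∂Measure.pi ν := by
          refine integral_mono
            (integrable_of_bounded (measurable_integral_update ν hfe j)
              fun x => abs_integral_le_of_bounded fun t => hexp _)
            ((integrable_of_bounded (hgm.const_mul l).exp hexp').mul_const _) fun x => ?_
          exact integral_exp_le_of_abs_sub_le (hf.comp (measurable_update x)) (a := f x)
            (fun t => hc j x t) l
      _ ≤ (Real.exp (l * ∫ x, g x ∂Measure.pi ν) * Real.exp (l ^ 2 * (∑ i ∈ S, c i ^ 2) / 2))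
            * Real.exp (l ^ 2 * c j ^ 2 / 2) := by
          rw [integral_mul_const]; gcongr
      _ = _ := by
          rw [mul_assoc, ← Real.exp_add]; congr 2; ring

/-- McDiarmid's inequality (with a non-optimal constant). -/
theorem measureReal_abs_sub_integral_ge_le (S : Finset ι) (c : ι → ℝ) (f : (ι → E) → ℝ)
    (hf : Measurable f) (C : ℝ) (hC : ∀ x, |f x| ≤ C)
    (hc : ∀ i x t, |f (Function.update x i t) - f x| ≤ c i)
    (hS : ∀ i, i ∉ S → ∀ x t, f (Function.update x i t) = f x) {s : ℝ} (hs : 0 ≤ s)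
    (hV : 0 < ∑ i ∈ S, c i ^ 2) :
    (Measure.pi ν).real {x | s ≤ |f x - ∫ y, f y ∂Measure.pi ν|} ≤
      2 * Real.exp (-s ^ 2 / (2 * ∑ i ∈ S, c i ^ 2)) := by
  set V := ∑ i ∈ S, c i ^ 2
  set m := ∫ y, f y ∂Measure.pi ν
  have key : ∀ l : ℝ, ∫ x, Real.exp (l * (f x - m)) ∂Measure.pi ν ≤ Real.exp (l ^ 2 * V / 2) := by
    intro l
    have e : ∀ x, Real.exp (l * (f x - m)) = Real.exp (-(l * m)) * Real.exp (l * f x) := fun x => by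
      rw [← Real.exp_add]; congr 1; ring
    simp_rw [e]
    rw [integral_const_mul]
    calc _ ≤ Real.exp (-(l * m)) * (Real.exp (l * m) * Real.exp (l ^ 2 * V / 2)) := by
          gcongr; exact mgf_le_of_bounded_differences ν S c l f hf C hC hc hS
      _ = _ := by rw [← mul_assoc, ← Real.exp_add]; simp
  have hint : ∀ l : ℝ, Integrable (fun x => Real.exp (l * (f x - m))) (Measure.pi ν) := fun l =>
    integrable_of_bounded ((hf.sub_const m).const_mul l).exp (C := Real.exp (|l| * (C + |m|)))
      fun x => by
        rw [Real.abs_exp, Real.exp_le_exp]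
        refine (le_abs_self _).trans ?_
        rw [abs_mul]; gcongr
        exact (abs_sub _ _).trans (by gcongr; exact hC x)
  have up := measure_ge_le_exp_mul_mgf (μ := Measure.pi ν) (X := fun x => f x - m) s
    (t := s / V) (by positivity) (hint _)
  have dn := measure_le_le_exp_mul_mgf (μ := Measure.pi ν) (X := fun x => f x - m) (-s)
    (t := -(s / V)) (by simpa using (by positivity : 0 ≤ s / V)) (hint _)
  simp only [mgf] at up dn
  have hval : ∀ l : ℝ, l ^ 2 = (s / V) ^ 2 → -(s / V) * s + l ^ 2 * V / 2 = -s ^ 2 / (2 * V) := by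
    intro l hl; rw [hl]; field_simp; ring
  have up' := up.trans (mul_le_mul_of_nonneg_left (key _) (Real.exp_pos _).le)
  have dn' := dn.trans (mul_le_mul_of_nonneg_left (key _) (Real.exp_pos _).le)
  rw [← Real.exp_add, hval _ rfl] at up'
  rw [← Real.exp_add, show -(-(s / V)) * -s = -(s / V) * s by ring, hval _ (by ring)] at dn'
  have hsub : {x | s ≤ |f x - m|} ⊆ {x | s ≤ f x - m} ∪ {x | f x - m ≤ -s} := by
    intro x hx
    rcases le_abs.1 (show s ≤ |f x - m| from hx) with h | h
    · exact Or.inl h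
    · exact Or.inr (by simp only [Set.mem_ofPred_eq]; linarith)
  calc _ ≤ _ := measureReal_mono hsub
    _ ≤ _ := measureReal_union_le _ _
    _ ≤ _ := by linarith

end ProductMeasure

/-- Conditioning a product measure on a box gives the product of the conditioned measures. -/
theorem cond_pi_box {ι E : Type*} [Fintype ι] [MeasurableSpace E] (ν : ι → Measure E)
    [∀ i, IsProbabilityMeasure (ν i)] (A : ι → Set E) (hA : ∀ i, MeasurableSet (A i))
    (hA0 : ∀ i, ν i (A i) ≠ 0) :
    (Measure.pi ν)[|Set.univ.pi A] = Measure.pi (fun i => (ν i)[|A i]) := by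
  have : ∀ i, IsProbabilityMeasure ((ν i)[|A i]) := fun i => cond_isProbabilityMeasure (hA0 i)
  refine (Measure.pi_eq fun s hs => ?_).symm
  rw [cond_apply (MeasurableSet.univ_pi hA), ← Set.pi_inter_distrib, Measure.pi_pi,
    Measure.pi_pi,
    ENNReal.prod_inv_distrib (fun i _ j _ _ => Or.inr (measure_ne_top _ _)),
    ← Finset.prod_mul_distrib]
  exact Finset.prod_congr rfl fun i _ => (cond_apply (hA i) _ _).symm

section Shear

variable {ι T : Type*} [Fintype ι] [DecidableEq ι] [AddCommGroup T] [MeasurableSpace T]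
  [MeasurableAdd₂ T] [MeasurableNeg T] (U : Measure T) [IsProbabilityMeasure U]
  [U.IsAddRightInvariant]

/-- Subtracting one coordinate of an i.i.d. invariant family from others preserves the law. -/
theorem measurePreserving_shear (v : ι) (B : Finset ι) (hv : v ∉ B) :
    MeasurePreserving (fun (x : ι → T) l => if l ∈ B then x l - x v else x l)
      (Measure.pi fun _ => U) (Measure.pi fun _ => U) := by
  set sh : (ι → T) → ι → T := fun x l => if l ∈ B then x l - x v else x l with hsh
  have hm : Measurable sh := by
    refine measurable_pi_iff.2 fun l => ?_
    by_cases h : l ∈ B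
    · simp only [hsh, h, if_true]
      exact (measurable_pi_apply l).sub (measurable_pi_apply v)
    · simpa [hsh, h] using measurable_pi_apply l
  have hu := measurePreserving_pi_update (fun _ : ι => U) v
  have hskew : MeasurePreserving
      (fun q : T × (ι → T) => (q.1, fun l => if l ∈ B then q.2 l - q.1 else q.2 l))
      (U.prod (Measure.pi fun _ => U)) (U.prod (Measure.pi fun _ => U)) := by
    refine MeasurePreserving.skew_product (f := id)
      (g := fun t (x : ι → T) l => if l ∈ B then x l - t else x l) (MeasurePreserving.id _) ?_
      (Eventually.of_forall fun t => ?_)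
    · refine measurable_pi_iff.2 fun l => ?_
      by_cases h : l ∈ B
      · simp only [Function.uncurry_def, h, if_true]
        exact ((measurable_pi_apply l).comp measurable_snd).sub measurable_fst
      · simpa [Function.uncurry_def, h, Function.comp_def] using
          (measurable_pi_apply l).comp measurable_snd
    · refine (measurePreserving_pi (fun _ : ι => U) (fun _ => U)
        (f := fun l y => if l ∈ B then y - t else y) fun l => ?_).map_eq
      by_cases h : l ∈ B
      · simpa [h] using measurePreserving_sub_right U t
      · simp only [h, if_false]; exact MeasurePreserving.id U
  have hcomp : sh ∘ (fun q : T × (ι → T) => Function.update q.2 v q.1) =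
      (fun q : T × (ι → T) => Function.update q.2 v q.1) ∘
        (fun q : T × (ι → T) => (q.1, fun l => if l ∈ B then q.2 l - q.1 else q.2 l)) := by
    funext q l
    by_cases h : l = v
    · subst h; simp [hsh, hv]
    · simp [hsh, Function.update_of_ne h]
  refine ⟨hm, ?_⟩
  have h1 : Measure.map sh (Measure.map (fun q : T × (ι → T) => Function.update q.2 v q.1)
      (U.prod (Measure.pi fun _ => U))) = Measure.pi fun _ => U := by
    rw [Measure.map_map hm hu.measurable, hcomp]
    exact (hu.comp hskew).map_eq
  rwa [hu.map_eq] at h1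

end Shear

/-- The tail `P(Bin(m, p) ≥ k)` of the binomial distribution, by its recursion. -/
def binomTail (p : ℝ) : ℕ → ℕ → ℝ
  | _, 0 => 1
  | 0, _ + 1 => 0
  | m + 1, k + 1 => p * binomTail p m k + (1 - p) * binomTail p m (k + 1)

section BinomTail

variable {p : ℝ}

@[simp] theorem binomTail_zero_right (m : ℕ) : binomTail p m 0 = 1 := by
  cases m <;> simp [binomTail]

@[simp] theorem binomTail_zero_succ (k : ℕ) : binomTail p 0 (k + 1) = 0 := by
  simp [binomTail]

theorem binomTail_succ_succ (m k : ℕ) :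
    binomTail p (m + 1) (k + 1) = p * binomTail p m k + (1 - p) * binomTail p m (k + 1) := by
  simp [binomTail]

theorem binomTail_nonneg (h0 : 0 ≤ p) (h1 : p ≤ 1) (m k : ℕ) : 0 ≤ binomTail p m k := by
  induction m generalizing k with
  | zero => cases k <;> simp
  | succ m ih =>
    cases k with
    | zero => simp
    | succ k =>
      rw [binomTail_succ_succ]
      have := ih k; have := ih (k + 1); have : 0 ≤ 1 - p := by linarith
      positivity

theorem binomTail_succ_right_le (h0 : 0 ≤ p) (h1 : p ≤ 1) (m k : ℕ) :
    binomTail p m (k + 1) ≤ binomTail p m k := by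
  induction m generalizing k with
  | zero => cases k <;> simp
  | succ m ih =>
    have hq : 0 ≤ 1 - p := by linarith
    cases k with
    | zero =>
      rw [binomTail_succ_succ]
      have := mul_le_mul_of_nonneg_left (ih 0) hq
      simp only [binomTail_zero_right] at this ⊢
      linarith
    | succ k =>
      rw [binomTail_succ_succ, binomTail_succ_succ]
      have := mul_le_mul_of_nonneg_left (ih k) h0
      have := mul_le_mul_of_nonneg_left (ih (k + 1)) hq
      linarith

theorem binomTail_le_one (h0 : 0 ≤ p) (h1 : p ≤ 1) (m k : ℕ) : binomTail p m k ≤ 1 := by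
  induction k with
  | zero => simp
  | succ k ih => exact (binomTail_succ_right_le h0 h1 m k).trans ih

theorem binomTail_le_succ_left (h0 : 0 ≤ p) (h1 : p ≤ 1) (m k : ℕ) :
    binomTail p m k ≤ binomTail p (m + 1) k := by
  cases k with
  | zero => simp
  | succ k =>
    rw [binomTail_succ_succ]
    nlinarith [binomTail_succ_right_le h0 h1 m k]

theorem binomTail_mono_left (h0 : 0 ≤ p) (h1 : p ≤ 1) (k : ℕ) :
    Monotone (fun m => binomTail p m k) :=
  monotone_nat_of_le_succ fun m => binomTail_le_succ_left h0 h1 m k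

theorem binomTail_mul_le_add (h0 : 0 ≤ p) (h1 : p ≤ 1) (m₁ m₂ k₁ k₂ : ℕ) :
    binomTail p m₁ k₁ * binomTail p m₂ k₂ ≤ binomTail p (m₁ + m₂) (k₁ + k₂) := by
  induction m₁ generalizing k₁ with
  | zero =>
    cases k₁ with
    | zero => simp
    | succ k =>
      simpa using binomTail_nonneg h0 h1 _ _
  | succ m ih =>
    cases k₁ with
    | zero => simpa using binomTail_mono_left h0 h1 k₂ (by omega : m₂ ≤ m + 1 + m₂)
    | succ k =>
      rw [show m + 1 + m₂ = (m + m₂) + 1 by ring, show k + 1 + k₂ = (k + k₂) + 1 by ring,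
        binomTail_succ_succ, binomTail_succ_succ]
      have := mul_le_mul_of_nonneg_left (ih k) h0
      have := mul_le_mul_of_nonneg_left (ih (k + 1)) (sub_nonneg.2 h1)
      rw [show k + 1 + k₂ = k + k₂ + 1 by ring] at this
      linarith

theorem binomTail_one_right (m : ℕ) : binomTail p m 1 = 1 - (1 - p) ^ m := by
  induction m with
  | zero => simp
  | succ m ih => rw [binomTail_succ_succ, ih, binomTail_zero_right]; ring

/-- Splitting the trials into `j` groups of size `m` with at least one success each. -/
theorem pow_le_binomTail (h0 : 0 ≤ p) (h1 : p ≤ 1) {m j N : ℕ} (hN : j * m ≤ N) :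
    (1 - (1 - p) ^ m) ^ j ≤ binomTail p N j := by
  refine le_trans ?_ (binomTail_mono_left h0 h1 j hN)
  have hnn : (0 : ℝ) ≤ 1 - (1 - p) ^ m :=
    sub_nonneg.2 (pow_le_one₀ (by linarith) (by linarith))
  clear hN
  induction j with
  | zero => simp
  | succ j ih =>
    rw [pow_succ, add_mul, one_mul]
    refine le_trans ?_ (binomTail_mul_le_add h0 h1 _ _ _ _)
    rw [binomTail_one_right]
    exact mul_le_mul_of_nonneg_right ih hnn

end BinomTail

section Hits

variable {ι T : Type*} [Fintype ι] [DecidableEq ι] [MeasurableSpace T]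

open scoped Classical in
/-- The number of indices in `S` at which `x` lies in `A`. -/
noncomputable def hits {ι T : Type*} (S : Finset ι) (A : Set T) (x : ι → T) : ℕ :=
  (S.filter fun l => x l ∈ A).card

open scoped Classical in
theorem hits_insert {ι T : Type*} [DecidableEq ι] {S : Finset ι} {j : ι} (hj : j ∉ S) (A : Set T)
    (x : ι → T) :
    hits (insert j S) A x = hits S A x + if x j ∈ A then 1 else 0 := by
  unfold hits
  rw [Finset.filter_insert]
  split_ifs with h
  · rw [Finset.card_insert_of_notMem (by simp [hj])]
  · simp

theorem hits_update {ι T : Type*} [DecidableEq ι] {S : Finset ι} {j : ι} (hj : j ∉ S) (A : Set T)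
    (x : ι → T) (t : T) :
    hits S A (Function.update x j t) = hits S A x := by
  classical
  unfold hits
  congr 1
  refine Finset.filter_congr fun l hl => ?_
  rw [Function.update_of_ne (ne_of_mem_of_not_mem hl hj)]

theorem hits_le_card {ι T : Type*} (S : Finset ι) (A : Set T) (x : ι → T) :
    hits S A x ≤ S.card := by
  classical
  exact Finset.card_filter_le _ _

theorem measurable_hits {ι T : Type*} [MeasurableSpace T] (S : Finset ι) {A : Set T}
    (hA : MeasurableSet A) : Measurable (hits (ι := ι) S A) := by
  classical
  unfold hits
  simp_rw [Finset.card_filter]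
  refine Finset.measurable_sum _ fun l _ => Measurable.ite ?_ measurable_const measurable_const
  exact measurable_pi_apply l hA

variable (U : Measure T) [IsProbabilityMeasure U]

theorem integral_mul_of_update_eq {φ : T → ℝ} (hφ : Measurable φ) {C : ℝ} (hφC : ∀ t, |φ t| ≤ C)
    {G : (ι → T) → ℝ} (hG : Measurable G) {D : ℝ} (hGD : ∀ x, |G x| ≤ D) (j : ι)
    (hGj : ∀ x t, G (Function.update x j t) = G x) :
    ∫ x, φ (x j) * G x ∂(Measure.pi fun _ : ι => U) =
      (∫ t, φ t ∂U) * ∫ x, G x ∂(Measure.pi fun _ : ι => U) := by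
  have hm : Measurable (fun x : ι → T => φ (x j) * G x) :=
    (hφ.comp (measurable_pi_apply j)).mul hG
  rw [integral_pi_update (fun _ : ι => U) hm (C := C * D) (fun x => ?_) j]
  · simp only [Function.update_self, hGj, integral_const_mul, integral_mul_const]
  · rw [abs_mul]
    exact mul_le_mul (hφC _) (hGD _) (abs_nonneg _) ((abs_nonneg _).trans (hφC (x j)))

open scoped Classical in
/-- The indicator of `k ≤ hits S A x`. -/
noncomputable def hitsInd {ι T : Type*} (S : Finset ι) (A : Set T) (k : ℕ) (x : ι → T) : ℝ :=
  if k ≤ hits S A x then 1 else 0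

theorem abs_hitsInd_le {ι T : Type*} (S : Finset ι) (A : Set T) (k : ℕ) (x : ι → T) :
    |hitsInd S A k x| ≤ 1 := by
  unfold hitsInd; split_ifs <;> norm_num

theorem measurable_hitsInd {ι T : Type*} [MeasurableSpace T] (S : Finset ι) {A : Set T}
    (hA : MeasurableSet A) (k : ℕ) : Measurable (hitsInd (ι := ι) S A k) := by
  unfold hitsInd
  exact Measurable.ite (measurable_hits S hA measurableSet_Ici) measurable_const measurable_const

theorem hitsInd_update {ι T : Type*} [DecidableEq ι] {S : Finset ι} {j : ι} (hj : j ∉ S) (A : Set T)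
    (k : ℕ) (x : ι → T) (t : T) :
    hitsInd S A k (Function.update x j t) = hitsInd S A k x := by
  simp [hitsInd, hits_update hj]

@[simp] theorem hitsInd_zero {ι T : Type*} (S : Finset ι) (A : Set T) (x : ι → T) :
    hitsInd S A 0 x = 1 := by
  simp [hitsInd]

theorem integral_ind {T : Type*} [MeasurableSpace T] (U : Measure T) {A : Set T}
    (hA : MeasurableSet A) :
    ∫ t, A.indicator (fun _ => (1 : ℝ)) t ∂U = U.real A := by
  rw [integral_indicator_const _ hA]; simp

theorem hitsInd_insert_succ {ι T : Type*} [DecidableEq ι] {S : Finset ι} {j : ι} (hj : j ∉ S) (A : Set T)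
    (k : ℕ) (x : ι → T) :
    hitsInd (insert j S) A (k + 1) x = A.indicator (fun _ => (1 : ℝ)) (x j) * hitsInd S A k x +
      Aᶜ.indicator (fun _ => (1 : ℝ)) (x j) * hitsInd S A (k + 1) x := by
  by_cases h : x j ∈ A <;> simp [hitsInd, hits_insert hj, h]

theorem abs_indicator_one_le {α : Type*} (A : Set α) (t : α) :
    |A.indicator (fun _ => (1 : ℝ)) t| ≤ 1 := by
  by_cases h : t ∈ A <;> simp [h]

theorem integrable_fun_add {α : Type*} [MeasurableSpace α] {m : Measure α} {f g : α → ℝ}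
    (hf : Integrable f m) (hg : Integrable g m) : Integrable (fun x => f x + g x) m := hf.add hg

theorem measurable_indicator_one {A : Set T} (hA : MeasurableSet A) :
    Measurable (A.indicator (fun _ => (1 : ℝ))) := measurable_const.indicator hA

theorem integrable_indicator_mul {ι T : Type*} [Fintype ι] [MeasurableSpace T] (U : Measure T)
    [IsProbabilityMeasure U] {G : (ι → T) → ℝ} (hG : Measurable G) {D : ℝ} (hGD : ∀ x, |G x| ≤ D)
    {A : Set T} (hA : MeasurableSet A) (j : ι) :
    Integrable (fun x => A.indicator (fun _ => (1 : ℝ)) (x j) * G x)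
      (Measure.pi fun _ : ι => U) := by
  refine integrable_of_bounded
    (((measurable_indicator_one hA).comp (measurable_pi_apply j)).mul hG) (C := 1 * D) fun x => ?_
  rw [abs_mul]
  exact mul_le_mul (abs_indicator_one_le _ _) (hGD _) (abs_nonneg _) zero_le_one

theorem integral_indicator_mul {G : (ι → T) → ℝ} (hG : Measurable G) {D : ℝ} (hGD : ∀ x, |G x| ≤ D)
    {A : Set T} (hA : MeasurableSet A) (j : ι) (hGj : ∀ x t, G (Function.update x j t) = G x) :
    ∫ x, A.indicator (fun _ => (1 : ℝ)) (x j) * G x ∂(Measure.pi fun _ : ι => U) =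
      U.real A * ∫ x, G x ∂(Measure.pi fun _ : ι => U) := by
  rw [integral_mul_of_update_eq U (measurable_indicator_one hA)
      (abs_indicator_one_le A) hG hGD j hGj,
    integral_ind U hA]

theorem integral_hitsInd {A : Set T} (hA : MeasurableSet A) (S : Finset ι) (k : ℕ) :
    ∫ x, hitsInd S A k x ∂(Measure.pi fun _ : ι => U) = binomTail (U.real A) S.card k := by
  induction S using Finset.induction generalizing k with
  | empty => cases k <;> simp [hitsInd, hits]
  | insert j S hj ih =>
    cases k with
    | zero => simp
    | succ k =>
      simp_rw [hitsInd_insert_succ hj]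
      have h1 := measurable_hitsInd (ι := ι) S hA k
      have h2 := measurable_hitsInd (ι := ι) S hA (k + 1)
      rw [integral_add (integrable_indicator_mul U h1 (abs_hitsInd_le S A k) hA j)
        (integrable_indicator_mul U h2 (abs_hitsInd_le S A _) hA.compl j),
        integral_indicator_mul U h1 (abs_hitsInd_le S A k) hA j (hitsInd_update hj A k),
        integral_indicator_mul U h2 (abs_hitsInd_le S A _) hA.compl j (hitsInd_update hj A _),
        ih, ih, Finset.card_insert_of_notMem hj, binomTail_succ_succ, probReal_compl_eq_one_sub hA]

/-- The numbers of hits of two disjoint sets are negatively correlated. -/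
theorem integral_hitsInd_mul_le {A B : Set T} (hA : MeasurableSet A) (hB : MeasurableSet B)
    (hAB : Disjoint A B) (S : Finset ι) (k l : ℕ) :
    ∫ x, hitsInd S A k x * hitsInd S B l x ∂(Measure.pi fun _ : ι => U) ≤
      binomTail (U.real A) S.card k * binomTail (U.real B) S.card l := by
  induction S using Finset.induction generalizing k l with
  | empty => cases k <;> cases l <;> simp [hitsInd, hits]
  | insert j S hj ih =>
    cases k with
    | zero => simp [integral_hitsInd U hB]
    | succ k =>
      cases l with
      | zero => simp [integral_hitsInd U hA]
      | succ l =>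
        have hC : MeasurableSet (A ∪ B)ᶜ := (hA.union hB).compl
        have e : ∀ x : ι → T, hitsInd (insert j S) A (k + 1) x * hitsInd (insert j S) B (l + 1) x =
            A.indicator (fun _ => (1 : ℝ)) (x j) * (hitsInd S A k x * hitsInd S B (l + 1) x) +
            (B.indicator (fun _ => (1 : ℝ)) (x j) * (hitsInd S A (k + 1) x * hitsInd S B l x) +
            (A ∪ B)ᶜ.indicator (fun _ => (1 : ℝ)) (x j) *
              (hitsInd S A (k + 1) x * hitsInd S B (l + 1) x)) := by
          intro x
          rw [hitsInd_insert_succ hj, hitsInd_insert_succ hj]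
          by_cases h : x j ∈ A
          · have h' : x j ∉ B := Set.disjoint_left.1 hAB h
            simp [h, h']
          · by_cases h' : x j ∈ B <;> simp [h, h']
        have hm : ∀ a b, Measurable (fun x : ι → T => hitsInd S A a x * hitsInd S B b x) :=
          fun a b => (measurable_hitsInd S hA a).mul (measurable_hitsInd S hB b)
        have hb : ∀ a b (x : ι → T), |hitsInd S A a x * hitsInd S B b x| ≤ 1 := fun a b x => by
          rw [abs_mul]
          exact mul_le_one₀ (abs_hitsInd_le _ _ _ _) (abs_nonneg _) (abs_hitsInd_le _ _ _ _)
        have hu : ∀ a b (x : ι → T) t, hitsInd S A a (Function.update x j t) *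
            hitsInd S B b (Function.update x j t) = hitsInd S A a x * hitsInd S B b x :=
          fun a b x t => by rw [hitsInd_update hj, hitsInd_update hj]
        simp_rw [e]
        rw [integral_add (integrable_indicator_mul U (hm _ _) (hb _ _) hA j)
          (integrable_fun_add (integrable_indicator_mul U (hm _ _) (hb _ _) hB j)
            (integrable_indicator_mul U (hm _ _) (hb _ _) hC j)),
          integral_add (integrable_indicator_mul U (hm _ _) (hb _ _) hB j)
            (integrable_indicator_mul U (hm _ _) (hb _ _) hC j),
          integral_indicator_mul U (hm _ _) (hb _ _) hA j (hu _ _),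
          integral_indicator_mul U (hm _ _) (hb _ _) hB j (hu _ _),
          integral_indicator_mul U (hm _ _) (hb _ _) hC j (hu _ _)]
        have hCv : U.real (A ∪ B)ᶜ = 1 - U.real A - U.real B := by
          rw [probReal_compl_eq_one_sub (hA.union hB), measureReal_union hAB hB]; ring
        rw [Finset.card_insert_of_notMem hj, binomTail_succ_succ, binomTail_succ_succ]
        have hA0 : 0 ≤ U.real A := measureReal_nonneg
        have hB0 : 0 ≤ U.real B := measureReal_nonneg
        have hC0 : 0 ≤ U.real (A ∪ B)ᶜ := measureReal_nonneg
        have i1 := mul_le_mul_of_nonneg_left (ih k (l + 1)) hA0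
        have i2 := mul_le_mul_of_nonneg_left (ih (k + 1) l) hB0
        have i3 := mul_le_mul_of_nonneg_left (ih (k + 1) (l + 1)) hC0
        rw [hCv] at i3 ⊢
        have u := sub_nonneg.2 (binomTail_succ_right_le hA0 (measureReal_le_one) S.card k)
        have v := sub_nonneg.2 (binomTail_succ_right_le hB0 (measureReal_le_one) S.card l)
        have := mul_nonneg (mul_nonneg hA0 hB0) (mul_nonneg u v)
        nlinarith

theorem integral_hits_mul_hitsInd_le {A A₂ : Set T} (hA : MeasurableSet A) (hA₂ : MeasurableSet A₂)
    (hAA : A ⊆ A₂) (S : Finset ι) (k : ℕ) :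
    ∫ x, (hits S A₂ x : ℝ) * hitsInd S A k x ∂(Measure.pi fun _ : ι => U) ≤
      (k + S.card * U.real A₂) * binomTail (U.real A) S.card k := by
  have hA0 : 0 ≤ U.real A := measureReal_nonneg
  have hA1 : U.real A ≤ 1 := measureReal_le_one
  induction S using Finset.induction generalizing k with
  | empty => cases k <;> simp [hitsInd, hits]
  | insert j S hj ih =>
    have hD : MeasurableSet (A₂ \ A) := hA₂.diff hA
    have hDv : U.real (A₂ \ A) = U.real A₂ - U.real A := measureReal_sdiff hAA hA
    have hm : ∀ a, Measurable (fun x : ι → T => (hits S A₂ x : ℝ) * hitsInd S A a x) :=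
      fun a => (measurable_from_top.comp (measurable_hits S hA₂)).mul (measurable_hitsInd S hA a)
    have hb : ∀ a (x : ι → T), |(hits S A₂ x : ℝ) * hitsInd S A a x| ≤ S.card * 1 := fun a x => by
      rw [abs_mul, Nat.abs_cast]
      exact mul_le_mul (by exact_mod_cast hits_le_card _ _ _) (abs_hitsInd_le _ _ _ _)
        (abs_nonneg _) (by positivity)
    have hu : ∀ a (x : ι → T) t, (hits S A₂ (Function.update x j t) : ℝ) *
        hitsInd S A a (Function.update x j t) = hits S A₂ x * hitsInd S A a x :=
      fun a x t => by rw [hits_update hj, hitsInd_update hj]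
    have hm1 : ∀ a, Measurable (hitsInd (ι := ι) S A a) := fun a => measurable_hitsInd S hA a
    have hb1 : ∀ a (x : ι → T), |hitsInd S A a x| ≤ 1 := fun a => abs_hitsInd_le S A a
    have hu1 := fun a => hitsInd_update hj A a
    have hint : ∀ a, Integrable (fun x : ι → T => (hits S A₂ x : ℝ) * hitsInd S A a x)
      (Measure.pi fun _ : ι => U) := fun a => integrable_of_bounded (hm a) (hb a)
    have hcard : ((insert j S).card : ℝ) = S.card + 1 := by
      rw [Finset.card_insert_of_notMem hj]; push_cast; ring
    cases k with
    | zero =>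
      have e : ∀ x : ι → T, (hits (insert j S) A₂ x : ℝ) * hitsInd (insert j S) A 0 x =
          (hits S A₂ x : ℝ) * hitsInd S A 0 x +
            A₂.indicator (fun _ => (1 : ℝ)) (x j) * hitsInd S A 0 x := by
        intro x
        by_cases h : x j ∈ A₂ <;> simp [hits_insert hj, h]
      simp_rw [e]
      rw [integral_add (hint 0) (integrable_indicator_mul U (hm1 0) (hb1 0) hA₂ j),
        integral_indicator_mul U (hm1 0) (hb1 0) hA₂ j (hu1 0), integral_hitsInd U hA, hcard]
      have := ih 0
      simp only [binomTail_zero_right] at this ⊢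
      push_cast at this ⊢
      linarith
    | succ k =>
      have e : ∀ x : ι → T, (hits (insert j S) A₂ x : ℝ) * hitsInd (insert j S) A (k + 1) x =
          A.indicator (fun _ => (1 : ℝ)) (x j) * ((hits S A₂ x : ℝ) * hitsInd S A k x) +
          (A.indicator (fun _ => (1 : ℝ)) (x j) * hitsInd S A k x +
          (Aᶜ.indicator (fun _ => (1 : ℝ)) (x j) * ((hits S A₂ x : ℝ) * hitsInd S A (k + 1) x) +
          (A₂ \ A).indicator (fun _ => (1 : ℝ)) (x j) * hitsInd S A (k + 1) x)) := by
        intro x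
        rw [hitsInd_insert_succ hj, hits_insert hj]
        by_cases h : x j ∈ A
        · have h' := hAA h
          simp [h, h']; ring
        · by_cases h' : x j ∈ A₂
          · simp [h, h']; ring
          · simp [h, h']
      simp_rw [e]
      rw [integral_add (integrable_indicator_mul U (hm _) (hb _) hA j)
          (integrable_fun_add (integrable_indicator_mul U (hm1 _) (hb1 _) hA j)
            (integrable_fun_add (integrable_indicator_mul U (hm _) (hb _) hA.compl j)
              (integrable_indicator_mul U (hm1 _) (hb1 _) hD j))),
        integral_add (integrable_indicator_mul U (hm1 _) (hb1 _) hA j)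
            (integrable_fun_add (integrable_indicator_mul U (hm _) (hb _) hA.compl j)
              (integrable_indicator_mul U (hm1 _) (hb1 _) hD j)),
        integral_add (integrable_indicator_mul U (hm _) (hb _) hA.compl j)
              (integrable_indicator_mul U (hm1 _) (hb1 _) hD j),
        integral_indicator_mul U (hm _) (hb _) hA j (hu _),
        integral_indicator_mul U (hm1 _) (hb1 _) hA j (hu1 _),
        integral_indicator_mul U (hm _) (hb _) hA.compl j (hu _),
        integral_indicator_mul U (hm1 _) (hb1 _) hD j (hu1 _),
        integral_hitsInd U hA, integral_hitsInd U hA, hDv, probReal_compl_eq_one_sub hA, hcard,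
        Finset.card_insert_of_notMem hj, binomTail_succ_succ]
      have i1 := mul_le_mul_of_nonneg_left (ih k) hA0
      have i2 := mul_le_mul_of_nonneg_left (ih (k + 1)) (sub_nonneg.2 hA1)
      have hmono := binomTail_succ_right_le hA0 hA1 S.card k
      have hle : U.real A ≤ U.real A₂ := measureReal_mono hAA
      have i3 := mul_nonneg (mul_nonneg (hA0.trans hle) hA0) (sub_nonneg.2 hmono)
      have i4 := mul_nonneg hA0 (binomTail_nonneg hA0 hA1 S.card (k + 1))
      push_cast at i1 i2 ⊢
      linarith

end Hits

theorem integral_comp_measurePreserving {α β : Type*} [MeasurableSpace α] [MeasurableSpace β]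
    {m : Measure α} {m' : Measure β} {g : α → β} (h : MeasurePreserving g m m') {f : β → ℝ}
    (hf : Measurable f) : ∫ x, f (g x) ∂m = ∫ y, f y ∂m' := by
  rw [← h.map_eq, integral_map h.measurable.aemeasurable hf.aestronglyMeasurable]

section Cayley

variable {T : Type*} [AddCommGroup T]

/-- The graph on `Fin n` in which distinct `i`, `j` are joined when `x i - x j ∈ K`. -/
def cayleyGraph {n : ℕ} (K : Set T) (x : Fin n → T) : SimpleGraph (Fin n) :=
  SimpleGraph.fromRel (fun i j => x i - x j ∈ K)

theorem cayleyGraph_adj {n : ℕ} {K : Set T} (hK : ∀ t ∈ K, -t ∈ K) (x : Fin n → T) (i j : Fin n) :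
    (cayleyGraph K x).Adj i j ↔ i ≠ j ∧ x i - x j ∈ K := by
  rw [cayleyGraph, SimpleGraph.fromRel_adj]
  refine and_congr_right fun _ => ⟨?_, Or.inl⟩
  rintro (h | h)
  · exact h
  · simpa using hK _ h

/-- The configuration seen from the point with index `i`. -/
def seenFrom {n : ℕ} (i : Fin n) (x : Fin n → T) : Fin n → T :=
  fun l => if l ∈ Finset.univ.erase i then x l - x i else x l

theorem seenFrom_of_ne {n : ℕ} {i l : Fin n} (h : l ≠ i) (x : Fin n → T) :
    seenFrom i x l = x l - x i := by simp [seenFrom, h]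

theorem vertexDegree_cayleyGraph {n : ℕ} {K : Set T} (hK : ∀ t ∈ K, -t ∈ K) (x : Fin n → T)
    (i : Fin n) :
    vertexDegree (cayleyGraph K x) i = hits (Finset.univ.erase i) K (seenFrom i x) := by
  classical
  unfold vertexDegree hits
  rw [← SimpleGraph.card_neighborFinset_eq_degree]
  congr 1
  ext l
  simp only [SimpleGraph.mem_neighborFinset, cayleyGraph_adj hK, Finset.mem_filter,
    Finset.mem_erase, Finset.mem_univ, and_true]
  constructor
  · rintro ⟨h1, h2⟩
    refine ⟨h1.symm, ?_⟩
    rw [seenFrom_of_ne h1.symm]; simpa using hK _ h2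
  · rintro ⟨h1, h2⟩
    rw [seenFrom_of_ne h1] at h2
    exact ⟨h1.symm, by simpa using hK _ h2⟩

variable [MeasurableSpace T] [MeasurableAdd₂ T] [MeasurableNeg T]

theorem measurable_sub_mem {n : ℕ} {K : Set T} (hKm : MeasurableSet K) (i j : Fin n) :
    MeasurableSet {x : Fin n → T | x i - x j ∈ K} := by
  have : Measurable (fun x : Fin n → T => x i - x j) :=
    (measurable_pi_apply i).sub (measurable_pi_apply j)
  exact this hKm

theorem measurableSet_cayleyGraph {n : ℕ} {K : Set T} (hKm : MeasurableSet K)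
    (Q : SimpleGraph (Fin n) → Prop) : MeasurableSet {x : Fin n → T | Q (cayleyGraph K x)} := by
  have hfin : Finite (SimpleGraph (Fin n)) :=
    Finite.of_injective (fun G => G.Adj) fun G H h => SimpleGraph.ext h
  have h1 : ∀ G : SimpleGraph (Fin n), MeasurableSet {x : Fin n → T | cayleyGraph K x = G} := by
    intro G
    have : {x : Fin n → T | cayleyGraph K x = G} =
        ⋂ i, ⋂ j, {x | (cayleyGraph K x).Adj i j ↔ G.Adj i j} := by
      ext x
      simp only [Set.mem_iInter, Set.mem_ofPred_eq]
      exact ⟨fun h i j => by rw [h],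
        fun h => SimpleGraph.ext (by funext i j; exact propext (h i j))⟩
    rw [this]
    refine MeasurableSet.iInter fun i => MeasurableSet.iInter fun j => ?_
    have h2 : MeasurableSet {x : Fin n → T | (cayleyGraph K x).Adj i j} := by
      simp only [cayleyGraph, SimpleGraph.fromRel_adj]
      by_cases hij : i = j
      · simp [hij]
      · simp only [ne_eq, hij, not_false_eq_true, true_and]
        exact (measurable_sub_mem hKm i j).union (measurable_sub_mem hKm j i)
    by_cases hG : G.Adj i j
    · simpa [hG] using h2
    · simp only [hG, iff_false]
      exact h2.compl
  have : {x : Fin n → T | Q (cayleyGraph K x)} =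
      ⋃ G ∈ {G : SimpleGraph (Fin n) | Q G}, {x | cayleyGraph K x = G} := by
    ext x; simp
  rw [this]
  exact MeasurableSet.biUnion (Set.toFinite _).countable fun G _ => h1 G

theorem measurable_cayleyGraph {n : ℕ} {K : Set T} (hKm : MeasurableSet K)
    (F : SimpleGraph (Fin n) → ℝ) : Measurable (fun x : Fin n → T => F (cayleyGraph K x)) :=
  fun s _ => measurableSet_cayleyGraph hKm fun G => F G ∈ s

variable (U : Measure T) [IsProbabilityMeasure U] [U.IsAddRightInvariant]

theorem measurePreserving_seenFrom {n : ℕ} (i : Fin n) :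
    MeasurePreserving (seenFrom (T := T) i) (Measure.pi fun _ => U) (Measure.pi fun _ => U) :=
  measurePreserving_shear U i (Finset.univ.erase i) (by simp)

open scoped Classical in
/-- The indicator that the vertex `i` has degree at least `k`. -/
noncomputable def degreeInd {n : ℕ} (k : ℕ) (G : SimpleGraph (Fin n)) (i : Fin n) : ℝ :=
  if k ≤ vertexDegree G i then 1 else 0

theorem degreeInd_nonneg {n : ℕ} (k : ℕ) (G : SimpleGraph (Fin n)) (i : Fin n) :
    0 ≤ degreeInd k G i := by
  unfold degreeInd; split_ifs <;> norm_num

theorem degreeInd_le_one {n : ℕ} (k : ℕ) (G : SimpleGraph (Fin n)) (i : Fin n) :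
    degreeInd k G i ≤ 1 := by
  unfold degreeInd; split_ifs <;> norm_num

theorem abs_degreeInd_le_one {n : ℕ} (k : ℕ) (G : SimpleGraph (Fin n)) (i : Fin n) :
    |degreeInd k G i| ≤ 1 := by
  rw [abs_of_nonneg (degreeInd_nonneg k G i)]; exact degreeInd_le_one k G i

theorem degreeInd_cayleyGraph {T : Type*} [AddCommGroup T] {n : ℕ} {K : Set T}
    (hK : ∀ t ∈ K, -t ∈ K) (x : Fin n → T)
    (k : ℕ) (i : Fin n) :
    degreeInd k (cayleyGraph K x) i = hitsInd (Finset.univ.erase i) K k (seenFrom i x) := by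
  simp only [degreeInd, hitsInd, vertexDegree_cayleyGraph hK]

theorem integral_degreeInd {n : ℕ} {K : Set T} (hKm : MeasurableSet K) (hK : ∀ t ∈ K, -t ∈ K)
    (k : ℕ) (i : Fin n) :
    ∫ x, degreeInd k (cayleyGraph K x) i ∂(Measure.pi fun _ : Fin n => U) =
      binomTail (U.real K) (n - 1) k := by
  simp_rw [degreeInd_cayleyGraph hK]
  rw [integral_comp_measurePreserving (measurePreserving_seenFrom U i)
    (measurable_hitsInd _ hKm k), integral_hitsInd U hKm]
  simp

open scoped Classical in
theorem integral_degreeInd_mul_far_le {n : ℕ} {K K₂ : Set T} (hKm : MeasurableSet K)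
    (hK : ∀ t ∈ K, -t ∈ K) (hK₂m : MeasurableSet K₂) (hKK : K ⊆ K₂)
    (hK₂ : ∀ s ∈ K, ∀ t ∈ K, s - t ∈ K₂) (k : ℕ) {i j : Fin n} (hij : i ≠ j) :
    ∫ x, (if x j - x i ∈ K₂ then 0
      else degreeInd k (cayleyGraph K x) i * degreeInd k (cayleyGraph K x) j)
        ∂(Measure.pi fun _ : Fin n => U) ≤ binomTail (U.real K) (n - 1) k ^ 2 := by
  set S : Finset (Fin n) := (Finset.univ.erase i).erase j with hS
  have hiS : i ∉ S := by simp [hS]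
  have hjS : j ∉ S := by simp [hS]
  set H : (Fin n → T) → ℝ := fun y => if y j ∈ K₂ then 0 else
    hitsInd S K k y * hitsInd S {t | t - y j ∈ K} k y with hH
  have hbase : ∀ t, MeasurableSet {s : T | s - t ∈ K} := fun t =>
    (measurable_id.sub_const t) hKm
  have hHm : Measurable H := by
    have h1 : Measurable (fun y : Fin n → T => hits S {t | t - y j ∈ K} y) := by
      unfold hits
      simp_rw [Finset.card_filter]
      refine Finset.measurable_sum _ fun l _ => Measurable.ite ?_ measurable_const measurable_const
      exact measurable_sub_mem hKm l j
    refine Measurable.ite (measurable_pi_apply j hK₂m) measurable_const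
      ((measurable_hitsInd S hKm k).mul ?_)
    unfold hitsInd
    exact Measurable.ite (h1 measurableSet_Ici) measurable_const measurable_const
  have hHb : ∀ y, |H y| ≤ 1 := fun y => by
    simp only [hH]; split_ifs
    · simp
    · rw [abs_mul]
      exact mul_le_one₀ (abs_hitsInd_le _ _ _ _) (abs_nonneg _) (abs_hitsInd_le _ _ _ _)
  have hcongr : ∀ x : Fin n → T, (if x j - x i ∈ K₂ then 0
      else degreeInd k (cayleyGraph K x) i * degreeInd k (cayleyGraph K x) j) =
        H (seenFrom i x) := by
    intro x
    simp only [hH, seenFrom_of_ne hij.symm]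
    split_ifs with h
    · rfl
    · have hnot : x j - x i ∉ K := fun h' => h (hKK h')
      have hnot' : x i - x j ∉ K := fun h' => hnot (by simpa using hK _ h')
      rw [degreeInd_cayleyGraph hK, degreeInd_cayleyGraph hK]
      congr 1
      · have : hits (Finset.univ.erase i) K (seenFrom i x) = hits S K (seenFrom i x) := by
          unfold hits
          congr 1
          ext l
          by_cases hl : l = j
          · subst hl; simp [hS, seenFrom_of_ne hij.symm, hnot]
          · simp [hS, hl]
        simp only [hitsInd, this]
      · have : hits (Finset.univ.erase j) K (seenFrom j x) =
            hits S {t | t - (x j - x i) ∈ K} (seenFrom i x) := by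
          unfold hits
          congr 1
          ext l
          by_cases hl : l = i
          · subst hl; simp [hS, seenFrom_of_ne hij, hnot']
          · by_cases hl' : l = j
            · subst hl'; simp [hS]
            · simp [hS, hl, hl', seenFrom_of_ne]
        simp only [hitsInd, this]
  simp_rw [hcongr]
  rw [integral_comp_measurePreserving (measurePreserving_seenFrom U i)
    hHm, integral_pi_update (fun _ : Fin n => U) hHm hHb j]
  have hp0 : 0 ≤ U.real K := measureReal_nonneg
  have hp1 : U.real K ≤ 1 := measureReal_le_one
  have hbound : ∀ t, ∫ y, H (Function.update y j t) ∂(Measure.pi fun _ : Fin n => U) ≤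
      binomTail (U.real K) (n - 1) k ^ 2 := by
    intro t
    simp only [hH, Function.update_self, hitsInd_update hjS]
    split_ifs with h
    · simp only [integral_zero]; positivity
    · have hdisj : Disjoint K {s | s - t ∈ K} := by
        rw [Set.disjoint_left]
        intro s hs hs'
        exact h (by simpa using hK₂ s hs (s - t) hs')
      have hinv : U.real {s : T | s - t ∈ K} = U.real K := by
        simp only [measureReal_def]
        congr 1
        exact (measurePreserving_sub_right U t).measure_preimage hKm.nullMeasurableSet
      refine (integral_hitsInd_mul_le U hKm (hbase t) hdisj S k k).trans ?_
      rw [hinv, ← sq]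
      have hc : S.card ≤ n - 1 := by
        refine (Finset.card_erase_le).trans ?_
        simp
      gcongr
      · exact binomTail_nonneg hp0 hp1 _ _
      · exact binomTail_mono_left hp0 hp1 k hc
  calc _ ≤ ∫ _ : T, binomTail (U.real K) (n - 1) k ^ 2 ∂U := by
        refine integral_mono ?_ (integrable_const _) hbound
        have h := measurePreserving_pi_update (fun _ : Fin n => U) j
        exact (integrable_of_bounded (m := U.prod (Measure.pi fun _ : Fin n => U))
          (hHm.comp h.measurable) fun x => hHb _).integral_prod_left
    _ = _ := by simp

theorem integral_degreeInd_mul_near_le {n : ℕ} {K K₂ : Set T} (hKm : MeasurableSet K)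
    (hK : ∀ t ∈ K, -t ∈ K) (hK₂m : MeasurableSet K₂) (hKK : K ⊆ K₂) (k : ℕ) (i : Fin n) :
    ∫ x, (hits (Finset.univ.erase i) K₂ (seenFrom i x) : ℝ) * degreeInd k (cayleyGraph K x) i
        ∂(Measure.pi fun _ : Fin n => U) ≤
      (k + n * U.real K₂) * binomTail (U.real K) (n - 1) k := by
  simp_rw [degreeInd_cayleyGraph hK]
  have hm : Measurable (fun y : Fin n → T => (hits (Finset.univ.erase i) K₂ y : ℝ) *
      hitsInd (Finset.univ.erase i) K k y) :=
    (measurable_from_top.comp (measurable_hits _ hK₂m)).mul (measurable_hitsInd _ hKm k)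
  rw [integral_comp_measurePreserving (measurePreserving_seenFrom U i)
    hm]
  refine (integral_hits_mul_hitsInd_le U hKm hK₂m hKK _ k).trans ?_
  have h0 := binomTail_nonneg (p := U.real K) measureReal_nonneg measureReal_le_one (n - 1) k
  have hc : (Finset.univ.erase i : Finset (Fin n)).card = n - 1 := by simp
  rw [hc]
  gcongr
  omega

/-- The number of vertices of degree at least `k`. -/
noncomputable def degreeCount {n : ℕ} (k : ℕ) (G : SimpleGraph (Fin n)) : ℝ :=
  ∑ i, degreeInd k G i

open scoped Classical in
theorem sum_degreeInd_mul_le {T : Type*} [AddCommGroup T] {n : ℕ} {K K₂ : Set T} (k : ℕ)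
    (x : Fin n → T) (i : Fin n) :
    ∑ j, degreeInd k (cayleyGraph K x) i * degreeInd k (cayleyGraph K x) j ≤
      degreeInd k (cayleyGraph K x) i + ((∑ j ∈ Finset.univ.erase i, (if x j - x i ∈ K₂ then 0
        else degreeInd k (cayleyGraph K x) i * degreeInd k (cayleyGraph K x) j)) +
      (hits (Finset.univ.erase i) K₂ (seenFrom i x) : ℝ) * degreeInd k (cayleyGraph K x) i) := by
  rw [← Finset.add_sum_erase _ _ (Finset.mem_univ i)]
  set D := degreeInd k (cayleyGraph K x) with hD
  have h1 : D i * D i ≤ D i := by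
    have := degreeInd_nonneg k (cayleyGraph K x) i
    have := degreeInd_le_one k (cayleyGraph K x) i
    nlinarith
  have h2 : (hits (Finset.univ.erase i) K₂ (seenFrom i x) : ℝ) * D i =
      ∑ j ∈ Finset.univ.erase i, if x j - x i ∈ K₂ then D i else 0 := by
    unfold hits
    rw [Finset.card_filter]
    push_cast
    rw [Finset.sum_mul]
    refine Finset.sum_congr rfl fun j hj => ?_
    rw [seenFrom_of_ne (Finset.ne_of_mem_erase hj)]
    split_ifs <;> simp
  rw [h2, ← Finset.sum_add_distrib]
  refine add_le_add h1 (Finset.sum_le_sum fun j _ => ?_)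
  have := degreeInd_nonneg k (cayleyGraph K x) i
  have := degreeInd_le_one k (cayleyGraph K x) j
  split_ifs
  · simp only [zero_add]; exact mul_le_of_le_one_right ‹_› ‹_›
  · simp [hD]

theorem integral_degreeCount {n : ℕ} {K : Set T} (hKm : MeasurableSet K) (hK : ∀ t ∈ K, -t ∈ K)
    (k : ℕ) :
    ∫ x, degreeCount k (cayleyGraph K x) ∂(Measure.pi fun _ : Fin n => U) =
      n * binomTail (U.real K) (n - 1) k := by
  unfold degreeCount
  rw [integral_finsetSum]
  · simp [integral_degreeInd U hKm hK]
  · exact fun i _ => integrable_of_bounded (measurable_cayleyGraph hKm fun G => degreeInd k G i)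
      fun x => abs_degreeInd_le_one _ _ _

theorem integral_degreeCount_sq_le {n : ℕ} {K K₂ : Set T} (hKm : MeasurableSet K)
    (hK : ∀ t ∈ K, -t ∈ K) (hK₂m : MeasurableSet K₂) (hKK : K ⊆ K₂)
    (hK₂ : ∀ s ∈ K, ∀ t ∈ K, s - t ∈ K₂) (k : ℕ) :
    ∫ x, degreeCount k (cayleyGraph K x) ^ 2 ∂(Measure.pi fun _ : Fin n => U) ≤
      (n * binomTail (U.real K) (n - 1) k) ^ 2 +
      (1 + k + n * U.real K₂) * (n * binomTail (U.real K) (n - 1) k) := by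
  classical
  set b := binomTail (U.real K) (n - 1) k with hb
  set P : Measure (Fin n → T) := Measure.pi fun _ : Fin n => U with hP
  have e : ∀ x : Fin n → T, degreeCount k (cayleyGraph K x) ^ 2 =
      ∑ i, ∑ j, degreeInd k (cayleyGraph K x) i * degreeInd k (cayleyGraph K x) j := fun x => by
    rw [sq, degreeCount, Finset.sum_mul_sum]
  have hDm := fun i : Fin n => measurable_cayleyGraph (n := n) hKm fun G => degreeInd k G i
  have hDD : ∀ i j : Fin n, Integrable (fun x => degreeInd k (cayleyGraph K x) i *
      degreeInd k (cayleyGraph K x) j) P := fun i j =>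
    integrable_of_bounded ((hDm i).mul (hDm j)) (C := 1) fun x => by
      rw [abs_mul]
      exact mul_le_one₀ (abs_degreeInd_le_one _ _ _) (abs_nonneg _) (abs_degreeInd_le_one _ _ _)
  have hI1 : ∀ i : Fin n, Integrable (fun x => degreeInd k (cayleyGraph K x) i) P := fun i =>
    integrable_of_bounded (hDm i) fun x => abs_degreeInd_le_one _ _ _
  have hI2 : ∀ i j : Fin n, Integrable (fun x : Fin n → T => if x j - x i ∈ K₂ then 0
        else degreeInd k (cayleyGraph K x) i * degreeInd k (cayleyGraph K x) j) P := fun i j =>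
    integrable_of_bounded (Measurable.ite (measurable_sub_mem hK₂m j i) measurable_const
      ((hDm i).mul (hDm j))) (C := 1) fun x => by
        split_ifs
        · simp
        · rw [abs_mul]
          exact mul_le_one₀ (abs_degreeInd_le_one _ _ _) (abs_nonneg _)
            (abs_degreeInd_le_one _ _ _)
  have hI3 : ∀ i : Fin n, Integrable (fun x : Fin n → T =>
      (hits (Finset.univ.erase i) K₂ (seenFrom i x) : ℝ) * degreeInd k (cayleyGraph K x) i) P :=
    fun i => by
      refine integrable_of_bounded ((measurable_from_top.comp ((measurable_hits _ hK₂m).comp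
        (measurePreserving_seenFrom U i).measurable)).mul (hDm i))
        (C := ((Finset.univ.erase i).card : ℝ) * 1) fun x => ?_
      rw [abs_mul, Nat.abs_cast]
      exact mul_le_mul (by exact_mod_cast hits_le_card _ _ _) (abs_degreeInd_le_one _ _ _)
        (abs_nonneg _) (by positivity)
  simp_rw [e]
  rw [integral_finsetSum _ fun i _ => integrable_finsetSum _ fun j _ => hDD i j]
  have hi : ∀ i : Fin n, ∫ x, ∑ j, degreeInd k (cayleyGraph K x) i *
      degreeInd k (cayleyGraph K x) j ∂P ≤ b + (n * b ^ 2 + (k + n * U.real K₂) * b) := by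
    intro i
    calc _ ≤ ∫ x, (degreeInd k (cayleyGraph K x) i + ((∑ j ∈ Finset.univ.erase i,
          (if x j - x i ∈ K₂ then 0
            else degreeInd k (cayleyGraph K x) i * degreeInd k (cayleyGraph K x) j)) +
          (hits (Finset.univ.erase i) K₂ (seenFrom i x) : ℝ) *
            degreeInd k (cayleyGraph K x) i)) ∂P :=
          integral_mono (integrable_finsetSum _ fun j _ => hDD i j)
            ((hI1 i).add ((integrable_finsetSum _ fun j _ => hI2 i j).add (hI3 i)))
            fun x => sum_degreeInd_mul_le k x i
      _ = b + ((∑ j ∈ Finset.univ.erase i, ∫ x, (if x j - x i ∈ K₂ then 0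
            else degreeInd k (cayleyGraph K x) i * degreeInd k (cayleyGraph K x) j) ∂P) +
          ∫ x, (hits (Finset.univ.erase i) K₂ (seenFrom i x) : ℝ) *
            degreeInd k (cayleyGraph K x) i ∂P) := by
          rw [integral_add (hI1 i) (integrable_fun_add (integrable_finsetSum _ fun j _ => hI2 i j)
            (hI3 i)), integral_add (integrable_finsetSum _ fun j _ => hI2 i j) (hI3 i),
            integral_finsetSum _ fun j _ => hI2 i j, integral_degreeInd U hKm hK]
      _ ≤ _ := by
          gcongr
          · calc _ ≤ ∑ j ∈ Finset.univ.erase i, b ^ 2 := Finset.sum_le_sum fun j hj =>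
                  integral_degreeInd_mul_far_le U hKm hK hK₂m hKK hK₂ k
                    (Finset.ne_of_mem_erase hj).symm
              _ ≤ _ := by
                rw [Finset.sum_const, nsmul_eq_mul]
                gcongr
                simp
          · exact integral_degreeInd_mul_near_le U hKm hK hK₂m hKK k i
  calc _ ≤ ∑ i : Fin n, (b + (n * b ^ 2 + (k + n * U.real K₂) * b)) :=
        Finset.sum_le_sum fun i _ => hi i
    _ = _ := by simp; ring

/-- With high probability at least half of the expected number of vertices have degree `≥ k`. -/
theorem measureReal_degreeCount_lt_le {n : ℕ} {K K₂ : Set T} (hKm : MeasurableSet K)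
    (hK : ∀ t ∈ K, -t ∈ K) (hK₂m : MeasurableSet K₂) (hKK : K ⊆ K₂)
    (hK₂ : ∀ s ∈ K, ∀ t ∈ K, s - t ∈ K₂) (k : ℕ)
    (hpos : 0 < n * binomTail (U.real K) (n - 1) k) :
    (Measure.pi fun _ : Fin n => U).real
      {x | degreeCount k (cayleyGraph K x) < n * binomTail (U.real K) (n - 1) k / 2} ≤
      4 * (1 + k + n * U.real K₂) / (n * binomTail (U.real K) (n - 1) k) := by
  set m := n * binomTail (U.real K) (n - 1) k with hm
  set P : Measure (Fin n → T) := Measure.pi fun _ : Fin n => U with hP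
  have hNm := measurable_cayleyGraph (n := n) hKm fun G => degreeCount k G
  have hNb : ∀ x : Fin n → T, |degreeCount k (cayleyGraph K x)| ≤ n := fun x => by
    unfold degreeCount
    refine (Finset.abs_sum_le_sum_abs _ _).trans ?_
    refine (Finset.sum_le_sum fun i _ => abs_degreeInd_le_one k _ i).trans ?_
    simp
  have hN1 : Integrable (fun x => degreeCount k (cayleyGraph K x)) P :=
    integrable_of_bounded hNm hNb
  have hN2 : Integrable (fun x => degreeCount k (cayleyGraph K x) ^ 2) P :=
    integrable_of_bounded (hNm.pow_const 2) (C := (n : ℝ) ^ 2) fun x => by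
      rw [abs_pow]; gcongr; exact hNb x
  have e : ∀ x : Fin n → T, (degreeCount k (cayleyGraph K x) - m) ^ 2 =
      degreeCount k (cayleyGraph K x) ^ 2 + (-(2 * m) * degreeCount k (cayleyGraph K x) + m ^ 2) :=
    fun x => by ring
  have hI : ∫ x, (degreeCount k (cayleyGraph K x) - m) ^ 2 ∂P ≤ (1 + k + n * U.real K₂) * m := by
    simp_rw [e]
    have hN3 := hN1.const_mul (-(2 * m))
    rw [integral_add hN2 (integrable_fun_add hN3 (integrable_const _)),
      integral_add hN3 (integrable_const _),
      integral_const_mul, integral_degreeCount U hKm hK]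
    have := integral_degreeCount_sq_le U (n := n) hKm hK hK₂m hKK hK₂ k
    simp only [integral_const, probReal_univ, smul_eq_mul, one_mul]
    nlinarith
  have hint : Integrable (fun x => (degreeCount k (cayleyGraph K x) - m) ^ 2) P := by
    simp_rw [e]
    exact hN2.add ((hN1.const_mul (-(2 * m))).add (integrable_const _))
  have hmk := mul_meas_ge_le_integral_of_nonneg (μ := P)
    (f := fun x => (degreeCount k (cayleyGraph K x) - m) ^ 2)
    (Eventually.of_forall fun x => sq_nonneg _) hint (m ^ 2 / 4)
  have hsub : {x : Fin n → T | degreeCount k (cayleyGraph K x) < m / 2} ⊆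
      {x | m ^ 2 / 4 ≤ (degreeCount k (cayleyGraph K x) - m) ^ 2} := by
    intro x hx
    simp only [Set.mem_ofPred_eq] at hx ⊢
    nlinarith
  have h1 := measureReal_mono (μ := P) hsub
  have h2 : m ^ 2 / 4 * P.real {x : Fin n → T | degreeCount k (cayleyGraph K x) < m / 2} ≤
      (1 + k + n * U.real K₂) * m :=
    (mul_le_mul_of_nonneg_left h1 (by positivity)).trans (hmk.trans hI)
  rw [le_div_iff₀ hpos]
  have : m * (P.real {x : Fin n → T | degreeCount k (cayleyGraph K x) < m / 2} * m) ≤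
      m * (4 * (1 + k + n * U.real K₂)) := by nlinarith
  exact le_of_mul_le_mul_left this hpos

end Cayley

section PairCount

/-- The pairs `(a, b)` with `a < b` of elements of `S`. -/
def orderedPairs {n : ℕ} (S : Finset (Fin n)) : Finset (Fin n × Fin n) :=
  (S ×ˢ S).filter fun p => p.1 < p.2

theorem card_orderedPairs {n : ℕ} (S : Finset (Fin n)) :
    (orderedPairs S).card = S.card.choose 2 := by
  have hsplit : S.offDiag = orderedPairs S ∪ (orderedPairs S).image Prod.swap := by
    ext ⟨a, b⟩
    simp only [orderedPairs, Finset.mem_offDiag, Finset.mem_union, Finset.mem_filter,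
      Finset.mem_product, Finset.mem_image, Prod.exists, Prod.swap_prod_mk, Prod.mk.injEq]
    constructor
    · rintro ⟨ha, hb, hab⟩
      rcases lt_or_gt_of_ne hab with h | h
      · exact Or.inl ⟨⟨ha, hb⟩, h⟩
      · exact Or.inr ⟨b, a, ⟨⟨hb, ha⟩, h⟩, rfl, rfl⟩
    · rintro (⟨⟨ha, hb⟩, h⟩ | ⟨b', a', ⟨⟨hb, ha⟩, h⟩, rfl, rfl⟩)
      · exact ⟨ha, hb, h.ne⟩
      · exact ⟨ha, hb, h.ne'⟩
  have hdisj : Disjoint (orderedPairs S) ((orderedPairs S).image Prod.swap) := by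
    rw [Finset.disjoint_left]
    rintro ⟨a, b⟩ h h'
    simp only [orderedPairs, Finset.mem_filter, Finset.mem_product, Finset.mem_image, Prod.exists,
      Prod.swap_prod_mk, Prod.mk.injEq] at h h'
    obtain ⟨b', a', ⟨_, h2⟩, rfl, rfl⟩ := h'
    exact lt_asymm h.2 h2
  have hc := congrArg Finset.card hsplit
  rw [Finset.card_union_of_disjoint hdisj, Finset.card_image_of_injective _ Prod.swap_injective,
    Finset.offDiag_card] at hc
  have hs : S.card * S.card - S.card = S.card * (S.card - 1) := by
    rw [Nat.mul_sub, mul_one]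
  rw [Nat.choose_two_right]
  omega

theorem sq_div_four_le_choose_two {s : ℕ} (hs : 2 ≤ s) : (s : ℝ) ^ 2 / 4 ≤ (s.choose 2 : ℝ) := by
  rw [Nat.cast_choose_two]
  have : (2 : ℝ) ≤ s := by exact_mod_cast hs
  nlinarith

end PairCount

section Triangles

variable {T : Type*} [AddCommGroup T] {n : ℕ}

/-- The number of pairs in `S` whose difference lies in `K`. -/
noncomputable def closePairs (S : Finset (Fin n)) (K : Set T) (y : Fin n → T) : ℝ :=
  ∑ p ∈ orderedPairs S, K.indicator (fun _ => (1 : ℝ)) (y p.1 - y p.2)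

theorem abs_closePairs_le (S : Finset (Fin n)) (K : Set T) (y : Fin n → T) :
    |closePairs S K y| ≤ (orderedPairs S).card := by
  unfold closePairs
  refine (Finset.abs_sum_le_sum_abs _ _).trans
    ((Finset.sum_le_sum fun p _ => abs_indicator_one_le K _).trans ?_)
  simp

theorem closePairs_update_of_notMem {S : Finset (Fin n)} {l : Fin n} (hl : l ∉ S) (K : Set T)
    (y : Fin n → T) (t : T) : closePairs S K (Function.update y l t) = closePairs S K y := by
  unfold closePairs
  refine Finset.sum_congr rfl fun p hp => ?_
  simp only [orderedPairs, Finset.mem_filter, Finset.mem_product] at hp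
  rw [Function.update_of_ne (ne_of_mem_of_not_mem hp.1.1 hl),
    Function.update_of_ne (ne_of_mem_of_not_mem hp.1.2 hl)]

theorem abs_closePairs_update_sub_le (S : Finset (Fin n)) (l : Fin n) (K : Set T)
    (y : Fin n → T) (t : T) :
    |closePairs S K (Function.update y l t) - closePairs S K y| ≤ 2 * S.card := by
  unfold closePairs
  rw [← Finset.sum_sub_distrib]
  have h1 : ∀ p ∈ orderedPairs S,
      |K.indicator (fun _ => (1 : ℝ)) (Function.update y l t p.1 - Function.update y l t p.2) -
        K.indicator (fun _ => (1 : ℝ)) (y p.1 - y p.2)| ≤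
      if p ∈ ({l} ×ˢ S) ∪ (S ×ˢ {l}) then 1 else 0 := by
    intro p hp
    simp only [orderedPairs, Finset.mem_filter, Finset.mem_product] at hp
    split_ifs with h
    · by_cases ha : Function.update y l t p.1 - Function.update y l t p.2 ∈ K <;>
        by_cases hb : y p.1 - y p.2 ∈ K <;> simp [ha, hb]
    · simp only [Finset.mem_union, Finset.mem_product, Finset.mem_singleton, hp.1.1, hp.1.2,
        and_true, true_and, not_or] at h
      rw [Function.update_of_ne h.1, Function.update_of_ne h.2]; simp
  have hcard : ((({l} ×ˢ S) ∪ (S ×ˢ {l})).card : ℝ) ≤ 2 * S.card := by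
    have h2 := Finset.card_union_le ({l} ×ˢ S) (S ×ˢ {l})
    rw [Finset.card_product, Finset.card_product, Finset.card_singleton, one_mul, mul_one] at h2
    calc _ ≤ ((S.card + S.card : ℕ) : ℝ) := Nat.cast_le.2 h2
      _ = _ := by push_cast; ring
  calc _ ≤ _ := Finset.abs_sum_le_sum_abs _ _
    _ ≤ _ := Finset.sum_le_sum h1
    _ ≤ ∑ p : Fin n × Fin n, if p ∈ ({l} ×ˢ S) ∪ (S ×ˢ {l}) then (1 : ℝ) else 0 :=
        Finset.sum_le_sum_of_subset_of_nonneg (Finset.subset_univ _) fun p _ _ => by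
          split_ifs <;> norm_num
    _ = ((({l} ×ˢ S) ∪ (S ×ˢ {l})).card : ℝ) := by
        rw [Finset.sum_ite_mem, Finset.univ_inter, Finset.sum_const, nsmul_eq_mul, mul_one]
    _ ≤ _ := hcard

/-- The number of edges between neighbours of `i` is far from `w` times the number of pairs. -/
def Deviates (w ε : ℝ) (G : SimpleGraph (Fin n)) (i : Fin n) : Prop :=
  ε * ((vertexDegree G i).choose 2 : ℕ) <
    |(neighborEdges G i : ℝ) - w * ((vertexDegree G i).choose 2 : ℕ)|

theorem neighborEdges_cayleyGraph {K : Set T} (hK : ∀ t ∈ K, -t ∈ K) (x : Fin n → T) (i : Fin n)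
    (S : Finset (Fin n)) (hS : ∀ l, l ∈ S ↔ l ≠ i ∧ seenFrom i x l ∈ K) :
    (neighborEdges (cayleyGraph K x) i : ℝ) = closePairs S K (seenFrom i x) := by
  classical
  have hadj : ∀ l, (cayleyGraph K x).Adj i l ↔ l ∈ S := fun l => by
    rw [hS, cayleyGraph_adj hK]
    constructor
    · rintro ⟨h1, h2⟩
      exact ⟨h1.symm, by rw [seenFrom_of_ne h1.symm]; simpa using hK _ h2⟩
    · rintro ⟨h1, h2⟩
      rw [seenFrom_of_ne h1] at h2
      exact ⟨h1.symm, by simpa using hK _ h2⟩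
  unfold neighborEdges closePairs orderedPairs
  rw [Finset.card_filter, Finset.sum_filter]
  push_cast
  symm
  refine Finset.sum_subset_zero_on_sdiff (Finset.subset_univ _) (fun p hp => ?_) fun p hp => ?_
  · simp only [Finset.mem_sdiff, Finset.mem_univ, Finset.mem_product, true_and] at hp
    rw [if_neg]
    rw [hadj, hadj]; tauto
  · rw [Finset.mem_product] at hp
    have h1 := ((hS _).1 hp.1).1
    have h2 := ((hS _).1 hp.2).1
    simp only [hadj, hp.1, hp.2, true_and, cayleyGraph_adj hK, seenFrom_of_ne h1, seenFrom_of_ne h2,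
      sub_sub_sub_cancel_right]
    by_cases h : p.1 < p.2
    · by_cases h' : x p.1 - x p.2 ∈ K <;> simp [h, h', h.ne]
    · simp [h]

variable [MeasurableSpace T] [MeasurableAdd₂ T] [MeasurableNeg T]

theorem measurable_closePairs (S : Finset (Fin n)) {K : Set T} (hK : MeasurableSet K) :
    Measurable (closePairs S K) := by
  unfold closePairs
  refine Finset.measurable_sum _ fun p _ => ?_
  exact (measurable_indicator_one hK).comp ((measurable_pi_apply p.1).sub (measurable_pi_apply p.2))

theorem integral_indicator_sub (ν : Fin n → Measure T) [∀ i, IsProbabilityMeasure (ν i)]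
    {K : Set T} (hK : MeasurableSet K) {a b : Fin n} (hab : a ≠ b) :
    ∫ y, K.indicator (fun _ => (1 : ℝ)) (y a - y b) ∂Measure.pi ν =
      ((ν a).prod (ν b)).real {q | q.1 - q.2 ∈ K} := by
  have hm : Measurable (fun y : Fin n → T => K.indicator (fun _ => (1 : ℝ)) (y a - y b)) :=
    (measurable_indicator_one hK).comp ((measurable_pi_apply a).sub (measurable_pi_apply b))
  have hm2 : Measurable (fun q : T × T => K.indicator (fun _ => (1 : ℝ)) (q.1 - q.2)) :=
    (measurable_indicator_one hK).comp (measurable_fst.sub measurable_snd)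
  have hset : MeasurableSet {q : T × T | q.1 - q.2 ∈ K} := (measurable_fst.sub measurable_snd) hK
  rw [integral_pi_update ν hm (fun y => abs_indicator_one_le K _) a]
  have h1 : ∀ t, ∫ y, K.indicator (fun _ => (1 : ℝ))
      (Function.update y a t a - Function.update y a t b) ∂Measure.pi ν =
      ∫ s, K.indicator (fun _ => (1 : ℝ)) (t - s) ∂ν b := by
    intro t
    simp only [Function.update_self, Function.update_of_ne hab.symm]
    exact integral_comp_measurePreserving (measurePreserving_eval ν b)
      (f := fun s => K.indicator (fun _ => (1 : ℝ)) (t - s))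
      ((measurable_indicator_one hK).comp (measurable_const.sub measurable_id))
  simp_rw [h1]
  rw [← integral_prod (fun q : T × T => K.indicator (fun _ => (1 : ℝ)) (q.1 - q.2))
    (integrable_of_bounded hm2 fun q => abs_indicator_one_le K _), ← integral_ind _ hset]
  rfl

theorem prod_cond_real {U : Measure T} [SFinite U] {K : Set T} (hK : MeasurableSet K)
    (hp : 0 < U.real K) {w : ℝ}
    (hw : (U.prod U).real {q | q.1 ∈ K ∧ q.2 ∈ K ∧ q.1 - q.2 ∈ K} = w * U.real K ^ 2) :
    ((U[|K]).prod (U[|K])).real {q | q.1 - q.2 ∈ K} = w := by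
  have hset : MeasurableSet {q : T × T | q.1 - q.2 ∈ K} := (measurable_fst.sub measurable_snd) hK
  have : {q : T × T | q.1 - q.2 ∈ K} ∩ K ×ˢ K = {q | q.1 ∈ K ∧ q.2 ∈ K ∧ q.1 - q.2 ∈ K} := by
    ext q; simp only [Set.mem_inter_iff, Set.mem_prod, Set.mem_ofPred_eq]; tauto
  rw [ProbabilityTheory.cond, Measure.prod_smul_left, Measure.prod_smul_right,
    Measure.prod_restrict, measureReal_ennreal_smul_apply, measureReal_ennreal_smul_apply,
    measureReal_restrict_apply hset, this, hw, ENNReal.toReal_inv]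
  change (U.real K)⁻¹ * ((U.real K)⁻¹ * (w * U.real K ^ 2)) = w
  field_simp

/-- Concentration of the number of close pairs among conditioned points. -/
theorem measureReal_closePairs_deviation_le (ν : Fin n → Measure T)
    [∀ i, IsProbabilityMeasure (ν i)] {K : Set T} (hK : MeasurableSet K) (S : Finset (Fin n))
    {w : ℝ} (hw : ∀ a ∈ S, ∀ b ∈ S, ((ν a).prod (ν b)).real {q | q.1 - q.2 ∈ K} = w)
    (hS : 2 ≤ S.card) {ε : ℝ} (hε : 0 < ε) :
    (Measure.pi ν).real {y | ε * (S.card.choose 2 : ℕ) ≤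
      |closePairs S K y - w * (S.card.choose 2 : ℕ)|} ≤
      2 * Real.exp (-(ε ^ 2 * S.card / 128)) := by
  have hmean : ∫ y, closePairs S K y ∂Measure.pi ν = w * (S.card.choose 2 : ℕ) := by
    unfold closePairs
    rw [integral_finsetSum]
    · rw [Finset.sum_congr rfl fun p hp => ?_, Finset.sum_const, card_orderedPairs, nsmul_eq_mul,
        mul_comm]
      simp only [orderedPairs, Finset.mem_filter, Finset.mem_product] at hp
      rw [integral_indicator_sub ν hK hp.2.ne, hw _ hp.1.1 _ hp.1.2]
    · exact fun p _ => integrable_of_bounded ((measurable_indicator_one hK).comp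
        ((measurable_pi_apply p.1).sub (measurable_pi_apply p.2)))
        fun y => abs_indicator_one_le K _
  set s : ℝ := (S.card : ℝ) with hs
  have hs2 : (2 : ℝ) ≤ s := by rw [hs]; exact_mod_cast hS
  have hsum : ∑ i ∈ S, (if i ∈ S then 2 * s else 0) ^ 2 = 4 * s ^ 3 := by
    rw [Finset.sum_congr rfl fun i hi => by rw [if_pos hi], Finset.sum_const, nsmul_eq_mul, ← hs]
    ring
  have h := measureReal_abs_sub_integral_ge_le ν S (fun i => if i ∈ S then 2 * s else 0)
    (closePairs S K) (measurable_closePairs S hK) _ (abs_closePairs_le S K)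
    (fun i x t => by
      split_ifs with hi
      · exact abs_closePairs_update_sub_le S i K x t
      · rw [closePairs_update_of_notMem hi]; simp)
    (fun i hi x t => closePairs_update_of_notMem hi K x t)
    (s := ε * (S.card.choose 2 : ℕ)) (by positivity) (by rw [hsum]; positivity)
  rw [hmean, hsum] at h
  refine h.trans ?_
  have hch := sq_div_four_le_choose_two hS
  rw [← hs] at hch
  gcongr
  rw [neg_div, neg_le_neg_iff, le_div_iff₀ (by positivity)]
  calc ε ^ 2 * s / 128 * (2 * (4 * s ^ 3)) = (ε * (s ^ 2 / 4)) ^ 2 := by ring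
    _ ≤ _ := by gcongr

theorem measureReal_deviates_le (U : Measure T) [IsProbabilityMeasure U] [U.IsAddRightInvariant]
    {K : Set T} (hKm : MeasurableSet K) (hK : ∀ t ∈ K, -t ∈ K) (hp : 0 < U.real K) {w : ℝ}
    (hw : (U.prod U).real {q | q.1 ∈ K ∧ q.2 ∈ K ∧ q.1 - q.2 ∈ K} = w * U.real K ^ 2)
    {ε : ℝ} (hε : 0 < ε) {k : ℕ} (hk : 2 ≤ k) (i : Fin n) :
    (Measure.pi fun _ : Fin n => U).real {x | k ≤ vertexDegree (cayleyGraph K x) i ∧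
        Deviates w ε (cayleyGraph K x) i} ≤
      binomTail (U.real K) (n - 1) k * (2 * Real.exp (-(ε ^ 2 * k / 128))) := by
  classical
  set P : Measure (Fin n → T) := Measure.pi fun _ : Fin n => U with hP
  set I : Finset (Finset (Fin n)) := ((Finset.univ.erase i).powerset).filter fun S => k ≤ S.card
    with hI
  set A : Finset (Fin n) → Fin n → Set T := fun S l =>
    if l = i then Set.univ else if l ∈ S then K else Kᶜ with hA
  have hAm : ∀ S l, MeasurableSet (A S l) := fun S l => by
    simp only [hA]; split_ifs
    exacts [MeasurableSet.univ, hKm, hKm.compl]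
  have hAS : ∀ S ∈ I, ∀ y ∈ Set.univ.pi (A S), ∀ l, l ∈ S ↔ l ≠ i ∧ y l ∈ K := by
    intro S hS y hy l
    have hSi : i ∉ S := fun h => by
      have := (Finset.mem_powerset.1 (Finset.mem_filter.1 hS).1) h
      simp at this
    have := hy l (Set.mem_univ l)
    simp only [hA] at this
    by_cases hl : l = i
    · subst hl; simp [hSi]
    · by_cases hlS : l ∈ S
      · simp only [hl, hlS, if_true, if_false] at this; simp [hl, hlS, this]
      · simp only [hl, hlS, if_false] at this
        have h2 : y l ∉ K := this
        simp [hlS, h2]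
  set B : Finset (Fin n) → Set (Fin n → T) := fun S => {y | ε * (S.card.choose 2 : ℕ) ≤
      |closePairs S K y - w * (S.card.choose 2 : ℕ)|} with hB
  have hbox : ∀ S ∈ I, P.real (Set.univ.pi (A S) ∩ B S) ≤
      P.real (Set.univ.pi (A S)) * (2 * Real.exp (-(ε ^ 2 * k / 128))) := by
    intro S hS
    have hkS : k ≤ S.card := (Finset.mem_filter.1 hS).2
    by_cases h0 : ∀ l, U (A S l) ≠ 0
    · have hbm : MeasurableSet (Set.univ.pi (A S)) := MeasurableSet.univ_pi (hAm S)
      have hb0 : P (Set.univ.pi (A S)) ≠ 0 := by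
        rw [hP, Measure.pi_pi]; exact Finset.prod_ne_zero_iff.2 fun l _ => h0 l
      have : ∀ l, IsProbabilityMeasure (U[|A S l]) := fun l => cond_isProbabilityMeasure (h0 l)
      have hc := cond_pi_box (fun _ : Fin n => U) (A S) (hAm S) h0
      have e : P.real (Set.univ.pi (A S) ∩ B S) =
          P.real (Set.univ.pi (A S)) * (P[|Set.univ.pi (A S)]).real (B S) := by
        simp only [measureReal_def]
        rw [← ENNReal.toReal_mul, mul_comm, cond_mul_eq_inter hbm]
      rw [e]
      refine mul_le_mul_of_nonneg_left ?_ measureReal_nonneg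
      rw [hc]
      refine (measureReal_closePairs_deviation_le _ hKm S (fun a ha b hb => ?_) (hk.trans hkS)
        hε).trans ?_
      · have hSi : i ∉ S := fun h => by
          have := (Finset.mem_powerset.1 (Finset.mem_filter.1 hS).1) h
          simp at this
        have hAa : ∀ a ∈ S, A S a = K := fun a ha => by
          simp [hA, ha, ne_of_mem_of_not_mem ha hSi]
        rw [hAa a ha, hAa b hb]
        exact prod_cond_real hKm hp hw
      · gcongr
    · push Not at h0
      obtain ⟨l, hl⟩ := h0
      have hz : P.real (Set.univ.pi (A S)) = 0 := by
        rw [measureReal_def, hP, Measure.pi_pi, Finset.prod_eq_zero (Finset.mem_univ l) hl]; simp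
      rw [hz, zero_mul]
      exact (measureReal_mono Set.inter_subset_left).trans hz.le
  have hsub : {x | k ≤ vertexDegree (cayleyGraph K x) i ∧ Deviates w ε (cayleyGraph K x) i} ⊆
      seenFrom i ⁻¹' ⋃ S ∈ I, (Set.univ.pi (A S) ∩ B S) := by
    rintro x ⟨hx1, hx2⟩
    set S := (Finset.univ.erase i).filter fun l => seenFrom i x l ∈ K with hS
    have hdeg : vertexDegree (cayleyGraph K x) i = S.card := by
      rw [vertexDegree_cayleyGraph hK, hits, hS]
    have hSmem : ∀ l, l ∈ S ↔ l ≠ i ∧ seenFrom i x l ∈ K := fun l => by simp [hS]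
    simp only [Set.mem_preimage, Set.mem_iUnion]
    refine ⟨S, ?_, fun l _ => ?_, ?_⟩
    · simp only [hI, Finset.mem_filter, Finset.mem_powerset]
      exact ⟨Finset.filter_subset _ _, hdeg ▸ hx1⟩
    · simp only [hA]
      split_ifs with h1 h2
      · trivial
      · exact ((hSmem l).1 h2).2
      · exact fun h => h2 ((hSmem l).2 ⟨h1, h⟩)
    · simp only [hB, Set.mem_ofPred_eq]
      have := hx2.le
      rwa [neighborEdges_cayleyGraph hK x i S hSmem, hdeg] at this
  have hBm : ∀ S, MeasurableSet (B S) := fun S =>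
    measurableSet_le measurable_const ((measurable_closePairs S hKm).sub_const _).abs
  have hdisj : Set.PairwiseDisjoint (I : Set (Finset (Fin n))) fun S => Set.univ.pi (A S) := by
    intro S hS S' hS' hne
    rw [Function.onFun, Set.disjoint_left]
    intro y hy hy'
    exact hne (Finset.ext fun l => (hAS S hS y hy l).trans (hAS S' hS' y hy' l).symm)
  have hsum : ∑ S ∈ I, P.real (Set.univ.pi (A S)) ≤ binomTail (U.real K) (n - 1) k := by
    rw [← measureReal_biUnion_finset hdisj fun S _ => MeasurableSet.univ_pi (hAm S)]
    have hm : MeasurableSet {y : Fin n → T | k ≤ hits (Finset.univ.erase i) K y} :=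
      measurable_hits _ hKm measurableSet_Ici
    have : P.real {y | k ≤ hits (Finset.univ.erase i) K y} = binomTail (U.real K) (n - 1) k := by
      have h := integral_hitsInd U hKm (Finset.univ.erase i : Finset (Fin n)) k
      rw [← hP] at h
      rw [← integral_ind P hm]
      rw [show (Finset.univ.erase i : Finset (Fin n)).card = n - 1 by simp] at h
      refine Eq.trans (congrArg _ (funext fun y => ?_)) h
      by_cases hy : k ≤ hits (Finset.univ.erase i) K y <;> simp [hitsInd, hy]
    rw [← this]
    refine measureReal_mono ?_
    intro y hy
    simp only [Set.mem_iUnion] at hy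
    obtain ⟨S, hS, hyS⟩ := hy
    have hkS : k ≤ S.card := (Finset.mem_filter.1 hS).2
    refine hkS.trans (Finset.card_le_card fun l hl => ?_)
    have := (hAS S hS y hyS l).1 hl
    simpa using this
  calc _ ≤ P.real (seenFrom i ⁻¹' ⋃ S ∈ I, (Set.univ.pi (A S) ∩ B S)) := measureReal_mono hsub
    _ = P.real (⋃ S ∈ I, (Set.univ.pi (A S) ∩ B S)) := by
        simp only [measureReal_def]
        congr 1
        exact (measurePreserving_seenFrom U i).measure_preimage
          (Finset.measurableSet_biUnion _ fun S _ =>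
            (MeasurableSet.univ_pi (hAm S)).inter (hBm S)).nullMeasurableSet
    _ ≤ ∑ S ∈ I, P.real (Set.univ.pi (A S) ∩ B S) := measureReal_biUnion_finset_le _ _
    _ ≤ ∑ S ∈ I, P.real (Set.univ.pi (A S)) * (2 * Real.exp (-(ε ^ 2 * k / 128))) :=
        Finset.sum_le_sum hbox
    _ ≤ _ := by
        rw [← Finset.sum_mul]; gcongr

end Triangles

section Exchangeability

open scoped Nat in
/-- Under a uniform permutation, each element of `A` is equally likely to come first. -/
theorem card_mul_card_perm_first_le {n : ℕ} (A : Finset (Fin n)) {b : Fin n} (hb : b ∈ A) :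
    A.card * (Finset.univ.filter fun σ : Equiv.Perm (Fin n) => ∀ a ∈ A, σ b ≤ σ a).card ≤ n ! := by
  set F : Fin n → Finset (Equiv.Perm (Fin n)) := fun b =>
    Finset.univ.filter fun σ => ∀ a ∈ A, σ b ≤ σ a with hF
  have hcard : ∀ b' ∈ A, (F b').card = (F b).card := by
    have key : ∀ b₁ ∈ A, ∀ b₂ ∈ A, (F b₁).card ≤ (F b₂).card := by
      intro b₁ h₁ b₂ h₂
      refine Finset.card_le_card_of_injOn (fun σ => σ * Equiv.swap b₁ b₂) (fun σ hσ => ?_)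
        fun σ _ τ _ h => mul_right_cancel h
      simp only [hF, Finset.coe_filter, Finset.mem_univ, true_and, Set.mem_ofPred_eq] at hσ ⊢
      intro a ha
      rw [Equiv.Perm.mul_apply, Equiv.Perm.mul_apply, Equiv.swap_apply_right]
      refine hσ _ ?_
      rw [Equiv.swap_apply_def]
      split_ifs
      exacts [h₂, h₁, ha]
    exact fun b' hb' => le_antisymm (key _ hb' _ hb) (key _ hb _ hb')
  have hdisj : Set.PairwiseDisjoint (A : Set (Fin n)) F := by
    intro b₁ h₁ b₂ h₂ hne
    rw [Function.onFun, Finset.disjoint_left]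
    intro σ hσ hσ'
    simp only [hF, Finset.mem_filter, Finset.mem_univ, true_and] at hσ hσ'
    exact hne (σ.injective (le_antisymm (hσ _ h₂) (hσ' _ h₁)))
  calc A.card * (F b).card = ∑ b' ∈ A, (F b').card := by
        rw [Finset.sum_congr rfl hcard, Finset.sum_const, smul_eq_mul]
    _ = (A.biUnion F).card := (Finset.card_biUnion hdisj).symm
    _ ≤ Fintype.card (Equiv.Perm (Fin n)) := Finset.card_le_univ _
    _ = n ! := by rw [Fintype.card_perm, Fintype.card_fin]

variable {n : ℕ}

theorem vertexDegree_comap (G : SimpleGraph (Fin n)) (σ : Equiv.Perm (Fin n)) (i : Fin n) :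
    vertexDegree (G.comap σ) i = vertexDegree G (σ i) := by
  classical
  unfold vertexDegree
  rw [← SimpleGraph.card_neighborFinset_eq_degree, ← SimpleGraph.card_neighborFinset_eq_degree]
  refine Finset.card_bij (fun l _ => σ l) (fun l hl => ?_) (fun l _ m _ h => σ.injective h)
    fun l hl => ⟨σ.symm l, ?_, by simp⟩
  · simpa using hl
  · simpa using hl

open scoped Classical in
theorem two_mul_neighborEdges (G : SimpleGraph (Fin n)) (i : Fin n) :
    2 * neighborEdges G i = (Finset.univ.filter fun p : Fin n × Fin n =>
      G.Adj i p.1 ∧ G.Adj i p.2 ∧ G.Adj p.1 p.2).card := by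
  set E := Finset.univ.filter fun p : Fin n × Fin n =>
    p.1 < p.2 ∧ G.Adj i p.1 ∧ G.Adj i p.2 ∧ G.Adj p.1 p.2 with hE
  have hsplit : (Finset.univ.filter fun p : Fin n × Fin n =>
      G.Adj i p.1 ∧ G.Adj i p.2 ∧ G.Adj p.1 p.2) = E ∪ E.image Prod.swap := by
    ext ⟨a, b⟩
    simp only [hE, Finset.mem_union, Finset.mem_filter, Finset.mem_univ, true_and,
      Finset.mem_image, Prod.exists, Prod.swap_prod_mk, Prod.mk.injEq]
    constructor
    · rintro ⟨h1, h2, h3⟩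
      rcases lt_or_gt_of_ne h3.ne with h | h
      · exact Or.inl ⟨h, h1, h2, h3⟩
      · exact Or.inr ⟨b, a, ⟨h, h2, h1, h3.symm⟩, rfl, rfl⟩
    · rintro (⟨_, h⟩ | ⟨b', a', ⟨_, h1, h2, h3⟩, rfl, rfl⟩)
      · exact h
      · exact ⟨h2, h1, h3.symm⟩
  have hdisj : Disjoint E (E.image Prod.swap) := by
    rw [Finset.disjoint_left]
    rintro ⟨a, b⟩ h h'
    simp only [hE, Finset.mem_filter, Finset.mem_univ, true_and, Finset.mem_image, Prod.exists,
      Prod.swap_prod_mk, Prod.mk.injEq] at h h'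
    obtain ⟨b', a', ⟨h2, _⟩, rfl, rfl⟩ := h'
    exact lt_asymm h.1 h2
  rw [hsplit, Finset.card_union_of_disjoint hdisj,
    Finset.card_image_of_injective _ Prod.swap_injective, two_mul]
  rfl

theorem neighborEdges_comap (G : SimpleGraph (Fin n)) (σ : Equiv.Perm (Fin n)) (i : Fin n) :
    neighborEdges (G.comap σ) i = neighborEdges G (σ i) := by
  classical
  have : 2 * neighborEdges (G.comap σ) i = 2 * neighborEdges G (σ i) := by
    rw [two_mul_neighborEdges, two_mul_neighborEdges]
    refine Finset.card_bij (fun p _ => (σ p.1, σ p.2)) (fun p hp => by simpa using hp)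
      (fun p _ q _ h => ?_) fun p hp => ⟨(σ.symm p.1, σ.symm p.2), by simpa using hp, by simp⟩
    rw [Prod.mk.injEq] at h
    exact Prod.ext (σ.injective h.1) (σ.injective h.2)
  omega

theorem deviates_comap (w ε : ℝ) (G : SimpleGraph (Fin n)) (σ : Equiv.Perm (Fin n)) (i : Fin n) :
    Deviates w ε (G.comap σ) i ↔ Deviates w ε G (σ i) := by
  simp only [Deviates, vertexDegree_comap, neighborEdges_comap]

theorem degreeCount_comap (k : ℕ) (G : SimpleGraph (Fin n)) (σ : Equiv.Perm (Fin n)) :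
    degreeCount k (G.comap σ) = degreeCount k G := by
  simp only [degreeCount, degreeInd, vertexDegree_comap]
  exact Equiv.sum_comp σ fun i => if k ≤ vertexDegree G i then (1 : ℝ) else 0

open scoped Classical in
theorem degreeCount_eq_card (k : ℕ) (G : SimpleGraph (Fin n)) :
    degreeCount k G = ((Finset.univ.filter fun i => k ≤ vertexDegree G i).card : ℝ) := by
  simp [degreeCount, degreeInd]

/-- The maximal degree is at most `k`, at least `v` vertices have degree at least `k`, and the
first vertex of maximal degree deviates. -/
def FirstDeviates (w ε v : ℝ) (k : ℕ) (G : SimpleGraph (Fin n)) : Prop :=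
  (∀ i, vertexDegree G i ≤ k) ∧ v ≤ degreeCount k G ∧
    ∃ h : (maxDegreeVertices G).Nonempty, Deviates w ε G ((maxDegreeVertices G).min' h)

theorem mem_maxDegreeVertices {G : SimpleGraph (Fin n)} {i : Fin n} :
    i ∈ maxDegreeVertices G ↔ ∀ j, vertexDegree G j ≤ vertexDegree G i := by
  simp [maxDegreeVertices]

open scoped Classical Nat in
theorem mul_card_firstDeviates_le (w ε : ℝ) {v : ℝ} (hv : 0 < v) (k : ℕ) (G : SimpleGraph (Fin n)) :
    v * ((Finset.univ.filter fun σ : Equiv.Perm (Fin n) =>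
      FirstDeviates w ε v k (G.comap σ)).card : ℝ) ≤
      n ! * ((Finset.univ.filter fun i => k ≤ vertexDegree G i ∧ Deviates w ε G i).card : ℝ) := by
  set A := Finset.univ.filter fun i => k ≤ vertexDegree G i with hA
  set B := Finset.univ.filter fun i => k ≤ vertexDegree G i ∧ Deviates w ε G i with hB
  by_cases hG : (∀ i, vertexDegree G i ≤ k) ∧ v ≤ degreeCount k G
  · obtain ⟨hdeg, hcnt⟩ := hG
    rw [degreeCount_eq_card, ← hA] at hcnt
    have hApos : 0 < A.card := by
      have : (0 : ℝ) < A.card := hv.trans_le hcnt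
      exact_mod_cast this
    obtain ⟨a₀, ha₀⟩ := Finset.card_pos.1 hApos
    have ha₀' : k ≤ vertexDegree G a₀ := (Finset.mem_filter.1 ha₀).2
    set F : Fin n → Finset (Equiv.Perm (Fin n)) := fun b =>
      Finset.univ.filter fun σ => ∀ a ∈ A, σ.symm b ≤ σ.symm a with hF
    have hFcard : ∀ b ∈ B, A.card * (F b).card ≤ n ! := by
      intro b hb
      have hbA : b ∈ A := by
        simp only [hB, hA, Finset.mem_filter, Finset.mem_univ, true_and] at hb ⊢; exact hb.1
      refine le_trans (Nat.mul_le_mul_left _ ?_) (card_mul_card_perm_first_le A hbA)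
      refine Finset.card_le_card_of_injOn (fun σ => σ⁻¹) (fun σ hσ => ?_)
        fun σ _ τ _ h => inv_injective h
      simpa [hF] using hσ
    have hsub : (Finset.univ.filter fun σ : Equiv.Perm (Fin n) =>
        FirstDeviates w ε v k (G.comap σ)) ⊆ B.biUnion F := by
      intro σ hσ
      obtain ⟨-, -, h, hdev⟩ := (Finset.mem_filter.1 hσ).2
      set m := (maxDegreeVertices (G.comap σ)).min' h with hm
      have hmem : m ∈ maxDegreeVertices (G.comap σ) := Finset.min'_mem _ _
      rw [mem_maxDegreeVertices] at hmem
      simp only [vertexDegree_comap] at hmem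
      rw [Finset.mem_biUnion]
      refine ⟨σ m, ?_, ?_⟩
      · simp only [hB, Finset.mem_filter, Finset.mem_univ, true_and]
        refine ⟨?_, (deviates_comap w ε G σ m).1 hdev⟩
        have := hmem (σ.symm a₀)
        rw [Equiv.apply_symm_apply] at this
        exact ha₀'.trans this
      · simp only [hF, Finset.mem_filter, Finset.mem_univ, true_and, Equiv.symm_apply_apply]
        intro a ha
        have ha' : k ≤ vertexDegree G a := (Finset.mem_filter.1 ha).2
        refine Finset.min'_le _ _ ?_
        rw [mem_maxDegreeVertices]
        intro j
        rw [vertexDegree_comap, vertexDegree_comap, Equiv.apply_symm_apply]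
        exact (hdeg _).trans ha'
    have h1 : A.card * (Finset.univ.filter fun σ : Equiv.Perm (Fin n) =>
        FirstDeviates w ε v k (G.comap σ)).card ≤ n ! * B.card := by
      calc _ ≤ A.card * (B.biUnion F).card := Nat.mul_le_mul_left _ (Finset.card_le_card hsub)
        _ ≤ A.card * ∑ b ∈ B, (F b).card := Nat.mul_le_mul_left _ Finset.card_biUnion_le
        _ = ∑ b ∈ B, A.card * (F b).card := Finset.mul_sum _ _ _
        _ ≤ ∑ b ∈ B, n ! := Finset.sum_le_sum hFcard
        _ = _ := by rw [Finset.sum_const, smul_eq_mul, mul_comm]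
    calc _ ≤ (A.card : ℝ) * ((Finset.univ.filter fun σ : Equiv.Perm (Fin n) =>
        FirstDeviates w ε v k (G.comap σ)).card : ℝ) := by gcongr
      _ ≤ _ := by exact_mod_cast h1
  · have : (Finset.univ.filter fun σ : Equiv.Perm (Fin n) =>
        FirstDeviates w ε v k (G.comap σ)) = ∅ := by
      refine Finset.filter_eq_empty_iff.2 fun σ _ hσ => hG ⟨fun i => ?_, ?_⟩
      · have := hσ.1 (σ.symm i)
        rwa [vertexDegree_comap, Equiv.apply_symm_apply] at this
      · have := hσ.2.1
        rwa [degreeCount_comap] at this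
    rw [this]
    simp only [Finset.card_empty, Nat.cast_zero, mul_zero]
    positivity

end Exchangeability

section MaxDegree

variable {T : Type*} [AddCommGroup T] {n : ℕ}

theorem cayleyGraph_comp_perm (K : Set T) (x : Fin n → T) (σ : Equiv.Perm (Fin n)) :
    cayleyGraph K (x ∘ σ) = (cayleyGraph K x).comap σ := by
  ext a b
  simp [cayleyGraph, SimpleGraph.fromRel_adj]

theorem measurePreserving_comp_perm {ι E : Type*} [Fintype ι] [MeasurableSpace E] (U : Measure E)
    [IsProbabilityMeasure U] (σ : Equiv.Perm ι) :
    MeasurePreserving (fun x : ι → E => x ∘ σ) (Measure.pi fun _ => U) (Measure.pi fun _ => U) := by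
  have hm : Measurable (fun x : ι → E => x ∘ σ) :=
    measurable_pi_iff.2 fun i => measurable_pi_apply (σ i)
  refine ⟨hm, (Measure.pi_eq fun s hs => ?_).symm⟩
  rw [Measure.map_apply hm (MeasurableSet.univ_pi hs)]
  have : (fun x : ι → E => x ∘ σ) ⁻¹' Set.univ.pi s = Set.univ.pi fun i => s (σ.symm i) := by
    ext x
    simp only [Set.mem_preimage, Set.mem_pi, Set.mem_univ, true_implies, Function.comp_apply]
    exact ⟨fun h i => by simpa using h (σ.symm i), fun h i => by simpa using h (σ i)⟩
  rw [this, Measure.pi_pi]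
  exact Equiv.prod_comp σ.symm fun i => U (s i)

variable [MeasurableSpace T] [MeasurableAdd₂ T] [MeasurableNeg T]
variable (U : Measure T) [IsProbabilityMeasure U]

theorem measureReal_firstDeviates_le {K : Set T} (hKm : MeasurableSet K) {w ε v β : ℝ} (hv : 0 < v)
    (k : ℕ) (hβ : ∀ i, (Measure.pi fun _ : Fin n => U).real
      {x | k ≤ vertexDegree (cayleyGraph K x) i ∧ Deviates w ε (cayleyGraph K x) i} ≤ β) :
    (Measure.pi fun _ : Fin n => U).real {x | FirstDeviates w ε v k (cayleyGraph K x)} ≤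
      n * β / v := by
  classical
  set P : Measure (Fin n → T) := Measure.pi fun _ : Fin n => U with hP
  have hQ : ∀ (Q : SimpleGraph (Fin n) → Prop) [DecidablePred Q],
      ∫ x, (if Q (cayleyGraph K x) then (1 : ℝ) else 0) ∂P =
      P.real {x | Q (cayleyGraph K x)} := fun Q _ => by
    rw [← integral_ind P (measurableSet_cayleyGraph hKm Q)]
    refine congrArg _ (funext fun x => ?_)
    by_cases h : Q (cayleyGraph K x) <;> simp [h]
  have hQi : ∀ (Q : SimpleGraph (Fin n) → Prop) [DecidablePred Q],
      Integrable (fun x => if Q (cayleyGraph K x) then (1 : ℝ) else 0) P := fun Q _ =>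
    integrable_of_bounded (measurable_cayleyGraph hKm fun G => if Q G then 1 else 0) (C := 1)
      fun x => by split_ifs <;> simp
  have hperm : ∀ σ : Equiv.Perm (Fin n),
      P.real {x | FirstDeviates w ε v k ((cayleyGraph K x).comap σ)}
      = P.real {x | FirstDeviates w ε v k (cayleyGraph K x)} := by
    intro σ
    simp only [measureReal_def]
    rw [← (measurePreserving_comp_perm U σ).measure_preimage
      (measurableSet_cayleyGraph hKm (FirstDeviates w ε v k)).nullMeasurableSet]
    simp only [Set.preimage_ofPred_eq, cayleyGraph_comp_perm]
    rfl
  have hL : ∫ x, ((Finset.univ.filter fun σ : Equiv.Perm (Fin n) =>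
      FirstDeviates w ε v k ((cayleyGraph K x).comap σ)).card : ℝ) ∂P =
      (n.factorial : ℝ) * P.real {x | FirstDeviates w ε v k (cayleyGraph K x)} := by
    simp_rw [Finset.card_filter]
    push_cast
    rw [integral_finsetSum _ fun (σ : Equiv.Perm (Fin n)) _ =>
      hQi fun G => FirstDeviates w ε v k (G.comap σ)]
    rw [Finset.sum_congr rfl fun (σ : Equiv.Perm (Fin n)) _ =>
      (hQ fun G => FirstDeviates w ε v k (G.comap σ)).trans (hperm σ)]
    simp [Fintype.card_perm]
  have hR : ∫ x, ((Finset.univ.filter fun i => k ≤ vertexDegree (cayleyGraph K x) i ∧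
      Deviates w ε (cayleyGraph K x) i).card : ℝ) ∂P ≤ n * β := by
    simp_rw [Finset.card_filter]
    push_cast
    rw [integral_finsetSum _ fun i _ => hQi fun G => k ≤ vertexDegree G i ∧ Deviates w ε G i]
    calc _ ≤ ∑ i : Fin n, β := Finset.sum_le_sum fun i _ =>
          (hQ fun G => k ≤ vertexDegree G i ∧ Deviates w ε G i).le.trans (hβ i)
      _ = _ := by simp
  have hint1 : Integrable (fun x => ((Finset.univ.filter fun σ : Equiv.Perm (Fin n) =>
      FirstDeviates w ε v k ((cayleyGraph K x).comap σ)).card : ℝ)) P := by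
    simp_rw [Finset.card_filter]
    push_cast
    exact integrable_finsetSum _ fun σ _ => hQi fun G => FirstDeviates w ε v k (G.comap σ)
  have hint2 : Integrable (fun x => ((Finset.univ.filter fun i =>
      k ≤ vertexDegree (cayleyGraph K x) i ∧ Deviates w ε (cayleyGraph K x) i).card : ℝ)) P := by
    simp_rw [Finset.card_filter]
    push_cast
    exact integrable_finsetSum _ fun i _ => hQi fun G => k ≤ vertexDegree G i ∧ Deviates w ε G i
  have h := integral_mono (hint1.const_mul v) (hint2.const_mul (n.factorial : ℝ)) fun x =>
    mul_card_firstDeviates_le w ε hv k (cayleyGraph K x)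
  rw [integral_const_mul, integral_const_mul, hL] at h
  have hfac : (0 : ℝ) < n.factorial := by exact_mod_cast n.factorial_pos
  rw [le_div_iff₀ hv]
  have h2 := h.trans (mul_le_mul_of_nonneg_left hR hfac.le)
  refine le_of_mul_le_mul_left ?_ hfac
  linarith

theorem deviates_of_maxDegreeClustering {w ε : ℝ} {G : SimpleGraph (Fin n)}
    (h : (maxDegreeVertices G).Nonempty) (h2 : 2 ≤ vertexDegree G ((maxDegreeVertices G).min' h))
    (hε : ε < |maxDegreeClustering G - w|) : Deviates w ε G ((maxDegreeVertices G).min' h) := by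
  rw [maxDegreeClustering, dif_pos h] at hε
  unfold Deviates
  set D := vertexDegree G ((maxDegreeVertices G).min' h)
  have hpos : (0 : ℝ) < (D.choose 2 : ℕ) := by exact_mod_cast Nat.choose_pos h2
  set δ := (neighborEdges G ((maxDegreeVertices G).min' h) : ℝ)
  have : δ - w * (D.choose 2 : ℕ) = (δ / (D.choose 2 : ℕ) - w) * (D.choose 2 : ℕ) := by
    field_simp
  rw [this, abs_mul, abs_of_pos hpos]
  exact mul_lt_mul_of_pos_right hε hpos

theorem maxDegreeVertices_nonempty (G : SimpleGraph (Fin n)) (i : Fin n) :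
    (maxDegreeVertices G).Nonempty := by
  obtain ⟨m, -, hm⟩ := Finset.exists_max_image Finset.univ (vertexDegree G) ⟨i, Finset.mem_univ i⟩
  exact ⟨m, mem_maxDegreeVertices.2 fun j => hm j (Finset.mem_univ j)⟩

theorem vertexDegree_le_min' {G : SimpleGraph (Fin n)} (h : (maxDegreeVertices G).Nonempty)
    (j : Fin n) : vertexDegree G j ≤ vertexDegree G ((maxDegreeVertices G).min' h) :=
  mem_maxDegreeVertices.1 (Finset.min'_mem _ h) j

variable [U.IsAddRightInvariant]

theorem measureReal_iUnion_deviates_le {K : Set T} (hKm : MeasurableSet K)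
    (hK : ∀ t ∈ K, -t ∈ K) (hp : 0 < U.real K) {w : ℝ}
    (hw : (U.prod U).real {q | q.1 ∈ K ∧ q.2 ∈ K ∧ q.1 - q.2 ∈ K} = w * U.real K ^ 2)
    {ε : ℝ} (hε : 0 < ε) {k : ℕ} (hk : 2 ≤ k) :
    (Measure.pi fun _ : Fin n => U).real (⋃ i, {x | k ≤ vertexDegree (cayleyGraph K x) i ∧
        Deviates w ε (cayleyGraph K x) i}) ≤
      n * binomTail (U.real K) (n - 1) k * (2 * Real.exp (-(ε ^ 2 * k / 128))) := by
  refine (measureReal_iUnion_fintype_le _).trans ?_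
  calc _ ≤ ∑ i : Fin n, binomTail (U.real K) (n - 1) k * (2 * Real.exp (-(ε ^ 2 * k / 128))) :=
        Finset.sum_le_sum fun i _ => measureReal_deviates_le U hKm hK hp hw hε hk i
    _ = _ := by simp [mul_assoc]

theorem measureReal_maxDegreeClustering_le {K K₂ : Set T} (hKm : MeasurableSet K)
    (hK : ∀ t ∈ K, -t ∈ K) (hK₂m : MeasurableSet K₂) (hKK : K ⊆ K₂)
    (hK₂ : ∀ s ∈ K, ∀ t ∈ K, s - t ∈ K₂) (hp : 0 < U.real K) {w : ℝ}
    (hw : (U.prod U).real {q | q.1 ∈ K ∧ q.2 ∈ K ∧ q.1 - q.2 ∈ K} = w * U.real K ^ 2)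
    {ε : ℝ} (hε : 0 < ε) {k : ℕ} (hk : 2 ≤ k)
    (hpos : 0 < n * binomTail (U.real K) (n - 1) k) :
    (Measure.pi fun _ : Fin n => U).real {x | ε < |maxDegreeClustering (cayleyGraph K x) - w|} ≤
      n * binomTail (U.real K) (n - 1) (k + 1) * (2 * Real.exp (-(ε ^ 2 * (k + 1 : ℕ) / 128))) +
      (4 * (1 + k + n * U.real K₂) / (n * binomTail (U.real K) (n - 1) k) +
        4 * Real.exp (-(ε ^ 2 * k / 128))) := by
  set m := n * binomTail (U.real K) (n - 1) k with hm
  set P : Measure (Fin n → T) := Measure.pi fun _ : Fin n => U with hP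
  have hsub : {x | ε < |maxDegreeClustering (cayleyGraph K x) - w|} ⊆
      (⋃ i, {x | k + 1 ≤ vertexDegree (cayleyGraph K x) i ∧ Deviates w ε (cayleyGraph K x) i}) ∪
      ({x | degreeCount k (cayleyGraph K x) < m / 2} ∪
        {x : Fin n → T | FirstDeviates w ε (m / 2) k (cayleyGraph K x)}) := by
    intro x hx
    rw [Set.mem_ofPred_eq] at hx
    by_cases hbig : ∃ i, k + 1 ≤ vertexDegree (cayleyGraph K x) i
    · obtain ⟨i, hi⟩ := hbig
      have hne := maxDegreeVertices_nonempty (cayleyGraph K x) i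
      have hd := hi.trans (vertexDegree_le_min' hne i)
      exact Or.inl (Set.mem_iUnion.2
        ⟨_, hd, deviates_of_maxDegreeClustering hne (by omega) hx⟩)
    · push Not at hbig
      refine Or.inr ?_
      by_cases hc : degreeCount k (cayleyGraph K x) < m / 2
      · exact Or.inl hc
      · push Not at hc
        have hcpos : 0 < degreeCount k (cayleyGraph K x) := lt_of_lt_of_le (by positivity) hc
        classical
        rw [degreeCount_eq_card] at hcpos
        have hcpos' := Nat.cast_pos.1 hcpos
        obtain ⟨i, hi⟩ := Finset.card_pos.1 hcpos'
        have hi' : k ≤ vertexDegree (cayleyGraph K x) i := (Finset.mem_filter.1 hi).2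
        have hne := maxDegreeVertices_nonempty (cayleyGraph K x) i
        have hd := hi'.trans (vertexDegree_le_min' hne i)
        exact Or.inr ⟨fun i => Nat.lt_succ_iff.1 (hbig i), hc, hne,
          deviates_of_maxDegreeClustering hne (hk.trans hd) hx⟩
  refine (measureReal_mono hsub).trans ((measureReal_union_le _ _).trans (add_le_add
    (measureReal_iUnion_deviates_le U hKm hK hp hw hε (by omega))
    ((measureReal_union_le _ _).trans (add_le_add
      (measureReal_degreeCount_lt_le U hKm hK hK₂m hKK hK₂ k hpos) ?_))))
  refine (measureReal_firstDeviates_le U hKm (half_pos hpos) k fun i =>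
    measureReal_deviates_le U hKm hK hp hw hε hk i).trans (le_of_eq ?_)
  rw [← mul_assoc, ← hm]
  field_simp
  ring

theorem measureReal_maxDegreeClustering_le' {K : Set T} (hKm : MeasurableSet K)
    (hK : ∀ t ∈ K, -t ∈ K) (hp : 0 < U.real K) {w : ℝ}
    (hw : (U.prod U).real {q | q.1 ∈ K ∧ q.2 ∈ K ∧ q.1 - q.2 ∈ K} = w * U.real K ^ 2)
    {ε : ℝ} (hε : 0 < ε) {k : ℕ} (hk : 2 ≤ k) (hn : 0 < n) :
    (Measure.pi fun _ : Fin n => U).real {x | ε < |maxDegreeClustering (cayleyGraph K x) - w|} ≤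
      (1 - binomTail (U.real K) (n - 1) k) + n * (2 * Real.exp (-(ε ^ 2 * k / 128))) := by
  set P : Measure (Fin n → T) := Measure.pi fun _ : Fin n => U with hP
  set i₀ : Fin n := ⟨0, hn⟩
  have hm := measurableSet_cayleyGraph (n := n) hKm fun G => k ≤ vertexDegree G i₀
  have hsub : {x | ε < |maxDegreeClustering (cayleyGraph K x) - w|} ⊆
      {x : Fin n → T | k ≤ vertexDegree (cayleyGraph K x) i₀}ᶜ ∪
      (⋃ i, {x | k ≤ vertexDegree (cayleyGraph K x) i ∧ Deviates w ε (cayleyGraph K x) i}) := by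
    intro x hx
    rw [Set.mem_ofPred_eq] at hx
    by_cases hi : k ≤ vertexDegree (cayleyGraph K x) i₀
    · have hne := maxDegreeVertices_nonempty (cayleyGraph K x) i₀
      have hd := hi.trans (vertexDegree_le_min' hne i₀)
      exact Or.inr (Set.mem_iUnion.2
        ⟨_, hd, deviates_of_maxDegreeClustering hne (by omega) hx⟩)
    · exact Or.inl hi
  have h1 : P.real {x : Fin n → T | k ≤ vertexDegree (cayleyGraph K x) i₀} =
      binomTail (U.real K) (n - 1) k := by
    rw [← integral_degreeInd U hKm hK k i₀, ← integral_ind P hm]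
    refine congrArg _ (funext fun x => ?_)
    by_cases h : k ≤ vertexDegree (cayleyGraph K x) i₀ <;> simp [degreeInd, h]
  refine (measureReal_mono hsub).trans ((measureReal_union_le _ _).trans (add_le_add ?_
    ((measureReal_iUnion_deviates_le U hKm hK hp hw hε hk).trans ?_)))
  · rw [probReal_compl_eq_one_sub hm, h1]
  · gcongr
    exact mul_le_of_le_one_right (by positivity)
      (binomTail_le_one measureReal_nonneg measureReal_le_one _ _)

end MaxDegree

section BinomTailAsymptotics

theorem binomTail_eq_zero {p : ℝ} {m k : ℕ} (h : m < k) : binomTail p m k = 0 := by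
  induction m generalizing k with
  | zero => obtain ⟨k, rfl⟩ := Nat.exists_eq_succ_of_ne_zero h.ne'; simp
  | succ m ih =>
    obtain ⟨k, rfl⟩ := Nat.exists_eq_succ_of_ne_zero (Nat.ne_zero_of_lt h)
    rw [Nat.succ_eq_add_one, binomTail_succ_succ, ih (by omega), ih (by omega)]; ring

/-- A lower bound for the binomial tail in terms of the mean. -/
theorem one_sub_exp_pow_le_binomTail {p : ℝ} (h0 : 0 ≤ p) (h1 : p ≤ 1) {n j : ℕ} (hj : 0 < j)
    (hn : 2 * j ≤ n) : (1 - Real.exp (-(n * p / (2 * j)))) ^ j ≤ binomTail p (n - 1) j := by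
  set m := (n - 1) / j with hm
  have hjm : j * m ≤ n - 1 := Nat.mul_div_le _ _
  have hlt : n - 1 < j * (m + 1) := by
    rw [mul_comm]; exact Nat.lt_mul_of_div_lt (Nat.lt_succ_self _) hj
  have hmn : n ≤ 2 * j * m := by
    have : j * (m + 1) = j * m + j := by ring
    have : 2 * j * m = j * m + j * m := by ring
    omega
  have hjR : (0 : ℝ) < j := by exact_mod_cast hj
  have hmp : n * p / (2 * j) ≤ m * p := by
    rw [div_le_iff₀ (by positivity)]
    have : (n : ℝ) ≤ 2 * j * m := by exact_mod_cast hmn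
    nlinarith
  have hpow : (1 - p) ^ m ≤ Real.exp (-(n * p / (2 * j))) := by
    calc (1 - p) ^ m ≤ Real.exp (-p) ^ m := by
          have := Real.one_sub_le_exp_neg p
          have h2 : 0 ≤ 1 - p := by linarith
          gcongr
      _ = Real.exp (-(m * p)) := by rw [← Real.exp_nat_mul]; congr 1; ring
      _ ≤ _ := by gcongr
  refine le_trans ?_ (pow_le_binomTail h0 h1 hjm)
  have : 0 ≤ 1 - Real.exp (-(n * p / (2 * j))) := by
    rw [sub_nonneg, Real.exp_le_one_iff, neg_nonpos]; positivity
  gcongr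

theorem one_sub_mul_exp_le_binomTail {p : ℝ} (h0 : 0 ≤ p) (h1 : p ≤ 1) {n j : ℕ} (hj : 0 < j)
    (hn : 2 * j ≤ n) : 1 - j * Real.exp (-(n * p / (2 * j))) ≤ binomTail p (n - 1) j := by
  refine le_trans ?_ (one_sub_exp_pow_le_binomTail h0 h1 hj hn)
  set e := Real.exp (-(n * p / (2 * j))) with he
  have he1 : e ≤ 1 := by rw [he, Real.exp_le_one_iff, neg_nonpos]; positivity
  have := one_add_mul_le_pow (a := -e) (by linarith) j
  calc 1 - j * e = 1 + j * -e := by ring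
    _ ≤ (1 + -e) ^ j := this
    _ = _ := by ring

theorem half_mul_le_one_sub_exp {x : ℝ} (h0 : 0 ≤ x) (h1 : x ≤ 1) : x / 2 ≤ 1 - Real.exp (-x) := by
  have h2 := Real.add_one_le_exp x
  have h3 : Real.exp (-x) * Real.exp x = 1 := by rw [← Real.exp_add]; simp
  have h4 := Real.exp_pos (-x)
  have h5 : Real.exp (-x) * (1 + x) ≤ 1 := by rw [← h3]; gcongr; linarith
  nlinarith

variable {p : ℕ → ℝ}

/-- If the mean is at least every negative power of `n`, then every fixed degree is exceeded by
many vertices. -/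
theorem tendsto_mul_binomTail (h0 : ∀ n, 0 ≤ p n) (h1 : ∀ n, p n ≤ 1)
    (hp : ∀ δ : ℝ, 0 < δ → ∀ᶠ n : ℕ in atTop, (n : ℝ) ^ (-δ) ≤ n * p n) {j : ℕ} (hj : 0 < j) :
    Tendsto (fun n : ℕ => n * binomTail (p n) (n - 1) j) atTop atTop := by
  have hjR : (0 : ℝ) < j := by exact_mod_cast hj
  have hjR1 : (1 : ℝ) ≤ j := by exact_mod_cast hj
  have hlim : Tendsto (fun n : ℕ => (n : ℝ) ^ (1 / 2 : ℝ) / (4 * j) ^ j) atTop atTop :=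
    ((tendsto_rpow_atTop (by norm_num)).comp tendsto_natCast_atTop_atTop).atTop_div_const
      (by positivity)
  refine tendsto_atTop_mono' _ ?_ hlim
  filter_upwards [hp (1 / (2 * j)) (by positivity), eventually_ge_atTop (2 * j),
    eventually_ge_atTop 1] with n hn hn2 hn1
  have hnR : (1 : ℝ) ≤ n := by exact_mod_cast hn1
  set y := (n : ℝ) ^ (-(1 / (2 * (j : ℝ)))) with hy
  have hy0 : 0 < y := by positivity
  have hy1 : y ≤ 1 := Real.rpow_le_one_of_one_le_of_nonpos hnR (by
    have : (0 : ℝ) ≤ 1 / (2 * j) := by positivity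
    linarith)
  have hb : y / (4 * j) ≤ 1 - Real.exp (-(n * p n / (2 * j))) := by
    have h3 : y / (2 * j) ≤ n * p n / (2 * j) := by gcongr
    have h4 : y / (2 * j) ≤ 1 := by
      rw [div_le_one (by positivity)]; linarith
    have h5 := half_mul_le_one_sub_exp (x := y / (2 * j)) (by positivity) h4
    have h6 : Real.exp (-(n * p n / (2 * j))) ≤ Real.exp (-(y / (2 * j))) := by gcongr
    calc y / (4 * j) = y / (2 * j) / 2 := by field_simp; norm_num
      _ ≤ _ := by linarith
  have h7 : (y / (4 * j)) ^ j ≤ binomTail (p n) (n - 1) j :=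
    (pow_le_pow_left₀ (by positivity) hb j).trans
      (one_sub_exp_pow_le_binomTail (h0 n) (h1 n) hj hn2)
  have h8 : y ^ j = (n : ℝ) ^ (-(1 / 2) : ℝ) := by
    rw [hy, ← Real.rpow_natCast, ← Real.rpow_mul (by positivity)]
    congr 1; field_simp
  calc (n : ℝ) ^ (1 / 2 : ℝ) / (4 * j) ^ j = n * (y / (4 * j)) ^ j := by
        rw [div_pow, h8, ← mul_div_assoc]
        congr 1
        nth_rewrite 2 [← Real.rpow_one (n : ℝ)]
        rw [← Real.rpow_add (by positivity)]; norm_num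
    _ ≤ _ := by gcongr

end BinomTailAsymptotics

section Asymptotics

/-- The error of the main bound at a threshold `k` up to which the degree counts are large. -/
noncomputable def thresholdError (c C a₀ : ℝ) (k : ℕ) : ℝ :=
  2 * Real.exp (-(c / 2 * (k + 1))) +
    (4 * (1 + k + C * ((k + 1) ^ 3 + a₀)) * Real.exp (-(c / 2 * k)) + 4 * Real.exp (-(c * k)))

theorem tendsto_pow_mul_exp_neg_mul {c : ℝ} (hc : 0 < c) (m : ℕ) :
    Tendsto (fun x : ℝ => x ^ m * Real.exp (-(c * x))) atTop (𝓝 0) := by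
  have h := (Real.tendsto_pow_mul_exp_neg_atTop_nhds_zero m).comp
    (tendsto_id.const_mul_atTop hc)
  have h2 := h.const_mul (c ^ m)⁻¹
  rw [mul_zero] at h2
  refine h2.congr fun x => ?_
  simp only [Function.comp_apply, id_eq, mul_pow]
  field_simp

theorem tendsto_thresholdError {c : ℝ} (hc : 0 < c) (C a₀ : ℝ) :
    Tendsto (thresholdError c C a₀) atTop (𝓝 0) := by
  have h : ∀ m, Tendsto (fun k : ℕ => (k : ℝ) ^ m * Real.exp (-(c / 2 * k))) atTop (𝓝 0) := fun m =>
    (tendsto_pow_mul_exp_neg_mul (half_pos hc) m).comp tendsto_natCast_atTop_atTop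
  have h' : Tendsto (fun k : ℕ => (k : ℝ) ^ 0 * Real.exp (-(c * k))) atTop (𝓝 0) :=
    (tendsto_pow_mul_exp_neg_mul hc 0).comp tendsto_natCast_atTop_atTop
  have := ((h 0).const_mul (2 * Real.exp (-(c / 2)) + 4 * (1 + C * (1 + a₀)))).add
    (((h 1).const_mul (4 * (1 + 3 * C))).add (((h 2).const_mul (4 * (3 * C))).add
      (((h 3).const_mul (4 * C)).add (h'.const_mul 4))))
  simp only [mul_zero, add_zero] at this
  refine this.congr fun k => ?_
  have e : Real.exp (-(c / 2 * (k + 1))) = Real.exp (-(c / 2)) * Real.exp (-(c / 2 * k)) := by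
    rw [← Real.exp_add]; congr 1; ring
  rw [thresholdError, e]
  ring

theorem floor_binomTail {P s t : ℝ} {n : ℕ} (hP0 : 0 ≤ P) (hP1 : P ≤ 1) (hs0 : 0 < s)
    (hs3 : s ^ 3 = n * P) (ht : 2 ≤ t) (htn : 2 * t ≤ n) :
    2 ≤ ⌊t⌋₊ ∧ 2 * ⌊t⌋₊ ≤ n ∧
      1 - t * Real.exp (-(s ^ 3 / (2 * t))) ≤ binomTail P (n - 1) ⌊t⌋₊ := by
  have hj2 : 2 ≤ ⌊t⌋₊ := Nat.le_floor (by exact_mod_cast ht)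
  have hjt : (⌊t⌋₊ : ℝ) ≤ t := Nat.floor_le (by linarith)
  have hj2R : (2 : ℝ) ≤ ⌊t⌋₊ := by exact_mod_cast hj2
  have hjn : 2 * ⌊t⌋₊ ≤ n := by
    have : (2 : ℝ) * ⌊t⌋₊ ≤ n := by linarith
    exact_mod_cast this
  refine ⟨hj2, hjn, ?_⟩
  refine le_trans ?_ (one_sub_mul_exp_le_binomTail hP0 hP1 (by omega) hjn)
  rw [← hs3]
  have : ⌊t⌋₊ * Real.exp (-(s ^ 3 / (2 * ⌊t⌋₊))) ≤ t * Real.exp (-(s ^ 3 / (2 * t))) := by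
    gcongr
  linarith

theorem exists_large_degree {c P s L s₂ η : ℝ} {n : ℕ} (hc0 : 0 < c) (hP0 : 0 ≤ P) (hP1 : P ≤ 1)
    (hs0 : 0 < s) (hs3 : s ^ 3 = n * P) (hnpos : (0 : ℝ) < n) (hexplog : Real.exp L = n)
    (hL0 : 0 ≤ L) (hlog1 : (2 / c) ^ 3 ≤ L) (hlog2 : max s₂ 2 ^ 2 ≤ L) (hcase : L ^ 2 ≤ n * P)
    (hs₂ : ∀ s ≥ s₂, s ^ 2 * Real.exp (-(1 / 2 * s)) ≤ η) :
    ∃ j : ℕ, 2 ≤ j ∧ 1 - binomTail P (n - 1) j ≤ η ∧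
      n * (2 * Real.exp (-(c * j))) ≤ 2 * Real.exp c / n := by
  have hsn : s ^ 3 ≤ n := by rw [hs3]; exact mul_le_of_le_one_right hnpos.le hP1
  have hsX : max s₂ 2 ≤ s := by
    refine le_of_pow_le_pow_left₀ three_ne_zero hs0.le ?_
    rw [hs3]
    refine le_trans ?_ hcase
    have h2 : (2 : ℝ) ≤ max s₂ 2 := le_max_right _ _
    calc max s₂ 2 ^ 3 ≤ (max s₂ 2 ^ 2) ^ 2 := by
          rw [← pow_mul]; exact pow_le_pow_right₀ (by linarith) (by norm_num)
      _ ≤ _ := by gcongr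
  have hs2 : 2 ≤ s := (le_max_right _ _).trans hsX
  obtain ⟨hj2, hjn, hb⟩ := floor_binomTail (t := s ^ 2) hP0 hP1 hs0 hs3 (by nlinarith)
    (by nlinarith [sq_nonneg s])
  have hexp1 : s ^ 3 / (2 * s ^ 2) = 1 / 2 * s := by field_simp
  rw [hexp1] at hb
  have hb' := hs₂ s ((le_max_left _ _).trans hsX)
  refine ⟨⌊s ^ 2⌋₊, hj2, by linarith, ?_⟩
  have hsq : 2 / c * L ≤ s ^ 2 := by
    refine le_of_pow_le_pow_left₀ three_ne_zero (by positivity) ?_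
    calc (2 / c * L) ^ 3 = (2 / c) ^ 3 * L ^ 3 := mul_pow _ _ _
      _ ≤ L * L ^ 3 := by gcongr
      _ = (L ^ 2) ^ 2 := by ring
      _ ≤ (n * P) ^ 2 := by gcongr
      _ = _ := by rw [← hs3]; ring
  have hsq' : 2 * L ≤ c * s ^ 2 := by
    rw [div_mul_eq_mul_div, div_le_iff₀ hc0] at hsq; linarith
  have hexp2 : Real.exp (-(c * ⌊s ^ 2⌋₊)) ≤ Real.exp c * (1 / n * (1 / n)) := by
    have h1 : (1 : ℝ) / n = Real.exp (-L) := by rw [Real.exp_neg, hexplog, one_div]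
    rw [h1, ← Real.exp_add, ← Real.exp_add, Real.exp_le_exp]
    have h2 : s ^ 2 - 1 < ⌊s ^ 2⌋₊ := Nat.sub_one_lt_floor _
    nlinarith
  calc _ ≤ n * (2 * (Real.exp c * (1 / n * (1 / n)))) := by gcongr
    _ = _ := by field_simp

theorem exists_threshold {c P s L s₁ : ℝ} {n k₂ : ℕ} (hc0 : 0 < c) (hP0 : 0 ≤ P) (hP1 : P ≤ 1)
    (hs0 : 0 < s) (hs3 : s ^ 3 = n * P) (hnpos : (0 : ℝ) < n) (hexplog : Real.exp L = n)
    (hL4 : 4 ≤ L) (hlog3 : c ^ 3 ≤ L) (hcase : n * P < L ^ 2) (hs₁2 : 2 ≤ s₁)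
    (hs₀ : ∀ s ≥ s₁, s * Real.exp (-(1 / 2 * s)) ≤ 1 / 2) (hnk₂ : k₂ ≤ n)
    (hμ : Real.exp (c / 2 * k₂) ≤ n * binomTail P (n - 1) k₂) :
    ∃ k : ℕ, k₂ ≤ k ∧ Real.exp (c / 2 * k) ≤ n * binomTail P (n - 1) k ∧
      n * binomTail P (n - 1) (k + 1) ≤ Real.exp (c / 2 * (k + 1)) ∧
      n * P ≤ (k + 1) ^ 3 + s₁ ^ 3 := by
  classical
  have hsn : s ^ 3 ≤ n := by rw [hs3]; exact mul_le_of_le_one_right hnpos.le hP1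
  set Q : ℕ → Prop := fun j => Real.exp (c / 2 * j) ≤ n * binomTail P (n - 1) j with hQ
  set k := Nat.findGreatest Q n with hk
  have hkk : k₂ ≤ k := Nat.le_findGreatest hnk₂ hμ
  have hQk : Q k := Nat.findGreatest_spec (P := Q) hnk₂ hμ
  refine ⟨k, hkk, hQk, ?_, ?_⟩
  · by_cases hkn : k + 1 ≤ n
    · have := Nat.findGreatest_is_greatest (P := Q) (Nat.lt_succ_self k) hkn
      simp only [hQ, not_le] at this
      push_cast at this
      exact this.le
    · rw [binomTail_eq_zero (by omega), mul_zero]; positivity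
  have hk0 : (0 : ℝ) ≤ (k + 1) ^ 3 := by positivity
  have hs₁0 : 0 ≤ s₁ ^ 3 := by positivity
  by_cases hss : s ≤ s₁
  · rw [← hs3]
    have : s ^ 3 ≤ s₁ ^ 3 := by gcongr
    linarith
  push Not at hss
  have hs2 : 2 ≤ s := hs₁2.trans hss.le
  obtain ⟨hj2, hjn, hb⟩ := floor_binomTail (t := s) hP0 hP1 hs0 hs3 hs2 (by nlinarith [sq_nonneg s])
  have h1 : s * Real.exp (-(s ^ 3 / (2 * s))) ≤ 1 / 2 := by
    refine le_trans ?_ (hs₀ s hss.le)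
    have h2 : s ^ 3 / (2 * s) = 1 / 2 * s * s := by field_simp
    have h3 : 1 / 2 * s ≤ 1 / 2 * s * s := by nlinarith
    rw [h2]
    exact mul_le_mul_of_nonneg_left (Real.exp_le_exp.2 (neg_le_neg h3)) hs0.le
  have hsL : c * s ≤ L := by
    refine le_of_pow_le_pow_left₀ three_ne_zero (by linarith) ?_
    calc (c * s) ^ 3 = c ^ 3 * s ^ 3 := mul_pow _ _ _
      _ ≤ L * L ^ 2 := by rw [hs3]; gcongr
      _ = _ := by ring
  have hQj : Q ⌊s⌋₊ := by
    have hjs : (⌊s⌋₊ : ℝ) ≤ s := Nat.floor_le hs0.le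
    have h5 : Real.exp (c / 2 * ⌊s⌋₊) ≤ n / 2 := by
      have h6 : (2 : ℝ) ≤ Real.exp (L / 2) := by
        have := Real.add_one_le_exp (L / 2); linarith
      have h7 : Real.exp (L / 2) * Real.exp (L / 2) = n := by
        rw [← Real.exp_add, add_halves, hexplog]
      have h8 : Real.exp (c / 2 * ⌊s⌋₊) ≤ Real.exp (L / 2) := by
        rw [Real.exp_le_exp]; nlinarith
      nlinarith
    have h9 : n / 2 ≤ n * binomTail P (n - 1) ⌊s⌋₊ := by nlinarith
    exact h5.trans h9
  have hjk : ⌊s⌋₊ ≤ k := Nat.le_findGreatest (by omega) hQj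
  have h10 : s ≤ k + 1 := by
    have h11 := Nat.lt_floor_add_one s
    have h12 : (⌊s⌋₊ : ℝ) ≤ k := by exact_mod_cast hjk
    linarith
  rw [← hs3]
  have : s ^ 3 ≤ ((k : ℝ) + 1) ^ 3 := by gcongr
  linarith

variable {T : Type*} [AddCommGroup T] [MeasurableSpace T] [MeasurableAdd₂ T] [MeasurableNeg T]
variable (U : Measure T) [IsProbabilityMeasure U] [U.IsAddRightInvariant]

theorem measureReal_maxDegreeClustering_le_thresholdError {n : ℕ} {K K₂ : Set T}
    (hKm : MeasurableSet K)
    (hK : ∀ t ∈ K, -t ∈ K) (hK₂m : MeasurableSet K₂) (hKK : K ⊆ K₂)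
    (hK₂ : ∀ s ∈ K, ∀ t ∈ K, s - t ∈ K₂) (hp : 0 < U.real K) {w : ℝ}
    (hw : (U.prod U).real {q | q.1 ∈ K ∧ q.2 ∈ K ∧ q.1 - q.2 ∈ K} = w * U.real K ^ 2)
    {ε : ℝ} (hε : 0 < ε) {k : ℕ} (hk : 2 ≤ k) {C a₀ : ℝ} (hC : 0 ≤ C)
    (hK₂C : U.real K₂ ≤ C * U.real K)
    (hlow : Real.exp (ε ^ 2 / 128 / 2 * k) ≤ n * binomTail (U.real K) (n - 1) k)
    (hup : n * binomTail (U.real K) (n - 1) (k + 1) ≤ Real.exp (ε ^ 2 / 128 / 2 * (k + 1)))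
    (ha : n * U.real K ≤ (k + 1) ^ 3 + a₀) :
    (Measure.pi fun _ : Fin n => U).real {x | ε < |maxDegreeClustering (cayleyGraph K x) - w|} ≤
      thresholdError (ε ^ 2 / 128) C a₀ k := by
  have hpos := (Real.exp_pos _).trans_le hlow
  refine (measureReal_maxDegreeClustering_le U hKm hK hK₂m hKK hK₂ hp hw hε hk hpos).trans ?_
  set c := ε ^ 2 / 128 with hc
  unfold thresholdError
  have e1 : Real.exp (-(ε ^ 2 * ((k + 1 : ℕ) : ℝ) / 128)) =
      Real.exp (-(c / 2 * (k + 1))) * Real.exp (-(c / 2 * (k + 1))) := by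
    rw [← Real.exp_add, hc]; push_cast; congr 1; ring
  have e2 : Real.exp (-(ε ^ 2 * (k : ℝ) / 128)) = Real.exp (-(c * k)) := by
    rw [hc]; congr 1; ring
  rw [e1, e2]
  have e3 : Real.exp (c / 2 * (k + 1)) * Real.exp (-(c / 2 * (k + 1))) = 1 := by
    rw [← Real.exp_add]; simp
  refine add_le_add ?_ (add_le_add ?_ le_rfl)
  · calc _ ≤ Real.exp (c / 2 * (k + 1)) *
          (2 * (Real.exp (-(c / 2 * (k + 1))) * Real.exp (-(c / 2 * (k + 1))))) := by gcongr
      _ = 2 * (Real.exp (c / 2 * (k + 1)) * Real.exp (-(c / 2 * (k + 1)))) *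
          Real.exp (-(c / 2 * (k + 1))) := by ring
      _ = _ := by rw [e3]; ring
  · have h1 : n * U.real K₂ ≤ C * ((k + 1) ^ 3 + a₀) := by
      calc n * U.real K₂ ≤ n * (C * U.real K) := by gcongr
        _ = C * (n * U.real K) := by ring
        _ ≤ _ := by gcongr
    have h2 : 0 ≤ n * U.real K₂ := by positivity
    have h3 : 0 ≤ 4 * (1 + k + C * ((k + 1) ^ 3 + a₀)) := by
      have : (0 : ℝ) ≤ k := by positivity
      linarith
    calc _ ≤ 4 * (1 + k + C * ((k + 1) ^ 3 + a₀)) / Real.exp (c / 2 * k) := by gcongr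
      _ = _ := by rw [Real.exp_neg, div_eq_mul_inv]

theorem tendsto_measureReal_maxDegreeClustering {K K₂ : ℕ → Set T}
    (hKm : ∀ n, MeasurableSet (K n)) (hK : ∀ n, ∀ t ∈ K n, -t ∈ K n)
    (hK₂m : ∀ n, MeasurableSet (K₂ n)) (hKK : ∀ n, K n ⊆ K₂ n)
    (hK₂ : ∀ n, ∀ s ∈ K n, ∀ t ∈ K n, s - t ∈ K₂ n) {w : ℝ}
    (hw : ∀ᶠ n in atTop, (U.prod U).real {q | q.1 ∈ K n ∧ q.2 ∈ K n ∧ q.1 - q.2 ∈ K n} =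
      w * U.real (K n) ^ 2) {C : ℝ} (hC : 0 ≤ C)
    (hK₂C : ∀ᶠ n in atTop, U.real (K₂ n) ≤ C * U.real (K n))
    (hp : ∀ δ : ℝ, 0 < δ → ∀ᶠ n : ℕ in atTop, (n : ℝ) ^ (-δ) ≤ n * U.real (K n))
    {ε : ℝ} (hε : 0 < ε) :
    Tendsto (fun n : ℕ => (Measure.pi fun _ : Fin n => U).real
      {x | ε < |maxDegreeClustering (cayleyGraph (K n) x) - w|}) atTop (𝓝 0) := by
  set c := ε ^ 2 / 128 with hc
  have hc0 : 0 < c := by positivity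
  have hp0 : ∀ n, 0 ≤ U.real (K n) := fun n => measureReal_nonneg
  have hp1 : ∀ n, U.real (K n) ≤ 1 := fun n => measureReal_le_one
  obtain ⟨s₀, hs₀⟩ : ∃ s₀ : ℝ, ∀ s ≥ s₀, s * Real.exp (-(1 / 2 * s)) ≤ 1 / 2 := by
    have := (tendsto_pow_mul_exp_neg_mul (c := 1 / 2) (by norm_num) 1).eventually_le_const
      (show (0 : ℝ) < 1 / 2 by norm_num)
    simpa using eventually_atTop.1 this
  set s₁ := max s₀ 2 with hs₁
  refine tendsto_order.2 ⟨fun a ha => Eventually.of_forall fun n => ha.trans_le measureReal_nonneg,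
    fun η hη => ?_⟩
  obtain ⟨k₁, hk₁⟩ := eventually_atTop.1
    ((tendsto_thresholdError hc0 C (s₁ ^ 3)).eventually_lt_const hη)
  set k₂ := max k₁ 2 with hk₂
  have hk₂pos : 0 < k₂ := by omega
  have hlog : Tendsto (fun n : ℕ => Real.log n) atTop atTop :=
    Real.tendsto_log_atTop.comp tendsto_natCast_atTop_atTop
  obtain ⟨s₂, hs₂⟩ : ∃ s₂ : ℝ, ∀ s ≥ s₂, s ^ 2 * Real.exp (-(1 / 2 * s)) ≤ η / 4 := by
    have := (tendsto_pow_mul_exp_neg_mul (c := 1 / 2) (by norm_num) 2).eventually_le_const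
      (show (0 : ℝ) < η / 4 by positivity)
    exact eventually_atTop.1 this
  have hinv : Tendsto (fun n : ℕ => 2 * Real.exp c / (n : ℝ)) atTop (𝓝 0) :=
    tendsto_const_nhds.div_atTop tendsto_natCast_atTop_atTop
  filter_upwards [hw, hK₂C, hp 1 one_pos, eventually_ge_atTop 8, eventually_ge_atTop k₂,
    (tendsto_mul_binomTail hp0 hp1 hp hk₂pos).eventually_ge_atTop (Real.exp (c / 2 * k₂)),
    hlog.eventually_ge_atTop ((2 / c) ^ 3), hlog.eventually_ge_atTop (max s₂ 2 ^ 2),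
    hinv.eventually_lt_const (show (0 : ℝ) < η / 2 by positivity),
    hlog.eventually_ge_atTop (c ^ 3)]
    with n hwn hK₂Cn hpn hn8 hnk₂ hμ hlog1 hlog2 hinvn hlog3
  have hn8R : (8 : ℝ) ≤ n := by exact_mod_cast hn8
  have hnpos : (0 : ℝ) < n := by linarith
  set P := U.real (K n) with hP
  have ha0 : 0 < n * P := (by positivity : (0 : ℝ) < (n : ℝ) ^ (-(1 : ℝ))).trans_le hpn
  have hPpos : 0 < P := pos_of_mul_pos_right ha0 hnpos.le
  have hPle : P ≤ 1 := hp1 n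
  set s : ℝ := (n * P) ^ (1 / 3 : ℝ) with hs
  have hs0 : 0 < s := by positivity
  have hs3 : s ^ 3 = n * P := by
    rw [hs, ← Real.rpow_natCast, ← Real.rpow_mul ha0.le]; norm_num
  have hexplog : Real.exp (Real.log n) = n := Real.exp_log hnpos
  set L := Real.log n with hL
  have hL4 : 4 ≤ L := by
    refine le_trans ?_ hlog2
    have : (2 : ℝ) ≤ max s₂ 2 := le_max_right _ _
    nlinarith
  by_cases hcase : L ^ 2 ≤ n * P
  · obtain ⟨j, hj2, hj, hjn⟩ := exists_large_degree hc0 hPpos.le hPle hs0 hs3 hnpos hexplog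
      (by linarith) hlog1 hlog2 hcase hs₂
    refine (measureReal_maxDegreeClustering_le' U (hKm n) (hK n) hPpos hwn hε hj2
      (by omega)).trans_lt ?_
    have e : ε ^ 2 * (j : ℝ) / 128 = c * j := by rw [hc]; ring
    rw [e]
    linarith
  · push Not at hcase
    obtain ⟨k, hkk, hlow, hup, ha⟩ := exists_threshold hc0 hPpos.le hPle hs0 hs3 hnpos hexplog hL4
      hlog3 hcase (le_max_right s₀ 2) (fun s hs => hs₀ s ((le_max_left _ _).trans hs)) hnk₂ hμ
    exact (measureReal_maxDegreeClustering_le_thresholdError U (hKm n) (hK n) (hK₂m n) (hKK n)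
      (hK₂ n) hPpos hwn hε (by omega) hC hK₂Cn hlow hup ha).trans_lt (hk₁ k (by omega))

end Asymptotics

section ProductIndependence

variable {ι E : Type*} [Fintype ι] [DecidableEq ι] [MeasurableSpace E]
  (ν : ι → Measure E) [∀ i, IsProbabilityMeasure (ν i)]

/-- Functions of disjoint sets of coordinates are uncorrelated under a product measure. -/
theorem integral_mul_of_disjoint_coords (B : Finset ι) {f g : (ι → E) → ℝ} (hf : Measurable f)
    {C : ℝ} (hC : ∀ x, |f x| ≤ C) (hg : Measurable g) {D : ℝ} (hD : ∀ x, |g x| ≤ D)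
    (hfB : ∀ l ∈ B, ∀ x t, f (Function.update x l t) = f x)
    (hgB : ∀ l, l ∉ B → ∀ x t, g (Function.update x l t) = g x) :
    ∫ x, f x * g x ∂Measure.pi ν = (∫ x, f x ∂Measure.pi ν) * ∫ x, g x ∂Measure.pi ν := by
  induction B using Finset.induction generalizing g with
  | empty =>
    obtain ⟨x0⟩ : Nonempty (ι → E) := nonempty_of_isProbabilityMeasure (Measure.pi ν)
    have : g = fun _ => g x0 := funext fun x =>
      eq_of_update_eq (fun l => hgB l (Finset.notMem_empty l)) x x0
    rw [this]
    simp [integral_mul_const]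
  | insert l B hl ih =>
    set g' : (ι → E) → ℝ := fun x => ∫ t, g (Function.update x l t) ∂ν l with hg'
    have hg'm : Measurable g' := measurable_integral_update ν hg l
    have hg'D : ∀ x, |g' x| ≤ D := fun x => abs_integral_le_of_bounded fun t => hD _
    have hfg : Measurable (fun x => f x * g x) := hf.mul hg
    have hfgb : ∀ x, |f x * g x| ≤ C * D := fun x => by
      rw [abs_mul]
      exact mul_le_mul (hC x) (hD x) (abs_nonneg _) ((abs_nonneg _).trans (hC x))
    have h := ih hg'm hg'D (fun m hm => hfB m (Finset.mem_insert_of_mem hm)) fun m hm x t => by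
      by_cases hml : m = l
      · subst hml; simp [hg']
      · simp only [hg']
        congr 1; ext s
        rw [Function.update_comm hml]
        exact hgB m (by simp [hml, hm]) _ t
    rw [integral_pi_update' ν hfg hfgb l, integral_pi_update' ν hg hD l, ← h]
    congr 1; ext x
    simp only [hfB l (Finset.mem_insert_self l B), integral_const_mul, hg']

theorem integral_pi_pair {F : E × E → ℝ} (hF : Measurable F) {C : ℝ} (hC : ∀ q, |F q| ≤ C) {a b : ι}
    (hab : a ≠ b) :
    ∫ y, F (y a, y b) ∂Measure.pi ν = ∫ q, F q ∂(ν a).prod (ν b) := by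
  have hm : Measurable (fun y : ι → E => F (y a, y b)) :=
    hF.comp ((measurable_pi_apply a).prodMk (measurable_pi_apply b))
  rw [integral_pi_update ν hm (fun y => hC _) a]
  have h1 : ∀ t, ∫ y, F (Function.update y a t a, Function.update y a t b) ∂Measure.pi ν =
      ∫ s, F (t, s) ∂ν b := by
    intro t
    simp only [Function.update_self, Function.update_of_ne hab.symm]
    exact integral_comp_measurePreserving (measurePreserving_eval ν b)
      (f := fun s => F (t, s)) (hF.comp measurable_prodMk_left)
  simp_rw [h1]
  rw [integral_prod _ (integrable_of_bounded hF hC)]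

end ProductIndependence

section Triples

variable {T : Type*} [AddCommGroup T] {n : ℕ}

/-- The triples `(k, j, i)` with `i < j < k`. -/
def triples (n : ℕ) : Finset (Fin n × Fin n × Fin n) :=
  Finset.univ.filter fun t => t.2.1 < t.1 ∧ t.2.2 < t.2.1

theorem mem_triples {t : Fin n × Fin n × Fin n} :
    t ∈ triples n ↔ t.2.1 < t.1 ∧ t.2.2 < t.2.1 := by simp [triples]

theorem sum_triples {M : Type*} [AddCommMonoid M] (F : Fin n → Fin n → Fin n → M) :
    ∑ k, ∑ j ∈ Finset.Iio k, ∑ i ∈ Finset.Iio j, F k j i =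
      ∑ t ∈ triples n, F t.1 t.2.1 t.2.2 := by
  rw [triples, Finset.sum_filter, Fintype.sum_prod_type]
  refine Finset.sum_congr rfl fun k _ => ?_
  rw [Fintype.sum_prod_type, ← Finset.filter_gt_eq_Iio, Finset.sum_filter]
  refine Finset.sum_congr rfl fun j _ => ?_
  rw [← Finset.filter_gt_eq_Iio, Finset.sum_filter]
  by_cases h : j < k <;> simp [h]

theorem sum_Iio_val (k : Fin n) (f : ℕ → ℕ) :
    ∑ j ∈ Finset.Iio k, f j = ∑ j ∈ Finset.range k, f j := by
  refine Finset.sum_bij (fun j _ => (j : ℕ)) (fun j hj => by simpa using hj)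
    (fun a _ b _ h => Fin.ext h) (fun b hb => ?_) fun _ _ => rfl
  have hb' := Finset.mem_range.1 hb
  exact ⟨⟨b, hb'.trans k.2⟩, by simpa [Fin.lt_def] using hb', rfl⟩

theorem card_triples (n : ℕ) : (triples n).card = n.choose 3 := by
  have h := sum_triples (n := n) (fun _ _ _ => 1)
  rw [Finset.sum_const, smul_eq_mul, mul_one] at h
  rw [← h]
  have h1 : ∀ j : Fin n, ∑ i ∈ Finset.Iio j, 1 = (j : ℕ) := fun j => by simp
  simp_rw [h1]
  have h2 : ∀ k : Fin n, ∑ j ∈ Finset.Iio k, (j : ℕ) = (k : ℕ).choose 2 := fun k => by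
    rw [sum_Iio_val k (fun j => j), Finset.sum_range_id, Nat.choose_two_right]
  simp_rw [h2]
  rw [Fin.sum_univ_eq_sum_range (fun k => k.choose 2) n]
  clear h h1 h2
  induction n with
  | zero => simp
  | succ n ih => rw [Finset.sum_range_succ, ih, Nat.choose_succ_succ' n 2, add_comm]

theorem cube_div_le_card_triples {n : ℕ} (hn : 3 ≤ n) :
    (n : ℝ) ^ 3 / 27 ≤ ((triples n).card : ℝ) := by
  rw [card_triples]
  obtain ⟨m, rfl⟩ := Nat.exists_eq_add_of_le hn
  have h : (((3 + m).choose 3 : ℕ) : ℝ) * 6 = (3 + m) * (2 + m) * (1 + m) := by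
    have h1 := Nat.descFactorial_eq_factorial_mul_choose (3 + m) 3
    have h2 : (3 + m).descFactorial 3 = (1 + m) * ((2 + m) * (3 + m)) := by
      simp only [Nat.descFactorial, mul_one, Nat.sub_zero]
      congr 1
      · omega
      · congr 1
        omega
    rw [h2] at h1
    have h3 : ((1 + m) * ((2 + m) * (3 + m)) : ℝ) =
        (Nat.factorial 3 : ℕ) * ((3 + m).choose 3 : ℕ) := by
      exact_mod_cast h1
    simp only [Nat.factorial] at h3
    push_cast at h3
    linarith
  have hm : (0 : ℝ) ≤ m := by positivity
  push_cast
  nlinarith [mul_nonneg hm hm, mul_nonneg (mul_nonneg hm hm) hm]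

/-- The vertices of a triple. -/
def vertices (t : Fin n × Fin n × Fin n) : Finset (Fin n) := {t.1, t.2.1, t.2.2}

theorem card_vertices_le (t : Fin n × Fin n × Fin n) : (vertices t).card ≤ 3 :=
  Finset.card_le_three

/-- A kernel of the two differences seen from the first vertex of a triple. -/
def tripleKernel (φ : T × T → ℝ) (t : Fin n × Fin n × Fin n) (x : Fin n → T) : ℝ :=
  φ (x t.2.2 - x t.1, x t.2.1 - x t.1)

theorem tripleKernel_update (φ : T × T → ℝ) (t : Fin n × Fin n × Fin n) {l : Fin n}
    (hl : l ∉ vertices t) (x : Fin n → T) (s : T) :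
    tripleKernel φ t (Function.update x l s) = tripleKernel φ t x := by
  simp only [vertices, Finset.mem_insert, Finset.mem_singleton, not_or] at hl
  simp only [tripleKernel]
  rw [Function.update_of_ne (Ne.symm hl.1), Function.update_of_ne (Ne.symm hl.2.1),
    Function.update_of_ne (Ne.symm hl.2.2)]

theorem card_filter_two_le (A : Finset (Fin n)) (hA : A.card ≤ 3) :
    (((triples n).filter fun t => 2 ≤ (A ∩ vertices t).card).card : ℝ) ≤ 27 * n := by
  have hsub : ((triples n).filter fun t => 2 ≤ (A ∩ vertices t).card) ⊆
      (A ×ˢ A ×ˢ Finset.univ) ∪ ((A ×ˢ Finset.univ ×ˢ A) ∪ (Finset.univ ×ˢ A ×ˢ A)) := by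
    rintro ⟨k, j, i⟩ ht
    have hc := (Finset.mem_filter.1 ht).2
    have hone : ∀ v : Fin n, ¬ (A ∩ vertices (k, j, i) ⊆ {v}) := fun v hv => by
      have := Finset.card_le_card hv
      rw [Finset.card_singleton] at this; omega
    have h1 := hone k
    have h2 := hone j
    have h3 := hone i
    simp only [vertices, Finset.subset_iff, Finset.mem_inter, Finset.mem_insert,
      Finset.mem_singleton] at h1 h2 h3
    simp only [Finset.mem_union, Finset.mem_product, Finset.mem_univ, and_true, true_and]
    by_cases hk : k ∈ A <;> by_cases hj : j ∈ A <;> by_cases hi : i ∈ A <;>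
      simp only [hk, hj, hi] <;> simp
    · exact h1 (by rintro l ⟨hl, rfl | rfl | rfl⟩ <;> simp_all)
    · exact h2 (by rintro l ⟨hl, rfl | rfl | rfl⟩ <;> simp_all)
    · exact h3 (by rintro l ⟨hl, rfl | rfl | rfl⟩ <;> simp_all)
    · exact h1 (by rintro l ⟨hl, rfl | rfl | rfl⟩ <;> simp_all)
  have h := (Finset.card_le_card hsub).trans ((Finset.card_union_le _ _).trans
    (Nat.add_le_add_left (Finset.card_union_le _ _) _))
  simp only [Finset.card_product, Finset.card_univ, Fintype.card_fin] at h
  have h9 : A.card * A.card ≤ 9 := Nat.mul_le_mul hA hA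
  have : ((triples n).filter fun t => 2 ≤ (A ∩ vertices t).card).card ≤ 27 * n := by nlinarith
  exact_mod_cast this

theorem card_filter_subset_le (A : Finset (Fin n)) (hA : A.card ≤ 3) :
    (((triples n).filter fun t => vertices t ⊆ A).card : ℝ) ≤ 27 := by
  have hsub : ((triples n).filter fun t => vertices t ⊆ A) ⊆ A ×ˢ A ×ˢ A := by
    rintro ⟨k, j, i⟩ ht
    have hc := (Finset.mem_filter.1 ht).2
    simp only [Finset.mem_product]
    exact ⟨hc (by simp [vertices]), hc (by simp [vertices]), hc (by simp [vertices])⟩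
  have h := Finset.card_le_card hsub
  simp only [Finset.card_product] at h
  have h9 : A.card * (A.card * A.card) ≤ 3 * (3 * 3) :=
    Nat.mul_le_mul hA (Nat.mul_le_mul hA hA)
  exact_mod_cast h.trans h9

/-- The indicator that both components lie in `K`. -/
noncomputable def cherryKernel (K : Set T) (q : T × T) : ℝ :=
  K.indicator (fun _ => (1 : ℝ)) q.1 * K.indicator (fun _ => (1 : ℝ)) q.2

/-- The indicator that both components and their difference lie in `K`. -/
noncomputable def triangleKernel (K : Set T) (q : T × T) : ℝ :=
  cherryKernel K q * K.indicator (fun _ => (1 : ℝ)) (q.1 - q.2)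

theorem indicator_one_nonneg {α : Type*} (A : Set α) (t : α) :
    0 ≤ A.indicator (fun _ => (1 : ℝ)) t := Set.indicator_nonneg (fun _ _ => zero_le_one) t

theorem indicator_one_le_one {α : Type*} (A : Set α) (t : α) :
    A.indicator (fun _ => (1 : ℝ)) t ≤ 1 := (le_abs_self _).trans (abs_indicator_one_le A t)

theorem tripleKernel_le_sum {K : Set T} (hK : ∀ t ∈ K, -t ∈ K) {φ : T × T → ℝ}
    (hφ : ∀ q, φ q ≤ cherryKernel K q) {t' : Fin n × Fin n × Fin n} (A : Finset (Fin n))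
    {e : Fin n} (he : vertices t' \ A = {e}) (ht' : t' ∈ triples n) (x : Fin n → T) :
    tripleKernel φ t' x ≤ ∑ v ∈ A, K.indicator (fun _ => (1 : ℝ)) (x e - x v) := by
  obtain ⟨k, j, i⟩ := t'
  obtain ⟨h1, h2⟩ := mem_triples.1 ht'
  simp only at h1 h2
  have hA : ∀ l, l = k ∨ l = j ∨ l = i → l ≠ e → l ∈ A := fun l hl hle => by
    by_contra hlA
    have : l ∈ vertices (k, j, i) \ A := Finset.mem_sdiff.2 ⟨by simpa [vertices] using hl, hlA⟩
    rw [he, Finset.mem_singleton] at this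
    exact hle this
  have hmem : e = k ∨ e = j ∨ e = i := by
    have : e ∈ vertices (k, j, i) \ A := by rw [he]; simp
    simpa [vertices] using (Finset.mem_sdiff.1 this).1
  have hsym : ∀ s : T, K.indicator (fun _ => (1 : ℝ)) s = K.indicator (fun _ => (1 : ℝ)) (-s) := by
    intro s
    by_cases h : s ∈ K
    · simp [h, hK s h]
    · have : -s ∉ K := fun h' => h (by simpa using hK _ h')
      simp [h, this]
  have key : ∀ v ∈ A, K.indicator (fun _ => (1 : ℝ)) (x e - x v) ≤
      ∑ v ∈ A, K.indicator (fun _ => (1 : ℝ)) (x e - x v) := fun v hv =>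
    Finset.single_le_sum (f := fun v => K.indicator (fun _ => (1 : ℝ)) (x e - x v))
      (fun v _ => indicator_one_nonneg K _) hv
  have hle1 : tripleKernel φ (k, j, i) x ≤ K.indicator (fun _ => (1 : ℝ)) (x i - x k) :=
    (hφ _).trans (mul_le_of_le_one_right (indicator_one_nonneg _ _) (indicator_one_le_one _ _))
  have hle2 : tripleKernel φ (k, j, i) x ≤ K.indicator (fun _ => (1 : ℝ)) (x j - x k) :=
    (hφ _).trans (mul_le_of_le_one_left (indicator_one_nonneg _ _) (indicator_one_le_one _ _))
  rcases hmem with rfl | rfl | rfl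
  · refine hle1.trans (le_trans (le_of_eq ?_) (key i (hA i (by simp) (h2.trans h1).ne)))
    rw [hsym, neg_sub]
  · exact hle2.trans (key k (hA k (by simp) h1.ne'))
  · exact hle1.trans (key k (hA k (by simp) (h2.trans h1).ne'))

variable [MeasurableSpace T] [MeasurableAdd₂ T] [MeasurableNeg T]

theorem measurable_tripleKernel {φ : T × T → ℝ} (hφ : Measurable φ) (t : Fin n × Fin n × Fin n) :
    Measurable (tripleKernel φ t) := by
  have h : ∀ a b : Fin n, Measurable (fun x : Fin n → T => x a - x b) := fun a b =>
    (measurable_pi_apply a).sub (measurable_pi_apply b)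
  exact hφ.comp ((h _ _).prodMk (h _ _))

variable (U : Measure T) [IsProbabilityMeasure U] [U.IsAddRightInvariant]

theorem integral_tripleKernel {φ : T × T → ℝ} (hφ : Measurable φ) {C : ℝ} (hC : ∀ q, |φ q| ≤ C)
    {t : Fin n × Fin n × Fin n} (ht : t ∈ triples n) :
    ∫ x, tripleKernel φ t x ∂(Measure.pi fun _ : Fin n => U) = ∫ q, φ q ∂U.prod U := by
  obtain ⟨h1, h2⟩ := mem_triples.1 ht
  have e : ∀ x : Fin n → T, tripleKernel φ t x =
      φ (seenFrom t.1 x t.2.2, seenFrom t.1 x t.2.1) := fun x => by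
    rw [seenFrom_of_ne h1.ne, seenFrom_of_ne (h2.trans h1).ne]; rfl
  simp_rw [e]
  rw [integral_comp_measurePreserving (measurePreserving_seenFrom U t.1)
    (f := fun y => φ (y t.2.2, y t.2.1))
    (hφ.comp ((measurable_pi_apply _).prodMk (measurable_pi_apply _))),
    integral_pi_pair (fun _ : Fin n => U) hφ hC h2.ne]

/-- Triples with at most one common vertex are uncorrelated. -/
theorem integral_tripleKernel_mul_of_inter_subset {φ : T × T → ℝ} (hφ : Measurable φ) {C : ℝ}
    (hC : ∀ q, |φ q| ≤ C) {t t' : Fin n × Fin n × Fin n} (ht : t ∈ triples n)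
    (ht' : t' ∈ triples n) (hc : (vertices t ∩ vertices t').card ≤ 1) :
    ∫ x, tripleKernel φ t x * tripleKernel φ t' x ∂(Measure.pi fun _ : Fin n => U) =
      (∫ q, φ q ∂U.prod U) ^ 2 := by
  obtain ⟨v, hv, hsub⟩ : ∃ v ∈ vertices t', vertices t ∩ vertices t' ⊆ {v} := by
    rcases (vertices t ∩ vertices t').eq_empty_or_nonempty with h | ⟨v, hv⟩
    · exact ⟨t'.1, by simp [vertices], by rw [h]; exact Finset.empty_subset _⟩
    · exact ⟨v, (Finset.mem_inter.1 hv).2, fun l hl => by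
        rw [Finset.mem_singleton]; exact Finset.card_le_one.1 hc l hl v hv⟩
  set B := (vertices t').erase v with hB
  set sh : (Fin n → T) → Fin n → T := fun x l => if l ∈ B then x l - x v else x l with hsh
  have hmp : MeasurePreserving sh (Measure.pi fun _ => U) (Measure.pi fun _ => U) :=
    measurePreserving_shear U v B (by simp [hB])
  set z : (Fin n → T) → Fin n → T := fun y => Function.update y v 0 with hz
  have hzm : Measurable z := measurable_pi_iff.2 fun l => by
    by_cases h : l = v
    · subst h; simp [hz]
    · simp only [hz, Function.update_of_ne h]; exact measurable_pi_apply l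
  have hf : ∀ x, tripleKernel φ t x = tripleKernel φ t (sh x) := by
    intro x
    have hl : ∀ l ∈ vertices t, sh x l = x l := fun l hl => by
      simp only [hsh]
      rw [if_neg]
      intro hlB
      have h := Finset.mem_erase.1 hlB
      exact h.1 (Finset.mem_singleton.1 (hsub (Finset.mem_inter.2 ⟨hl, h.2⟩)))
    simp only [tripleKernel]
    rw [hl _ (by simp [vertices]), hl _ (by simp [vertices]), hl _ (by simp [vertices])]
  have hg : ∀ x, tripleKernel φ t' x = tripleKernel φ t' (z (sh x)) := by
    intro x
    have hl : ∀ l ∈ vertices t', z (sh x) l = x l - x v := fun l hl => by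
      by_cases h : l = v
      · subst h; simp [hz]
      · simp [hz, hsh, hB, h, hl]
    simp only [tripleKernel]
    rw [hl _ (by simp [vertices]), hl _ (by simp [vertices]), hl _ (by simp [vertices])]
    simp
  have hgm : Measurable (fun y => tripleKernel φ t' (z y)) :=
    (measurable_tripleKernel hφ t').comp hzm
  have hfm := measurable_tripleKernel hφ t
  have hgint : ∫ y, tripleKernel φ t' (z y) ∂(Measure.pi fun _ : Fin n => U) =
      ∫ q, φ q ∂U.prod U := by
    rw [← integral_tripleKernel U hφ hC ht', ← integral_comp_measurePreserving hmp hgm]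
    simp_rw [← hg]
  have e : ∀ x, tripleKernel φ t x * tripleKernel φ t' x =
      tripleKernel φ t (sh x) * tripleKernel φ t' (z (sh x)) := fun x => by
    rw [← hf, ← hg]
  simp_rw [e]
  rw [integral_comp_measurePreserving hmp
    (f := fun y => tripleKernel φ t y * tripleKernel φ t' (z y)) (hfm.mul hgm),
    integral_mul_of_disjoint_coords (fun _ : Fin n => U) B hfm (fun x => hC _) hgm (fun x => hC _)
      (fun l hl x s => tripleKernel_update φ t (fun hlt => ?_) x s) fun l hl x s => ?_,
    hgint, integral_tripleKernel U hφ hC ht, sq]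
  · have h := Finset.mem_erase.1 hl
    exact h.1 (Finset.mem_singleton.1 (hsub (Finset.mem_inter.2 ⟨hlt, h.2⟩)))
  · by_cases h : l = v
    · subst h; simp [hz]
    · simp only [hz]
      rw [Function.update_comm h]
      refine tripleKernel_update φ t' (fun hlt => hl ?_) _ _
      exact Finset.mem_erase.2 ⟨h, hlt⟩

theorem measurable_cherryKernel {T : Type*} [MeasurableSpace T] {K : Set T}
    (hKm : MeasurableSet K) :
    Measurable (cherryKernel K) :=
  ((measurable_indicator_one hKm).comp measurable_fst).mul
    ((measurable_indicator_one hKm).comp measurable_snd)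

theorem measurable_triangleKernel {K : Set T} (hKm : MeasurableSet K) :
    Measurable (triangleKernel K) :=
  (measurable_cherryKernel hKm).mul
    ((measurable_indicator_one hKm).comp (measurable_fst.sub measurable_snd))

theorem integral_cherryKernel {T : Type*} [MeasurableSpace T] {U : Measure T}
    [IsProbabilityMeasure U] {K : Set T}
    (hKm : MeasurableSet K) : ∫ q, cherryKernel K q ∂U.prod U = U.real K ^ 2 := by
  unfold cherryKernel
  rw [integral_prod_mul (K.indicator fun _ => (1 : ℝ)) (K.indicator fun _ => (1 : ℝ)),
    integral_ind U hKm, sq]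

theorem integral_triangleKernel {U : Measure T} [IsProbabilityMeasure U] {K : Set T}
    (hKm : MeasurableSet K) : ∫ q, triangleKernel K q ∂U.prod U =
      (U.prod U).real {q | q.1 ∈ K ∧ q.2 ∈ K ∧ q.1 - q.2 ∈ K} := by
  have hm : MeasurableSet {q : T × T | q.1 ∈ K ∧ q.2 ∈ K ∧ q.1 - q.2 ∈ K} :=
    (measurable_fst hKm).inter ((measurable_snd hKm).inter
      ((measurable_fst.sub measurable_snd) hKm))
  rw [← integral_ind _ hm]
  refine congrArg _ (funext fun q => ?_)
  by_cases h1 : q.1 ∈ K <;> by_cases h2 : q.2 ∈ K <;> by_cases h3 : q.1 - q.2 ∈ K <;>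
    simp [triangleKernel, cherryKernel, h1, h2, h3]

theorem cherryKernel_le_one {T : Type*} (K : Set T) (q : T × T) : cherryKernel K q ≤ 1 :=
  mul_le_one₀ (indicator_one_le_one _ _) (indicator_one_nonneg _ _) (indicator_one_le_one _ _)

theorem cherryKernel_nonneg {T : Type*} (K : Set T) (q : T × T) : 0 ≤ cherryKernel K q :=
  mul_nonneg (indicator_one_nonneg _ _) (indicator_one_nonneg _ _)

theorem integral_tripleKernel_mul_indicator {K : Set T} (hKm : MeasurableSet K) {φ : T × T → ℝ}
    (hφm : Measurable φ) (hφ1 : ∀ q, |φ q| ≤ 1) {t : Fin n × Fin n × Fin n} (ht : t ∈ triples n)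
    {e v : Fin n} (he : e ∉ vertices t) (hv : v ∈ vertices t) :
    ∫ x, tripleKernel φ t x * K.indicator (fun _ => (1 : ℝ)) (x e - x v)
      ∂(Measure.pi fun _ : Fin n => U) = (∫ q, φ q ∂U.prod U) * U.real K := by
  have hev : v ≠ e := ne_of_mem_of_not_mem hv he
  have hm : Measurable (fun x : Fin n → T =>
      tripleKernel φ t x * K.indicator (fun _ => (1 : ℝ)) (x e - x v)) :=
    (measurable_tripleKernel hφm t).mul
      ((measurable_indicator_one hKm).comp ((measurable_pi_apply e).sub (measurable_pi_apply v)))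
  rw [integral_pi_update' (fun _ : Fin n => U) hm (C := 1 * 1) (fun x => ?_) e]
  · have h1 : ∀ a : T, ∫ s, K.indicator (fun _ => (1 : ℝ)) (s - a) ∂U = U.real K := fun a => by
      rw [integral_comp_measurePreserving (measurePreserving_sub_right U a)
        (measurable_indicator_one hKm), integral_ind U hKm]
    simp only [tripleKernel_update φ t he, Function.update_self, Function.update_of_ne hev,
      integral_const_mul, h1, integral_mul_const]
    rw [integral_tripleKernel U hφm hφ1 ht]
  · rw [abs_mul]
    exact mul_le_mul (hφ1 _) (abs_indicator_one_le _ _) (abs_nonneg _) zero_le_one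

open scoped Classical in
theorem integral_tripleKernel_mul_le {K : Set T} (hKm : MeasurableSet K) (hK : ∀ t ∈ K, -t ∈ K)
    {φ : T × T → ℝ} (hφm : Measurable φ) (hφ0 : ∀ q, 0 ≤ φ q) (hφ : ∀ q, φ q ≤ cherryKernel K q)
    {t t' : Fin n × Fin n × Fin n} (ht : t ∈ triples n) (ht' : t' ∈ triples n) :
    ∫ x, tripleKernel φ t x * tripleKernel φ t' x ∂(Measure.pi fun _ : Fin n => U) ≤
      (∫ q, φ q ∂U.prod U) ^ 2 +
      ((if 2 ≤ (vertices t ∩ vertices t').card then 3 * U.real K ^ 3 else 0) +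
        if vertices t' ⊆ vertices t then U.real K ^ 2 else 0) := by
  have hφ1 : ∀ q, |φ q| ≤ 1 := fun q => by
    rw [abs_of_nonneg (hφ0 q)]; exact (hφ q).trans (cherryKernel_le_one K q)
  have hp0 : 0 ≤ U.real K := measureReal_nonneg
  have hmle : ∫ q, φ q ∂U.prod U ≤ U.real K ^ 2 := by
    rw [← integral_cherryKernel hKm]
    refine integral_mono (integrable_of_bounded hφm hφ1)
      (integrable_of_bounded (measurable_cherryKernel hKm) (C := 1) fun q => ?_) hφ
    rw [abs_of_nonneg (cherryKernel_nonneg K q)]; exact cherryKernel_le_one K q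
  have hΦm := fun t : Fin n × Fin n × Fin n => measurable_tripleKernel hφm t
  have hint : Integrable (fun x => tripleKernel φ t x * tripleKernel φ t' x)
      (Measure.pi fun _ : Fin n => U) :=
    integrable_of_bounded ((hΦm t).mul (hΦm t')) (C := 1) fun x => by
      rw [abs_mul]; exact mul_le_one₀ (hφ1 _) (abs_nonneg _) (hφ1 _)
  by_cases h2 : 2 ≤ (vertices t ∩ vertices t').card
  · by_cases hsub : vertices t' ⊆ vertices t
    · have : ∫ x, tripleKernel φ t x * tripleKernel φ t' x ∂(Measure.pi fun _ : Fin n => U) ≤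
          U.real K ^ 2 := by
        refine le_trans (integral_mono hint (integrable_of_bounded (hΦm t) fun x => hφ1 _)
          fun x => ?_) ((integral_tripleKernel U hφm hφ1 ht).le.trans hmle)
        exact mul_le_of_le_one_right (hφ0 _) ((le_abs_self _).trans (hφ1 _))
      rw [if_pos h2, if_pos hsub]
      have : 0 ≤ 3 * U.real K ^ 3 := by positivity
      have := sq_nonneg (∫ q, φ q ∂U.prod U)
      linarith
    · obtain ⟨e, he⟩ : ∃ e, vertices t' \ vertices t = {e} := by
        rw [← Finset.card_eq_one]
        have h3 := card_vertices_le t'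
        have h4 := Finset.card_sdiff_add_card_inter (vertices t') (vertices t)
        rw [Finset.inter_comm] at h4
        have h5 : 0 < (vertices t' \ vertices t).card :=
          Finset.card_pos.2 (Finset.sdiff_nonempty.2 hsub)
        omega
      have het : e ∉ vertices t := by
        have : e ∈ vertices t' \ vertices t := by rw [he]; simp
        exact (Finset.mem_sdiff.1 this).2
      have hI : ∀ v, Integrable (fun x : Fin n → T =>
          tripleKernel φ t x * K.indicator (fun _ => (1 : ℝ)) (x e - x v))
          (Measure.pi fun _ : Fin n => U) := fun v =>
        integrable_of_bounded ((hΦm t).mul ((measurable_indicator_one hKm).comp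
          ((measurable_pi_apply e).sub (measurable_pi_apply v)))) (C := 1) fun x => by
            rw [abs_mul]
            exact mul_le_one₀ (hφ1 _) (abs_nonneg _) (abs_indicator_one_le _ _)
      have : ∫ x, tripleKernel φ t x * tripleKernel φ t' x ∂(Measure.pi fun _ : Fin n => U) ≤
          3 * U.real K ^ 3 := by
        calc _ ≤ ∫ x, ∑ v ∈ vertices t, tripleKernel φ t x *
              K.indicator (fun _ => (1 : ℝ)) (x e - x v) ∂(Measure.pi fun _ : Fin n => U) := by
              refine integral_mono hint (integrable_finsetSum _ fun v _ => hI v) fun x => ?_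
              simp only
              rw [← Finset.mul_sum]
              exact mul_le_mul_of_nonneg_left (tripleKernel_le_sum hK hφ _ he ht' x) (hφ0 _)
          _ = ∑ v ∈ vertices t, (∫ q, φ q ∂U.prod U) * U.real K := by
              rw [integral_finsetSum _ fun v _ => hI v]
              exact Finset.sum_congr rfl fun v hv =>
                integral_tripleKernel_mul_indicator U hKm hφm hφ1 ht het hv
          _ ≤ 3 * (U.real K ^ 2 * U.real K) := by
              rw [Finset.sum_const, nsmul_eq_mul]
              have h3 : ((vertices t).card : ℝ) ≤ 3 := by exact_mod_cast card_vertices_le t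
              have h4 : 0 ≤ ∫ q, φ q ∂U.prod U := integral_nonneg hφ0
              gcongr
          _ = _ := by ring
      rw [if_pos h2, if_neg hsub]
      have := sq_nonneg (∫ q, φ q ∂U.prod U)
      linarith
  · rw [integral_tripleKernel_mul_of_inter_subset U hφm hφ1 ht ht' (by omega), if_neg h2]
    have : (0 : ℝ) ≤ if vertices t' ⊆ vertices t then U.real K ^ 2 else 0 := by positivity
    linarith

/-- Chebyshev's inequality for a sum over triples. -/
theorem mul_measureReal_abs_sum_tripleKernel_sub_ge_le {K : Set T} (hKm : MeasurableSet K)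
    (hK : ∀ t ∈ K, -t ∈ K) {φ : T × T → ℝ} (hφm : Measurable φ) (hφ0 : ∀ q, 0 ≤ φ q)
    (hφ : ∀ q, φ q ≤ cherryKernel K q) {τ : ℝ} (hτ : 0 ≤ τ) :
    τ ^ 2 * (Measure.pi fun _ : Fin n => U).real
      {x | τ ≤ |∑ t ∈ triples n, tripleKernel φ t x - (triples n).card * ∫ q, φ q ∂U.prod U|} ≤
      (triples n).card * (81 * n * U.real K ^ 3 + 27 * U.real K ^ 2) := by
  classical
  have hφ1 : ∀ q, |φ q| ≤ 1 := fun q => by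
    rw [abs_of_nonneg (hφ0 q)]; exact (hφ q).trans (cherryKernel_le_one K q)
  set P : Measure (Fin n → T) := Measure.pi fun _ : Fin n => U with hP
  set m := ∫ q, φ q ∂U.prod U with hm
  set N : ℝ := ((triples n).card : ℝ) with hN
  set S : (Fin n → T) → ℝ := fun x => ∑ t ∈ triples n, tripleKernel φ t x with hS
  have hΦm := fun t : Fin n × Fin n × Fin n => measurable_tripleKernel hφm t
  have hΦi := fun t : Fin n × Fin n × Fin n =>
    integrable_of_bounded (m := P) (hΦm t) fun x => hφ1 _
  have hSi : Integrable S P := integrable_finsetSum _ fun t _ => hΦi t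
  have hI : ∀ t t' : Fin n × Fin n × Fin n,
      Integrable (fun x => tripleKernel φ t x * tripleKernel φ t' x) P := fun t t' =>
    integrable_of_bounded ((hΦm t).mul (hΦm t')) (C := 1) fun x => by
      rw [abs_mul]; exact mul_le_one₀ (hφ1 _) (abs_nonneg _) (hφ1 _)
  have hSS : ∀ x, S x ^ 2 = ∑ t ∈ triples n, ∑ t' ∈ triples n,
      tripleKernel φ t x * tripleKernel φ t' x := fun x => by
    rw [sq]; exact Finset.sum_mul_sum _ _ _ _
  have hS2i : Integrable (fun x => S x ^ 2) P := by
    simp_rw [hSS]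
    exact integrable_finsetSum _ fun t _ => integrable_finsetSum _ fun t' _ => hI t t'
  have hES : ∫ x, S x ∂P = N * m := by
    rw [integral_finsetSum _ fun t _ => hΦi t,
      Finset.sum_congr rfl fun t ht => integral_tripleKernel U hφm hφ1 ht, Finset.sum_const,
      nsmul_eq_mul]
  have hES2 : ∫ x, S x ^ 2 ∂P ≤
      (N * m) ^ 2 + N * (81 * n * U.real K ^ 3 + 27 * U.real K ^ 2) := by
    simp_rw [hSS]
    rw [integral_finsetSum _ fun t _ => integrable_finsetSum _ fun t' _ => hI t t']
    calc _ ≤ ∑ t ∈ triples n, (N * m ^ 2 + (81 * n * U.real K ^ 3 + 27 * U.real K ^ 2)) := by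
          refine Finset.sum_le_sum fun t ht => ?_
          rw [integral_finsetSum _ fun t' _ => hI t t']
          refine (Finset.sum_le_sum fun t' ht' =>
            integral_tripleKernel_mul_le U hKm hK hφm hφ0 hφ ht ht').trans ?_
          rw [Finset.sum_add_distrib, Finset.sum_add_distrib, Finset.sum_const, nsmul_eq_mul,
            ← Finset.sum_filter, ← Finset.sum_filter, Finset.sum_const, Finset.sum_const,
            nsmul_eq_mul, nsmul_eq_mul]
          have h1 := card_filter_two_le (vertices t) (card_vertices_le t)
          have h2 := card_filter_subset_le (vertices t) (card_vertices_le t)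
          have h3 : 0 ≤ 3 * U.real K ^ 3 := by positivity
          have h4 : 0 ≤ U.real K ^ 2 := by positivity
          have h5 := mul_le_mul_of_nonneg_right h1 h3
          have h6 := mul_le_mul_of_nonneg_right h2 h4
          linarith
      _ = _ := by rw [Finset.sum_const, nsmul_eq_mul]; ring
  have e : ∀ x, (S x - N * m) ^ 2 = S x ^ 2 + (-(2 * (N * m)) * S x + (N * m) ^ 2) :=
    fun x => by ring
  have hvi : Integrable (fun x => (S x - N * m) ^ 2) P := by
    simp_rw [e]
    exact hS2i.add ((hSi.const_mul _).add (integrable_const _))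
  have hvar : ∫ x, (S x - N * m) ^ 2 ∂P ≤ N * (81 * n * U.real K ^ 3 + 27 * U.real K ^ 2) := by
    simp_rw [e]
    have h3 := hSi.const_mul (-(2 * (N * m)))
    rw [integral_add hS2i (integrable_fun_add h3 (integrable_const _)),
      integral_add h3 (integrable_const _), integral_const_mul, hES]
    simp only [integral_const, probReal_univ, smul_eq_mul, one_mul]
    nlinarith
  have hmk := mul_meas_ge_le_integral_of_nonneg (μ := P) (f := fun x => (S x - N * m) ^ 2)
    (Eventually.of_forall fun x => sq_nonneg _) hvi (τ ^ 2)
  refine le_trans (mul_le_mul_of_nonneg_left (measureReal_mono fun x hx => ?_) (sq_nonneg τ))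
    (hmk.trans hvar)
  rw [Set.mem_ofPred_eq] at hx ⊢
  rw [← sq_abs (S x - N * m)]
  exact pow_le_pow_left₀ hτ hx 2

end Triples

section GlobalClustering

variable {T : Type*} [AddCommGroup T] {n : ℕ}

theorem edgeIndicator_comm (G : SimpleGraph (Fin n)) (i j : Fin n) :
    edgeIndicator G i j = edgeIndicator G j i := by
  unfold edgeIndicator
  by_cases h : G.Adj i j
  · rw [if_pos h, if_pos h.symm]
  · rw [if_neg h, if_neg fun h' => h h'.symm]

theorem edgeIndicator_cayleyGraph {K : Set T} (hK : ∀ t ∈ K, -t ∈ K) (x : Fin n → T)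
    {i j : Fin n} (hij : i ≠ j) :
    edgeIndicator (cayleyGraph K x) i j = K.indicator (fun _ => (1 : ℝ)) (x j - x i) := by
  unfold edgeIndicator
  have : (cayleyGraph K x).Adj i j ↔ x j - x i ∈ K := by
    rw [cayleyGraph_adj hK]
    exact ⟨fun h => by simpa using hK _ h.2, fun h => ⟨hij, by simpa using hK _ h⟩⟩
  by_cases h : x j - x i ∈ K <;> simp [this, h]

theorem globalClustering_cayleyGraph {K : Set T} (hK : ∀ t ∈ K, -t ∈ K) (x : Fin n → T) :
    globalClustering (cayleyGraph K x) =
      (∑ t ∈ triples n, tripleKernel (triangleKernel K) t x) /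
        ∑ t ∈ triples n, tripleKernel (cherryKernel K) t x := by
  unfold globalClustering
  rw [sum_triples fun k j i => edgeIndicator (cayleyGraph K x) k i *
      edgeIndicator (cayleyGraph K x) k j * edgeIndicator (cayleyGraph K x) i j,
    sum_triples fun k j i => edgeIndicator (cayleyGraph K x) k i *
      edgeIndicator (cayleyGraph K x) k j]
  congr 1
  · refine Finset.sum_congr rfl fun t ht => ?_
    obtain ⟨h1, h2⟩ := mem_triples.1 ht
    rw [edgeIndicator_cayleyGraph hK x (h2.trans h1).ne', edgeIndicator_cayleyGraph hK x h1.ne',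
      ← neg_sub]
    rw [edgeIndicator_comm _ t.2.2 t.2.1, edgeIndicator_cayleyGraph hK x h2.ne']
    simp [tripleKernel, triangleKernel, cherryKernel]
  · refine Finset.sum_congr rfl fun t ht => ?_
    obtain ⟨h1, h2⟩ := mem_triples.1 ht
    rw [edgeIndicator_cayleyGraph hK x (h2.trans h1).ne', edgeIndicator_cayleyGraph hK x h1.ne']
    rfl

theorem abs_div_sub_le {a b w M η : ℝ} (hM : 0 < M) (hw0 : 0 ≤ w) (hw1 : w ≤ 1) (hη0 : 0 ≤ η)
    (hη : η ≤ 1 / 2) (ha : |a - w * M| ≤ η * M) (hb : |b - M| ≤ η * M) :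
    |a / b - w| ≤ 4 * η := by
  obtain ⟨hb1, hb2⟩ := abs_le.1 hb
  obtain ⟨ha1, ha2⟩ := abs_le.1 ha
  have hbpos : M / 2 ≤ b := by nlinarith
  have hb0 : 0 < b := by linarith
  have e : a / b - w = (a - w * b) / b := by field_simp
  rw [e, abs_div, abs_of_pos hb0, div_le_iff₀ hb0]
  have h1 : |a - w * b| ≤ 2 * (η * M) := by
    have hηM : 0 ≤ η * M := by positivity
    rw [abs_le]; constructor <;> nlinarith
  nlinarith

variable [MeasurableSpace T] [MeasurableAdd₂ T] [MeasurableNeg T]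
variable (U : Measure T) [IsProbabilityMeasure U] [U.IsAddRightInvariant]

theorem measureReal_globalClustering_le (hn : 3 ≤ n) {K : Set T} (hKm : MeasurableSet K)
    (hK : ∀ t ∈ K, -t ∈ K) (hp : 0 < U.real K) {w : ℝ} (hw0 : 0 ≤ w) (hw1 : w ≤ 1)
    (hw : (U.prod U).real {q | q.1 ∈ K ∧ q.2 ∈ K ∧ q.1 - q.2 ∈ K} = w * U.real K ^ 2)
    {η : ℝ} (hη0 : 0 < η) (hη : η ≤ 1 / 2) :
    (Measure.pi fun _ : Fin n => U).real {x | 4 * η < |globalClustering (cayleyGraph K x) - w|} ≤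
      2 * (27 / η ^ 2 * (81 * ((n : ℝ) ^ 2 * U.real K)⁻¹ +
        27 * ((n : ℝ) ^ 3 * U.real K ^ 2)⁻¹)) := by
  set P : Measure (Fin n → T) := Measure.pi fun _ : Fin n => U with hP
  set p := U.real K with hpdef
  set N : ℝ := ((triples n).card : ℝ) with hN
  have hnpos : (0 : ℝ) < n := by
    have : 0 < n := by omega
    exact_mod_cast this
  have hNn : (n : ℝ) ^ 3 / 27 ≤ N := cube_div_le_card_triples hn
  have hN0 : 0 < N := lt_of_lt_of_le (by positivity) hNn
  have hM : 0 < N * p ^ 2 := by positivity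
  have htri0 : ∀ q, 0 ≤ triangleKernel K q := fun q =>
    mul_nonneg (cherryKernel_nonneg K q) (indicator_one_nonneg _ _)
  have htri : ∀ q, triangleKernel K q ≤ cherryKernel K q := fun q =>
    mul_le_of_le_one_right (cherryKernel_nonneg K q) (indicator_one_le_one _ _)
  have hb : ∀ φ : T × T → ℝ, Measurable φ → (∀ q, 0 ≤ φ q) → (∀ q, φ q ≤ cherryKernel K q) →
      P.real {x | η * (N * p ^ 2) ≤
        |∑ t ∈ triples n, tripleKernel φ t x - N * ∫ q, φ q ∂U.prod U|} ≤
        27 / η ^ 2 * (81 * ((n : ℝ) ^ 2 * p)⁻¹ + 27 * ((n : ℝ) ^ 3 * p ^ 2)⁻¹) := by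
    intro φ h1 h2 h3
    have h := mul_measureReal_abs_sum_tripleKernel_sub_ge_le U (n := n) hKm hK h1 h2 h3
      (τ := η * (N * p ^ 2)) (by positivity)
    rw [mul_comm, ← le_div_iff₀ (by positivity)] at h
    refine h.trans ?_
    rw [← hN, ← hpdef]
    calc N * (81 * n * p ^ 3 + 27 * p ^ 2) / (η * (N * p ^ 2)) ^ 2
        = (81 * n * p ^ 3 + 27 * p ^ 2) / (η ^ 2 * p ^ 4) / N := by field_simp
      _ ≤ (81 * n * p ^ 3 + 27 * p ^ 2) / (η ^ 2 * p ^ 4) / ((n : ℝ) ^ 3 / 27) := by gcongr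
      _ = _ := by field_simp
  have hc := hb _ (measurable_cherryKernel hKm) (cherryKernel_nonneg K) fun q => le_rfl
  have ht := hb _ (measurable_triangleKernel hKm) htri0 htri
  rw [integral_cherryKernel hKm] at hc
  rw [integral_triangleKernel hKm, hw] at ht
  have hsub : {x | 4 * η < |globalClustering (cayleyGraph K x) - w|} ⊆
      {x | η * (N * p ^ 2) ≤ |∑ t ∈ triples n, tripleKernel (cherryKernel K) t x - N * p ^ 2|} ∪
      {x | η * (N * p ^ 2) ≤
        |∑ t ∈ triples n, tripleKernel (triangleKernel K) t x - N * (w * p ^ 2)|} := by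
    intro x hx
    by_contra hcon
    rw [Set.mem_union, not_or, Set.mem_ofPred_eq, Set.mem_ofPred_eq, not_le, not_le] at hcon
    rw [Set.mem_ofPred_eq, globalClustering_cayleyGraph hK] at hx
    refine absurd hx (not_lt.2 (abs_div_sub_le hM hw0 hw1 hη0.le hη ?_ hcon.1.le))
    rw [show w * (N * p ^ 2) = N * (w * p ^ 2) by ring]
    exact hcon.2.le
  refine (measureReal_mono hsub).trans ((measureReal_union_le _ _).trans ?_)
  linarith

theorem tendsto_measureReal_globalClustering {K : ℕ → Set T} (hKm : ∀ n, MeasurableSet (K n))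
    (hK : ∀ n, ∀ t ∈ K n, -t ∈ K n) {w : ℝ} (hw0 : 0 ≤ w) (hw1 : w ≤ 1)
    (hw : ∀ᶠ n in atTop, (U.prod U).real {q | q.1 ∈ K n ∧ q.2 ∈ K n ∧ q.1 - q.2 ∈ K n} =
      w * U.real (K n) ^ 2)
    (hp : Tendsto (fun n : ℕ => (n : ℝ) ^ (3 / 2 : ℝ) * U.real (K n)) atTop atTop)
    {ε : ℝ} (hε : 0 < ε) :
    Tendsto (fun n : ℕ => (Measure.pi fun _ : Fin n => U).real
      {x | ε < |globalClustering (cayleyGraph (K n) x) - w|}) atTop (𝓝 0) := by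
  set η := min (ε / 4) (1 / 2) with hη
  have hη0 : 0 < η := by positivity
  have h1 : Tendsto (fun n : ℕ => (n : ℝ) ^ 3 * U.real (K n) ^ 2) atTop atTop := by
    refine (hp.atTop_mul_atTop₀ hp).congr fun n => ?_
    have : ((n : ℝ) ^ (3 / 2 : ℝ)) * ((n : ℝ) ^ (3 / 2 : ℝ)) = (n : ℝ) ^ 3 := by
      rw [← Real.rpow_natCast, ← sq, ← Real.rpow_natCast, ← Real.rpow_mul (by positivity)]
      norm_num
    rw [← this]; ring
  have h2 : Tendsto (fun n : ℕ => (n : ℝ) ^ 2 * U.real (K n)) atTop atTop := by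
    refine tendsto_atTop_mono' _ ?_ hp
    filter_upwards [eventually_ge_atTop 1] with n hn
    have hnR : (1 : ℝ) ≤ n := by exact_mod_cast hn
    have : (n : ℝ) ^ (3 / 2 : ℝ) ≤ (n : ℝ) ^ 2 := by
      rw [← Real.rpow_natCast]
      exact Real.rpow_le_rpow_of_exponent_le hnR (by norm_num)
    gcongr
  have hlim : Tendsto (fun n : ℕ => 2 * (27 / η ^ 2 * (81 * ((n : ℝ) ^ 2 * U.real (K n))⁻¹ +
        27 * ((n : ℝ) ^ 3 * U.real (K n) ^ 2)⁻¹))) atTop (𝓝 0) := by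
    have := (((h2.inv_tendsto_atTop.const_mul 81).add
      (h1.inv_tendsto_atTop.const_mul 27)).const_mul (27 / η ^ 2)).const_mul 2
    simpa using this
  refine tendsto_of_tendsto_of_tendsto_of_le_of_le' tendsto_const_nhds hlim
    (Eventually.of_forall fun n => measureReal_nonneg) ?_
  filter_upwards [hw, hp.eventually_gt_atTop 0, eventually_ge_atTop 3] with n hwn hpn hn
  have hpos : 0 < U.real (K n) := pos_of_mul_pos_right hpn (by positivity)
  refine le_trans (measureReal_mono fun x hx => ?_) (measureReal_globalClustering_le U hn (hKm n)
    (hK n) hpos hw0 hw1 hwn hη0 (min_le_right _ _))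
  rw [Set.mem_ofPred_eq] at hx ⊢
  have : η ≤ ε / 4 := min_le_left _ _
  linarith

end GlobalClustering

section Torus

variable {d : ℕ}

instance isProbabilityMeasure_volume_unitAddCircle :
    IsProbabilityMeasure (volume : Measure UnitAddCircle) :=
  ⟨by simp⟩

instance isProbabilityMeasure_volume_torus :
    IsProbabilityMeasure (volume : Measure (Fin d → UnitAddCircle)) := by
  rw [volume_pi]; infer_instance

/-- The Euclidean distance to the origin on the torus. -/
noncomputable def torusNorm (t : Fin d → UnitAddCircle) : ℝ :=
  ‖WithLp.toLp 2 (fun i => ‖t i‖)‖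

/-- The quotient map from Euclidean space to the torus. -/
noncomputable def toTorus (x : EuclideanSpace ℝ (Fin d)) : Fin d → UnitAddCircle :=
  fun i => (x i : UnitAddCircle)

/-- The ball of radius `r` in the torus. -/
def torusBall (d : ℕ) (r : ℝ) : Set (Fin d → UnitAddCircle) :=
  {t | torusNorm t ≤ r}

theorem euclidean_norm_le_of_abs_le {x y : EuclideanSpace ℝ (Fin d)} (h : ∀ i, |x i| ≤ |y i|) :
    ‖x‖ ≤ ‖y‖ := by
  rw [EuclideanSpace.norm_eq, EuclideanSpace.norm_eq]
  exact Real.sqrt_le_sqrt (Finset.sum_le_sum fun i _ => pow_le_pow_left₀ (norm_nonneg _) (h i) 2)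

theorem toTorus_sub (x y : EuclideanSpace ℝ (Fin d)) :
    toTorus (x - y) = toTorus x - toTorus y := by
  ext i; simp [toTorus]

theorem torusNorm_neg (t : Fin d → UnitAddCircle) : torusNorm (-t) = torusNorm t := by
  simp [torusNorm]

theorem torusNorm_add_le (s t : Fin d → UnitAddCircle) :
    torusNorm (s + t) ≤ torusNorm s + torusNorm t := by
  unfold torusNorm
  refine le_trans (euclidean_norm_le_of_abs_le fun i => ?_) (norm_add_le _ _)
  simp only [PiLp.add_apply, Pi.add_apply, abs_norm]
  exact (norm_add_le _ _).trans (le_abs_self _)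

theorem torusNorm_toTorus_le (x : EuclideanSpace ℝ (Fin d)) (z : Fin d → ℤ) :
    torusNorm (toTorus x) ≤ ‖x + WithLp.toLp 2 (fun i => (z i : ℝ))‖ := by
  refine euclidean_norm_le_of_abs_le fun i => ?_
  simp only [toTorus, PiLp.add_apply, UnitAddCircle.norm_eq, abs_abs]
  simpa using round_le (x i) (-z i)

theorem exists_torusNorm_toTorus_eq (x : EuclideanSpace ℝ (Fin d)) :
    torusNorm (toTorus x) = ‖x + WithLp.toLp 2 (fun i => ((-round (x i) : ℤ) : ℝ))‖ := by
  simp only [torusNorm, EuclideanSpace.norm_eq, toTorus, UnitAddCircle.norm_eq, PiLp.add_apply]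
  congr 1
  refine Finset.sum_congr rfl fun i _ => ?_
  simp [sub_eq_add_neg]

theorem torusNorm_toTorus_le_norm (x : EuclideanSpace ℝ (Fin d)) :
    torusNorm (toTorus x) ≤ ‖x‖ := by
  refine (torusNorm_toTorus_le x 0).trans_eq ?_
  congr 1
  ext i; simp

theorem torusDist_eq (x y : EuclideanSpace ℝ (Fin d)) :
    torusDist x y = torusNorm (toTorus x - toTorus y) := by
  rw [← toTorus_sub]
  refine le_antisymm ?_ (le_ciInf fun z => torusNorm_toTorus_le _ z)
  rw [exists_torusNorm_toTorus_eq]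
  exact ciInf_le (f := fun z : Fin d → ℤ => ‖x - y + WithLp.toLp 2 (fun i => (z i : ℝ))‖)
    ⟨0, by rintro _ ⟨z, rfl⟩; exact norm_nonneg _⟩ (fun i => -round ((x - y) i))

theorem torusGraph_eq {n : ℕ} (r : ℝ) (x : Fin n → EuclideanSpace ℝ (Fin d)) :
    torusGraph r x = cayleyGraph (torusBall d r) (fun i => toTorus (x i)) := by
  simp only [torusGraph, cayleyGraph, torusDist_eq, torusBall, Set.mem_ofPred_eq]

theorem measurable_toTorus : Measurable (toTorus (d := d)) :=
  measurable_pi_lambda _ fun i => AddCircle.measurable_mk'.comp (by fun_prop)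

theorem measurable_torusNorm : Measurable (torusNorm (d := d)) := by
  unfold torusNorm
  fun_prop

theorem measurableSet_torusBall (r : ℝ) : MeasurableSet (torusBall d r) :=
  measurableSet_le measurable_torusNorm measurable_const

theorem neg_mem_torusBall {r : ℝ} (t : Fin d → UnitAddCircle) (ht : t ∈ torusBall d r) :
    -t ∈ torusBall d r := by
  simpa [torusBall, torusNorm_neg] using ht

theorem torusBall_mono {r s : ℝ} (h : r ≤ s) : torusBall d r ⊆ torusBall d s :=
  fun _ ht => le_trans ht h

theorem sub_mem_torusBall {r : ℝ} (s : Fin d → UnitAddCircle) (hs : s ∈ torusBall d r)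
    (t : Fin d → UnitAddCircle) (ht : t ∈ torusBall d r) : s - t ∈ torusBall d (2 * r) := by
  have h := torusNorm_add_le s (-t)
  rw [torusNorm_neg] at h
  have h1 : torusNorm s ≤ r := hs
  have h2 : torusNorm t ≤ r := ht
  rw [sub_eq_add_neg]
  exact h.trans (by linarith)

/-- The half-open unit cube with corner `(a, …, a)`. -/
def halfOpenCube (d : ℕ) (a : ℝ) : Set (EuclideanSpace ℝ (Fin d)) :=
  {x | ∀ i, x i ∈ Set.Ioc a (a + 1)}

theorem halfOpenCube_eq_preimage (a : ℝ) :
    halfOpenCube d a = WithLp.ofLp ⁻¹' (Set.univ.pi fun _ : Fin d => Set.Ioc a (a + 1)) := by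
  ext x; simp [halfOpenCube]

theorem measurePreserving_toTorus (a : ℝ) :
    MeasurePreserving (toTorus (d := d)) (volume.restrict (halfOpenCube d a)) volume := by
  have h1 := (PiLp.volume_preserving_ofLp (Fin d)).restrict_preimage
    (MeasurableSet.univ_pi fun _ : Fin d => measurableSet_Ioc (a := a) (b := a + 1))
  rw [← halfOpenCube_eq_preimage, volume_pi, Measure.restrict_pi_pi] at h1
  exact (measurePreserving_pi _ _ fun _ : Fin d => UnitAddCircle.measurePreserving_mk a).comp h1

theorem halfOpenCube_ae_eq_unitCube :
    halfOpenCube d 0 =ᵐ[volume] unitCube d := by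
  have h : unitCube d = WithLp.ofLp ⁻¹' (Set.univ.pi fun _ : Fin d => Set.Icc (0 : ℝ) 1) := by
    ext x
    simp only [unitCube, Set.mem_ofPred_eq, Set.mem_preimage, Set.mem_univ_pi]
  rw [h, halfOpenCube_eq_preimage, zero_add]
  refine (PiLp.volume_preserving_ofLp (Fin d)).quasiMeasurePreserving.preimage_ae_eq ?_
  rw [volume_pi]
  exact Measure.pi_Ioc_ae_eq_pi_Icc

theorem map_toTorus_cond_unitCube :
    Measure.map toTorus (cond (volume : Measure (EuclideanSpace ℝ (Fin d))) (unitCube d)) =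
      volume := by
  have h := measurePreserving_toTorus (d := d) 0
  have h1 : volume (halfOpenCube d 0) = 1 := by
    have := h.measure_preimage (s := Set.univ) MeasurableSet.univ.nullMeasurableSet
    rwa [Set.preimage_univ, Measure.restrict_apply_univ, measure_univ] at this
  rw [ProbabilityTheory.cond, ← measure_congr halfOpenCube_ae_eq_unitCube,
    ← Measure.restrict_congr_set halfOpenCube_ae_eq_unitCube, h1, inv_one, one_smul, h.map_eq]

theorem map_toTorus_sample {Ω : Type*} [MeasurableSpace Ω] {P : Measure Ω} [IsProbabilityMeasure P]
    {n : ℕ} {X : Fin n → Ω → EuclideanSpace ℝ (Fin d)} (hX : ∀ i, Measurable (X i))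
    (hU : ∀ i, pdf.IsUniform (X i) (unitCube d) P volume) (hI : iIndepFun X P) :
    Measure.map (fun ω i => toTorus (X i ω)) P =
      Measure.pi fun _ : Fin n => (volume : Measure (Fin d → UnitAddCircle)) := by
  have h := hI.comp (fun _ => toTorus) fun _ => measurable_toTorus
  rw [iIndepFun_iff_map_fun_eq_pi_map
    fun i => (measurable_toTorus.comp (hX i)).aemeasurable] at h
  refine h.trans ?_
  congr 1
  ext1 i
  rw [← Measure.map_map measurable_toTorus (hX i), show Measure.map (X i) P = _ from hU i,
    map_toTorus_cond_unitCube]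

theorem torusNorm_toTorus_of_mem {x : EuclideanSpace ℝ (Fin d)}
    (hx : x ∈ halfOpenCube d (-(1 / 2))) : torusNorm (toTorus x) = ‖x‖ := by
  simp only [torusNorm, EuclideanSpace.norm_eq, toTorus, Real.norm_eq_abs, abs_norm, sq_abs]
  congr 1
  refine Finset.sum_congr rfl fun i _ => ?_
  rw [(AddCircle.norm_coe_eq_abs_iff (1 : ℝ) one_ne_zero).2, sq_abs]
  have := hx i
  rw [abs_one, abs_le]
  constructor <;> linarith [this.1, this.2]

theorem closedBall_subset_halfOpenCube {r : ℝ} (hr : r < 1 / 2) :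
    Metric.closedBall 0 r ⊆ halfOpenCube d (-(1 / 2)) := by
  intro x hx i
  rw [mem_closedBall_zero_iff] at hx
  have := abs_le.1 (((PiLp.norm_apply_le x i).trans hx))
  constructor <;> linarith [this.1, this.2]

theorem real_volume_torusBall {r : ℝ} (hr0 : 0 ≤ r) (hr : r < 1 / 2) :
    volume.real (torusBall d r) =
      r ^ d * volume.real (Metric.ball (0 : EuclideanSpace ℝ (Fin d)) 1) := by
  rw [← (measurePreserving_toTorus (-(1 / 2))).measureReal_preimage
    (measurableSet_torusBall r).nullMeasurableSet,
    measureReal_restrict_apply (measurable_toTorus (measurableSet_torusBall r))]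
  have : toTorus ⁻¹' torusBall d r ∩ halfOpenCube d (-(1 / 2)) = Metric.closedBall 0 r := by
    ext x
    rw [Set.mem_inter_iff, mem_closedBall_zero_iff]
    constructor
    · rintro ⟨h1, h2⟩
      rw [← torusNorm_toTorus_of_mem h2]; exact h1
    · intro h
      have h2 := closedBall_subset_halfOpenCube hr (mem_closedBall_zero_iff.2 h)
      exact ⟨(torusNorm_toTorus_of_mem h2).trans_le h, h2⟩
  rw [this, Measure.addHaar_real_closedBall _ _ hr0, finrank_euclideanSpace_fin]

theorem real_volume_torusBall_le {r : ℝ} (hr0 : 0 ≤ r) :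
    volume.real (torusBall d r) ≤
      r ^ d * volume.real (Metric.ball (0 : EuclideanSpace ℝ (Fin d)) 1) := by
  rw [← (measurePreserving_toTorus (-(1 / 2))).measureReal_preimage
    (measurableSet_torusBall r).nullMeasurableSet,
    measureReal_restrict_apply (measurable_toTorus (measurableSet_torusBall r))]
  have h := Measure.addHaar_real_closedBall (volume : Measure (EuclideanSpace ℝ (Fin d))) 0 hr0
  rw [finrank_euclideanSpace_fin] at h
  rw [← h]
  refine measureReal_mono ?_ measure_closedBall_lt_top.ne
  rintro x ⟨h1, h2⟩
  exact mem_closedBall_zero_iff.2 ((torusNorm_toTorus_of_mem h2).symm.trans_le h1)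

end Torus

section Triangles

open scoped Pointwise

variable {d : ℕ}

theorem real_volume_ball_pos (d : ℕ) :
    0 < volume.real (Metric.ball (0 : EuclideanSpace ℝ (Fin d)) 1) :=
  ENNReal.toReal_pos (Metric.measure_ball_pos _ _ one_pos).ne' measure_ball_lt_top.ne

theorem one_le_norm_of_ne_zero {z : Fin d → ℤ} (hz : z ≠ 0) :
    1 ≤ ‖(WithLp.toLp 2 (fun i => (z i : ℝ)) : EuclideanSpace ℝ (Fin d))‖ := by
  obtain ⟨i, hi⟩ := Function.ne_iff.1 hz
  refine le_trans ?_ (PiLp.norm_apply_le _ i)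
  rw [Real.norm_eq_abs, ← Int.cast_abs]
  exact_mod_cast Int.one_le_abs hi

/-- The pairs in the ball of radius `r` at distance at most `r`. -/
def closeBallPairs (d : ℕ) (r : ℝ) : Set (EuclideanSpace ℝ (Fin d) × EuclideanSpace ℝ (Fin d)) :=
  {q | q.1 ∈ Metric.closedBall 0 r ∧ q.2 ∈ Metric.closedBall 0 r ∧
    q.1 - q.2 ∈ Metric.closedBall 0 r}

theorem real_volume_closeBallPairs {r : ℝ} (hr : 0 < r) :
    volume.real (closeBallPairs d r) = r ^ (2 * d) * volume.real (closeBallPairs d 1) := by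
  have : closeBallPairs d r = r • closeBallPairs d 1 := by
    ext q
    rw [Set.mem_smul_set_iff_inv_smul_mem₀ hr.ne']
    simp only [closeBallPairs, Set.mem_ofPred_eq, mem_closedBall_zero_iff, Prod.smul_fst,
      Prod.smul_snd, ← smul_sub, norm_smul, norm_inv, Real.norm_eq_abs, abs_of_pos hr,
      inv_mul_le_iff₀ hr, mul_one]
  rw [this, measureReal_def, Measure.volume_eq_prod, Measure.addHaar_smul, ENNReal.toReal_mul,
    ENNReal.toReal_ofReal (abs_nonneg _), Module.finrank_prod, finrank_euclideanSpace_fin,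
    abs_of_pos (by positivity), two_mul]
  rfl

theorem ballProb_mul_sq (d : ℕ) :
    volume.real (closeBallPairs d 1) =
      ballProb d * volume.real (Metric.ball (0 : EuclideanSpace ℝ (Fin d)) 1) ^ 2 := by
  have hV := real_volume_ball_pos d
  have hc : volume.real (Metric.closedBall (0 : EuclideanSpace ℝ (Fin d)) 1) =
      volume.real (Metric.ball (0 : EuclideanSpace ℝ (Fin d)) 1) := by
    rw [Measure.addHaar_real_closedBall _ _ zero_le_one]; simp
  have h := prod_cond_real (U := (volume : Measure (EuclideanSpace ℝ (Fin d))))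
    (K := Metric.closedBall 0 1) measurableSet_closedBall (hc ▸ hV)
    (w := volume.real (closeBallPairs d 1) /
      volume.real (Metric.ball (0 : EuclideanSpace ℝ (Fin d)) 1) ^ 2)
    (by rw [hc, div_mul_cancel₀ _ (by positivity)]; rfl)
  simp only [mem_closedBall_zero_iff] at h
  rw [ballProb, h, div_mul_cancel₀ _ (by positivity)]

theorem ballProb_nonneg (d : ℕ) : 0 ≤ ballProb d := measureReal_nonneg

theorem ballProb_le_one (d : ℕ) : ballProb d ≤ 1 := by
  have : IsProbabilityMeasure
      (cond (volume : Measure (EuclideanSpace ℝ (Fin d))) (Metric.closedBall 0 1)) :=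
    cond_isProbabilityMeasure_of_finite (Metric.measure_closedBall_pos _ _ one_pos).ne'
      measure_closedBall_lt_top.ne
  exact measureReal_le_one

theorem real_volume_torus_triangles (hd : 1 ≤ d) {r : ℝ} (hr0 : 0 < r) (hr : r ≤ 1 / 3) :
    ((volume : Measure (Fin d → UnitAddCircle)).prod volume).real
      {q | q.1 ∈ torusBall d r ∧ q.2 ∈ torusBall d r ∧ q.1 - q.2 ∈ torusBall d r} =
      ballProb d * volume.real (torusBall d r) ^ 2 := by
  have hmp := (measurePreserving_toTorus (d := d) (-(1 / 2))).prod
    (measurePreserving_toTorus (d := d) (-(1 / 2)))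
  have hB : ∀ r, MeasurableSet (torusBall d r) := measurableSet_torusBall
  have hm : MeasurableSet {q : (Fin d → UnitAddCircle) × (Fin d → UnitAddCircle) |
      q.1 ∈ torusBall d r ∧ q.2 ∈ torusBall d r ∧ q.1 - q.2 ∈ torusBall d r} :=
    (measurable_fst (hB r)).inter ((measurable_snd (hB r)).inter
      ((measurable_fst.sub measurable_snd) (hB r)))
  rw [← hmp.measureReal_preimage hm.nullMeasurableSet, Measure.prod_restrict,
    measureReal_restrict_apply (hmp.measurable hm)]
  have hsub : closeBallPairs d r ⊆ (Prod.map toTorus toTorus ⁻¹'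
      {q : (Fin d → UnitAddCircle) × (Fin d → UnitAddCircle) |
        q.1 ∈ torusBall d r ∧ q.2 ∈ torusBall d r ∧ q.1 - q.2 ∈ torusBall d r}) ∩
      halfOpenCube d (-(1 / 2)) ×ˢ halfOpenCube d (-(1 / 2)) := by
    rintro ⟨x, y⟩ ⟨h1, h2, h3⟩
    have h4 := closedBall_subset_halfOpenCube (by linarith) h1
    have h5 := closedBall_subset_halfOpenCube (by linarith) h2
    rw [mem_closedBall_zero_iff] at h1 h2 h3
    refine ⟨⟨(torusNorm_toTorus_le_norm _).trans h1, (torusNorm_toTorus_le_norm _).trans h2, ?_⟩,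
      h4, h5⟩
    simp only [Prod.map_fst, Prod.map_snd, ← toTorus_sub]
    exact (torusNorm_toTorus_le_norm _).trans h3
  have hdiff : ((Prod.map toTorus toTorus ⁻¹'
      {q : (Fin d → UnitAddCircle) × (Fin d → UnitAddCircle) |
        q.1 ∈ torusBall d r ∧ q.2 ∈ torusBall d r ∧ q.1 - q.2 ∈ torusBall d r}) ∩
      halfOpenCube d (-(1 / 2)) ×ˢ halfOpenCube d (-(1 / 2))) \ closeBallPairs d r ⊆
      Metric.sphere 0 r ×ˢ Set.univ := by
    rintro ⟨x, y⟩ ⟨⟨⟨h1, h2, h3⟩, h4, h5⟩, h6⟩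
    simp only [Prod.map_fst, Prod.map_snd, ← toTorus_sub] at h1 h2 h3 h4 h5
    have h1 : torusNorm (toTorus x) ≤ r := h1
    have h2 : torusNorm (toTorus y) ≤ r := h2
    have h3 : torusNorm (toTorus (x - y)) ≤ r := h3
    rw [torusNorm_toTorus_of_mem h4] at h1
    rw [torusNorm_toTorus_of_mem h5] at h2
    simp only [closeBallPairs, Set.mem_ofPred_eq, mem_closedBall_zero_iff, h1, h2, true_and,
      not_le] at h6
    refine ⟨mem_sphere_zero_iff_norm.2 (le_antisymm h1 ?_), trivial⟩
    rw [exists_torusNorm_toTorus_eq] at h3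
    have hz : (fun i => -round ((x - y) i)) ≠ (0 : Fin d → ℤ) := by
      intro h
      have : x - y + WithLp.toLp 2 (fun i => ((-round ((x - y) i) : ℤ) : ℝ)) = x - y := by
        ext i
        have hi : -round ((x - y) i) = 0 := congrFun h i
        change (x - y) i + ((-round ((x - y) i) : ℤ) : ℝ) = (x - y) i
        rw [hi, Int.cast_zero, add_zero]
      rw [this] at h3
      linarith
    have h7 := one_le_norm_of_ne_zero hz
    have h8 := norm_sub_le (x - y + WithLp.toLp 2 (fun i => ((-round ((x - y) i) : ℤ) : ℝ))) (x - y)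
    rw [add_sub_cancel_left] at h8
    have h9 := norm_sub_le x y
    linarith
  have : Nontrivial (EuclideanSpace ℝ (Fin d)) := by
    have : Nonempty (Fin d) := ⟨⟨0, hd⟩⟩
    infer_instance
  have h0 : ((volume : Measure (EuclideanSpace ℝ (Fin d))).prod
      (volume : Measure (EuclideanSpace ℝ (Fin d)))) (Metric.sphere 0 r ×ˢ Set.univ) = 0 := by
    rw [Measure.prod_prod, Measure.addHaar_sphere, zero_mul]
  have hae := (LE.le.eventuallyLE hsub).antisymm
    (ae_le_set.2 (measure_mono_null hdiff h0))
  rw [← measureReal_congr hae, ← Measure.volume_eq_prod (EuclideanSpace ℝ (Fin d))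
    (EuclideanSpace ℝ (Fin d)), real_volume_closeBallPairs hr0, ballProb_mul_sq,
        real_volume_torusBall hr0.le (by linarith)]
  ring

end Triangles

section LongestEdge

open scoped Pointwise

variable {d : ℕ}

/-- The pairs `(x, y)` in which `x` is the longest edge of the triangle `0, x, y` and `‖x‖ ≤ 1`. -/
def longestFirst (d : ℕ) : Set (EuclideanSpace ℝ (Fin d) × EuclideanSpace ℝ (Fin d)) :=
  {q | ‖q.1‖ ≤ 1 ∧ ‖q.2‖ ≤ ‖q.1‖ ∧ ‖q.1 - q.2‖ ≤ ‖q.1‖}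

/-- The pairs in the unit ball in which the first vector is the longer one. -/
def longerFirst (d : ℕ) : Set (EuclideanSpace ℝ (Fin d) × EuclideanSpace ℝ (Fin d)) :=
  {q | ‖q.1‖ ≤ 1 ∧ ‖q.2‖ ≤ ‖q.1‖}

/-- The intersection of the balls of radius `‖x‖` around `0` and `x`. -/
def lens (x : EuclideanSpace ℝ (Fin d)) : Set (EuclideanSpace ℝ (Fin d)) :=
  {y | ‖y‖ ≤ ‖x‖ ∧ ‖x - y‖ ≤ ‖x‖}

theorem measurableSet_longerFirst : MeasurableSet (longerFirst d) :=
  (measurableSet_le measurable_fst.norm measurable_const).inter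
    (measurableSet_le measurable_snd.norm measurable_fst.norm)

theorem measurableSet_longestFirst : MeasurableSet (longestFirst d) :=
  (measurableSet_le measurable_fst.norm measurable_const).inter
    ((measurableSet_le measurable_snd.norm measurable_fst.norm).inter
      (measurableSet_le (measurable_fst.sub measurable_snd).norm measurable_fst.norm))

theorem volume_lens_eq_of_norm_eq_one {u v : EuclideanSpace ℝ (Fin d)} (hu : ‖u‖ = 1)
    (hv : ‖v‖ = 1) : volume (lens u) = volume (lens v) := by
  have h := Submodule.reflection_sub (hu.trans hv.symm)
  set R := (ℝ ∙ (u - v))ᗮ.reflection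
  rw [← R.measurePreserving.measure_preimage_emb R.toMeasurableEquiv.measurableEmbedding (lens v)]
  congr 1
  ext y
  simp only [lens, Set.mem_preimage, Set.mem_ofPred_eq, LinearIsometryEquiv.norm_map, hu,
    ← h, ← map_sub]

theorem volume_lens {u x : EuclideanSpace ℝ (Fin d)} (hu : ‖u‖ = 1) (hx : x ≠ 0) :
    volume (lens x) = ENNReal.ofReal (‖x‖ ^ d) * volume (lens u) := by
  have hx0 : 0 < ‖x‖ := norm_pos_iff.2 hx
  have hx1 : ‖‖x‖⁻¹ • x‖ = 1 := by
    rw [norm_smul, norm_inv, norm_norm, inv_mul_cancel₀ hx0.ne']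
  have : lens x = ‖x‖ • lens (‖x‖⁻¹ • x) := by
    ext y
    rw [Set.mem_smul_set_iff_inv_smul_mem₀ hx0.ne']
    simp only [lens, Set.mem_ofPred_eq, hx1, ← smul_sub]
    rw [norm_smul, norm_smul, norm_inv, norm_norm, inv_mul_le_iff₀ hx0, inv_mul_le_iff₀ hx0,
      mul_one]
  rw [this, Measure.addHaar_smul, finrank_euclideanSpace_fin, abs_of_pos (by positivity),
    volume_lens_eq_of_norm_eq_one hx1 hu]

theorem volume_longestFirst_mul {u : EuclideanSpace ℝ (Fin d)} (hu : ‖u‖ = 1) :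
    volume (longestFirst d) * volume (Metric.closedBall (0 : EuclideanSpace ℝ (Fin d)) 1) =
      volume (longerFirst d) * volume (lens u) := by
  have hd : Nontrivial (EuclideanSpace ℝ (Fin d)) := ⟨u, 0, by rintro rfl; simp at hu⟩
  have hne : ∀ᵐ x : EuclideanSpace ℝ (Fin d), x ≠ 0 := Measure.ae_ne _ _
  have h1 : volume (longestFirst d) = (∫⁻ x : EuclideanSpace ℝ (Fin d),
      (Metric.closedBall 0 1).indicator (fun x => ENNReal.ofReal (‖x‖ ^ d)) x) *
        volume (lens u) := by
    rw [Measure.volume_eq_prod, Measure.prod_apply measurableSet_longestFirst,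
      ← lintegral_mul_const _ (by
        exact Measurable.indicator (by fun_prop) measurableSet_closedBall)]
    refine lintegral_congr_ae ?_
    filter_upwards [hne] with x hx
    by_cases hx1 : x ∈ Metric.closedBall 0 1
    · rw [Set.indicator_of_mem hx1, ← volume_lens hu hx]
      rw [mem_closedBall_zero_iff] at hx1
      congr 1
      ext y
      simp [longestFirst, lens, hx1]
    · rw [Set.indicator_of_notMem hx1, zero_mul]
      rw [mem_closedBall_zero_iff] at hx1
      convert measure_empty (μ := volume)
      ext y
      simp [longestFirst, hx1]
  have h2 : volume (longerFirst d) = (∫⁻ x : EuclideanSpace ℝ (Fin d),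
      (Metric.closedBall 0 1).indicator (fun x => ENNReal.ofReal (‖x‖ ^ d)) x) *
        volume (Metric.closedBall (0 : EuclideanSpace ℝ (Fin d)) 1) := by
    rw [Measure.volume_eq_prod, Measure.prod_apply measurableSet_longerFirst,
      ← lintegral_mul_const _ (by
        exact Measurable.indicator (by fun_prop) measurableSet_closedBall)]
    refine lintegral_congr fun x => ?_
    by_cases hx1 : x ∈ Metric.closedBall 0 1
    · have h := Measure.addHaar_closedBall' (volume : Measure (EuclideanSpace ℝ (Fin d))) 0
        (norm_nonneg x)
      rw [finrank_euclideanSpace_fin] at h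
      rw [Set.indicator_of_mem hx1, ← h]
      rw [mem_closedBall_zero_iff] at hx1
      congr 1
      ext y
      simp [longerFirst, hx1]
    · rw [Set.indicator_of_notMem hx1, zero_mul]
      rw [mem_closedBall_zero_iff] at hx1
      convert measure_empty (μ := volume)
      ext y
      simp [longerFirst, hx1]
  rw [h1, h2, mul_right_comm]

theorem volume_norm_fst_eq_norm_snd [Nontrivial (EuclideanSpace ℝ (Fin d))] :
    volume {q : EuclideanSpace ℝ (Fin d) × EuclideanSpace ℝ (Fin d) | ‖q.1‖ = ‖q.2‖} = 0 := by
  have hm : MeasurableSet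
      {q : EuclideanSpace ℝ (Fin d) × EuclideanSpace ℝ (Fin d) | ‖q.1‖ = ‖q.2‖} :=
    measurableSet_eq_fun (by fun_prop) (by fun_prop)
  rw [Measure.volume_eq_prod, Measure.measure_prod_null hm]
  refine Eventually.of_forall fun x => ?_
  rw [Pi.zero_apply]
  convert Measure.addHaar_sphere volume (0 : EuclideanSpace ℝ (Fin d)) ‖x‖ using 2
  ext y
  simp [eq_comm]

theorem volume_norm_fst_eq_norm_sub [Nontrivial (EuclideanSpace ℝ (Fin d))] :
    volume {q : EuclideanSpace ℝ (Fin d) × EuclideanSpace ℝ (Fin d) | ‖q.1‖ = ‖q.1 - q.2‖} = 0 := by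
  have hm : MeasurableSet
      {q : EuclideanSpace ℝ (Fin d) × EuclideanSpace ℝ (Fin d) | ‖q.1‖ = ‖q.1 - q.2‖} :=
    measurableSet_eq_fun (by fun_prop) (by fun_prop)
  rw [Measure.volume_eq_prod, Measure.measure_prod_null hm]
  refine Eventually.of_forall fun x => ?_
  rw [Pi.zero_apply]
  convert Measure.addHaar_sphere volume x ‖x‖ using 2
  ext y
  simp [eq_comm, norm_sub_rev]

theorem measurePreserving_swap_volume :
    MeasurePreserving (Prod.swap : EuclideanSpace ℝ (Fin d) × EuclideanSpace ℝ (Fin d) → _)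
      volume volume := by
  rw [Measure.volume_eq_prod]; exact Measure.measurePreserving_swap

theorem two_mul_volume_longerFirst [Nontrivial (EuclideanSpace ℝ (Fin d))] :
    2 * volume (longerFirst d) =
      volume (Metric.closedBall (0 : EuclideanSpace ℝ (Fin d)) 1) ^ 2 := by
  have hsw := measurePreserving_swap_volume.measure_preimage
    (measurableSet_longerFirst (d := d)).nullMeasurableSet
  have hu : (Metric.closedBall (0 : EuclideanSpace ℝ (Fin d)) 1) ×ˢ (Metric.closedBall 0 1) =
      longerFirst d ∪ Prod.swap ⁻¹' longerFirst d := by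
    ext ⟨x, y⟩
    simp only [Set.mem_prod, mem_closedBall_zero_iff, longerFirst, Set.mem_union,
      Set.mem_preimage, Set.mem_ofPred_eq, Prod.fst_swap, Prod.snd_swap]
    constructor
    · rintro ⟨h1, h2⟩
      rcases le_total ‖y‖ ‖x‖ with h | h
      · exact Or.inl ⟨h1, h⟩
      · exact Or.inr ⟨h2, h⟩
    · rintro (⟨h1, h2⟩ | ⟨h1, h2⟩)
      · exact ⟨h1, h2.trans h1⟩
      · exact ⟨h2.trans h1, h1⟩
  rw [sq, ← Measure.prod_prod, ← Measure.volume_eq_prod, hu,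
    measure_union₀ (measurePreserving_swap_volume.measurable
      measurableSet_longerFirst).nullMeasurableSet, hsw, two_mul]
  refine measure_mono_null ?_ volume_norm_fst_eq_norm_snd
  rintro q ⟨h1, h2⟩
  exact le_antisymm h2.2 h1.2

theorem measurePreserving_sub_neg :
    MeasurePreserving (fun q : EuclideanSpace ℝ (Fin d) × EuclideanSpace ℝ (Fin d) =>
      (q.1 - q.2, -q.2)) volume volume := by
  rw [Measure.volume_eq_prod]
  exact ((MeasurePreserving.id _).prod (Measure.measurePreserving_neg _)).comp
    (measurePreserving_sub_prod volume volume)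

theorem volume_closeBallPairs_one [Nontrivial (EuclideanSpace ℝ (Fin d))] :
    volume (closeBallPairs d 1) = 3 * volume (longestFirst d) := by
  have hm := measurableSet_longestFirst (d := d)
  have h1 := measurePreserving_swap_volume.measure_preimage hm.nullMeasurableSet
  have h2 := measurePreserving_sub_neg.measure_preimage hm.nullMeasurableSet
  have hu : closeBallPairs d 1 = longestFirst d ∪ (Prod.swap ⁻¹' longestFirst d ∪
      (fun q => (q.1 - q.2, -q.2)) ⁻¹' longestFirst d) := by
    ext ⟨x, y⟩
    simp only [closeBallPairs, mem_closedBall_zero_iff, longestFirst, Set.mem_union,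
      Set.mem_preimage, Set.mem_ofPred_eq, Prod.fst_swap, Prod.snd_swap, norm_neg,
      sub_neg_eq_add, sub_add_cancel, norm_sub_rev y x]
    constructor
    · rintro ⟨h1, h2, h3⟩
      rcases le_total ‖y‖ ‖x‖ with h | h <;> rcases le_total ‖x - y‖ ‖x‖ with h' | h' <;>
        rcases le_total ‖x - y‖ ‖y‖ with h'' | h''
      all_goals first
        | exact Or.inl ⟨h1, by linarith, by linarith⟩
        | exact Or.inr (Or.inl ⟨h2, by linarith, by linarith⟩)
        | exact Or.inr (Or.inr ⟨h3, by linarith, by linarith⟩)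
    · rintro (⟨h1, h2, h3⟩ | ⟨h1, h2, h3⟩ | ⟨h1, h2, h3⟩) <;>
        exact ⟨by linarith, by linarith, by linarith⟩
  have hm1 := measurePreserving_swap_volume.measurable hm
  have hm2 := measurePreserving_sub_neg.measurable hm
  rw [hu, measure_union₀ (hm1.union hm2).nullMeasurableSet, measure_union₀ hm2.nullMeasurableSet,
    h1, h2]
  · ring
  · refine measure_mono_null ?_ (measurePreserving_swap_volume.measure_preimage
      (measurableSet_eq_fun (f := fun q => ‖q.1‖) (g := fun q => ‖q.1 - q.2‖)
        (by fun_prop) (by fun_prop)).nullMeasurableSet |>.trans volume_norm_fst_eq_norm_sub)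
    rintro ⟨x, y⟩ ⟨h1, h2⟩
    simp only [longestFirst, Set.mem_preimage, Set.mem_ofPred_eq, Prod.fst_swap, Prod.snd_swap,
      norm_neg, sub_neg_eq_add, sub_add_cancel, norm_sub_rev y x] at h1 h2 ⊢
    linarith
  · refine measure_mono_null ?_ (measure_union_null volume_norm_fst_eq_norm_snd
      volume_norm_fst_eq_norm_sub)
    rintro ⟨x, y⟩ ⟨h1, h2 | h2⟩
    · refine Or.inl ?_
      simp only [longestFirst, Set.mem_preimage, Set.mem_ofPred_eq, Prod.fst_swap,
        Prod.snd_swap] at h1 h2 ⊢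
      linarith
    · refine Or.inr ?_
      simp only [longestFirst, Set.mem_preimage, Set.mem_ofPred_eq, sub_neg_eq_add, sub_add_cancel]
        at h1 h2 ⊢
      linarith

theorem ballProb_mul_eq_lens {u : EuclideanSpace ℝ (Fin d)} (hu : ‖u‖ = 1) :
    ballProb d * volume.real (Metric.ball (0 : EuclideanSpace ℝ (Fin d)) 1) =
      3 / 2 * volume.real (lens u) := by
  have : Nontrivial (EuclideanSpace ℝ (Fin d)) := ⟨u, 0, by rintro rfl; simp at hu⟩
  have hV := real_volume_ball_pos d
  have hc : volume.real (Metric.closedBall (0 : EuclideanSpace ℝ (Fin d)) 1) =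
      volume.real (Metric.ball (0 : EuclideanSpace ℝ (Fin d)) 1) := by
    rw [Measure.addHaar_real_closedBall _ _ zero_le_one]; simp
  have h1 := ballProb_mul_sq d
  have h2 := congrArg ENNReal.toReal (volume_closeBallPairs_one (d := d))
  have h3 := congrArg ENNReal.toReal (two_mul_volume_longerFirst (d := d))
  have h4 := congrArg ENNReal.toReal (volume_longestFirst_mul hu)
  simp only [ENNReal.toReal_mul, ENNReal.toReal_pow, ENNReal.toReal_ofNat,
    ← measureReal_def, hc] at h2 h3 h4
  set V := volume.real (Metric.ball (0 : EuclideanSpace ℝ (Fin d)) 1)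
  have h5 : V ^ 2 * (ballProb d * V) = V ^ 2 * (3 / 2 * volume.real (lens u)) := by
    calc V ^ 2 * (ballProb d * V) = (ballProb d * V ^ 2) * V := by ring
      _ = 3 * (volume.real (longestFirst d) * V) := by rw [← h1, h2]; ring
      _ = 3 / 2 * (2 * volume.real (longerFirst d)) * volume.real (lens u) := by rw [h4]; ring
      _ = _ := by rw [h3]; ring
  exact mul_left_cancel₀ (by positivity) h5

end LongestEdge

section Slices

/-- The first coordinate together with the remaining ones. -/
def splitFirst {k : ℕ} (y : EuclideanSpace ℝ (Fin (k + 1))) : ℝ × EuclideanSpace ℝ (Fin k) :=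
  (y 0, WithLp.toLp 2 fun i => y i.succ)

theorem measurePreserving_splitFirst (k : ℕ) :
    MeasurePreserving (splitFirst (k := k)) volume volume := by
  have h1 := PiLp.volume_preserving_ofLp (Fin (k + 1))
  have h2 := volume_preserving_piFinSuccAbove (fun _ : Fin (k + 1) => ℝ) 0
  have h3 : MeasurePreserving (Prod.map (id : ℝ → ℝ) (WithLp.toLp 2 : (Fin k → ℝ) → _))
      volume volume := by
    rw [Measure.volume_eq_prod, Measure.volume_eq_prod]
    exact (MeasurePreserving.id _).prod (PiLp.volume_preserving_toLp (Fin k))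
  exact h3.comp (h2.comp h1)

theorem norm_sq_splitFirst {k : ℕ} (y : EuclideanSpace ℝ (Fin (k + 1))) :
    ‖y‖ ^ 2 = (splitFirst y).1 ^ 2 + ‖(splitFirst y).2‖ ^ 2 := by
  rw [EuclideanSpace.real_norm_sq_eq, EuclideanSpace.real_norm_sq_eq, Fin.sum_univ_succ]
  rfl

theorem real_volume_ball_slab (k : ℕ) {a b : ℝ} (ha : -1 ≤ a) (hab : a ≤ b) (hb : b ≤ 1) :
    volume.real {y : EuclideanSpace ℝ (Fin (k + 1)) | ‖y‖ ≤ 1 ∧ y 0 ∈ Set.Icc a b} =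
      (∫ t in a..b, √(1 - t ^ 2) ^ k) *
        volume.real (Metric.ball (0 : EuclideanSpace ℝ (Fin k)) 1) := by
  set S : Set (ℝ × EuclideanSpace ℝ (Fin k)) :=
    {q | q.1 ^ 2 + ‖q.2‖ ^ 2 ≤ 1} ∩ {q | q.1 ∈ Set.Icc a b} with hS
  have hSm : MeasurableSet S :=
    (measurableSet_le ((measurable_fst.pow_const 2).add (measurable_snd.norm.pow_const 2))
      measurable_const).inter (measurable_fst measurableSet_Icc)
  have hpre : {y : EuclideanSpace ℝ (Fin (k + 1)) | ‖y‖ ≤ 1 ∧ y 0 ∈ Set.Icc a b} =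
      splitFirst ⁻¹' S := by
    ext y
    simp only [hS, Set.mem_preimage, Set.mem_inter_iff, Set.mem_ofPred_eq, ← norm_sq_splitFirst]
    rw [sq_le_one_iff₀ (norm_nonneg y)]
    rfl
  rw [hpre, (measurePreserving_splitFirst k).measureReal_preimage hSm.nullMeasurableSet,
    intervalIntegral.integral_of_le hab, ← integral_Icc_eq_integral_Ioc, ← integral_mul_const,
    ← integral_indicator measurableSet_Icc, measureReal_def, Measure.volume_eq_prod,
    Measure.prod_apply hSm, ← integral_toReal]
  · congr 1
    ext t
    by_cases ht : t ∈ Set.Icc a b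
    · rw [Set.indicator_of_mem ht]
      have h1 : 0 ≤ 1 - t ^ 2 := by nlinarith [ht.1, ht.2]
      have h := Measure.addHaar_real_closedBall
        (volume : Measure (EuclideanSpace ℝ (Fin k))) 0 (Real.sqrt_nonneg (1 - t ^ 2))
      rw [finrank_euclideanSpace_fin] at h
      rw [← h, measureReal_def]
      congr 2
      ext z
      simp only [hS, Set.mem_preimage, Set.mem_inter_iff, Set.mem_ofPred_eq, ht, and_true,
        mem_closedBall_zero_iff]
      rw [Real.le_sqrt (norm_nonneg z) h1]
      constructor <;> intro h <;> linarith
    · rw [Set.indicator_of_notMem ht]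
      have : Prod.mk t ⁻¹' S = ∅ := by
        ext z
        simp only [hS, Set.mem_preimage, Set.mem_inter_iff, Set.mem_ofPred_eq, ht, and_false,
          Set.mem_empty_iff_false]
      rw [this, measure_empty, ENNReal.toReal_zero]
  · exact (measurable_measure_prodMk_left hSm).aemeasurable
  · refine Eventually.of_forall fun t => lt_of_le_of_lt (measure_mono ?_)
      (measure_closedBall_lt_top (x := (0 : EuclideanSpace ℝ (Fin k))) (r := 1))
    rintro z ⟨h1, _⟩
    have h1 : t ^ 2 + ‖z‖ ^ 2 ≤ 1 := h1
    rw [mem_closedBall_zero_iff, ← sq_le_one_iff₀ (norm_nonneg z)]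
    nlinarith [sq_nonneg t]

theorem continuous_sqrt_one_sub_sq_pow (k : ℕ) : Continuous fun t : ℝ => √(1 - t ^ 2) ^ k := by
  fun_prop

theorem real_volume_unit_ball_eq_integral (k : ℕ) :
    volume.real (Metric.ball (0 : EuclideanSpace ℝ (Fin (k + 1))) 1) =
      2 * (∫ t in (0 : ℝ)..1, √(1 - t ^ 2) ^ k) *
        volume.real (Metric.ball (0 : EuclideanSpace ℝ (Fin k)) 1) := by
  have hc : volume.real (Metric.closedBall (0 : EuclideanSpace ℝ (Fin (k + 1))) 1) =
      volume.real (Metric.ball (0 : EuclideanSpace ℝ (Fin (k + 1))) 1) := by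
    rw [Measure.addHaar_real_closedBall _ _ zero_le_one]; simp
  have hset : Metric.closedBall (0 : EuclideanSpace ℝ (Fin (k + 1))) 1 =
      {y | ‖y‖ ≤ 1 ∧ y 0 ∈ Set.Icc (-1 : ℝ) 1} := by
    ext y
    rw [mem_closedBall_zero_iff]
    exact ⟨fun h => ⟨h, abs_le.1 ((PiLp.norm_apply_le y 0).trans h)⟩, fun h => h.1⟩
  have hcont := continuous_sqrt_one_sub_sq_pow k
  have hneg : ∫ t in (-1 : ℝ)..0, √(1 - t ^ 2) ^ k = ∫ t in (0 : ℝ)..1, √(1 - t ^ 2) ^ k := by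
    have h := intervalIntegral.integral_comp_neg (a := 0) (b := 1)
      fun t : ℝ => √(1 - t ^ 2) ^ k
    simpa using h.symm
  rw [← hc, hset, real_volume_ball_slab k le_rfl (by norm_num) le_rfl,
    ← intervalIntegral.integral_add_adjacent_intervals (hcont.intervalIntegrable (-1) 0)
      (hcont.intervalIntegrable 0 1), hneg, two_mul]

theorem real_volume_lens_single (k : ℕ) :
    volume.real (lens (EuclideanSpace.single (0 : Fin (k + 1)) (1 : ℝ))) =
      2 * (∫ t in (1 / 2 : ℝ)..1, √(1 - t ^ 2) ^ k) *
        volume.real (Metric.ball (0 : EuclideanSpace ℝ (Fin k)) 1) := by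
  set e := EuclideanSpace.single (0 : Fin (k + 1)) (1 : ℝ) with he
  have he1 : ‖e‖ = 1 := by simp [he]
  have he0 : e 0 = 1 := by simp [he]
  set H : Set (EuclideanSpace ℝ (Fin (k + 1))) := {y | ‖y‖ ≤ 1 ∧ y 0 ∈ Set.Icc (1 / 2 : ℝ) 1}
    with hH
  have hHm : MeasurableSet H :=
    (measurableSet_le measurable_norm measurable_const).inter
      ((by fun_prop : Measurable fun y : EuclideanSpace ℝ (Fin (k + 1)) => y 0) measurableSet_Icc)
  have hr := Measure.measurePreserving_sub_left
    (volume : Measure (EuclideanSpace ℝ (Fin (k + 1)))) e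
  have hn : ∀ y : EuclideanSpace ℝ (Fin (k + 1)), ‖e - y‖ ^ 2 = 1 - 2 * y 0 + ‖y‖ ^ 2 := by
    intro y
    rw [norm_sub_sq_real, he1, he, EuclideanSpace.inner_single_left]
    simp
  have hsub : ∀ y : EuclideanSpace ℝ (Fin (k + 1)), (e - y) 0 = 1 - y 0 := fun y => by
    rw [PiLp.sub_apply, he0]
  have hun : lens e = H ∪ (fun y => e - y) ⁻¹' H := by
    ext y
    have h1 := hn y
    have h2 : |y 0| ≤ ‖y‖ := PiLp.norm_apply_le y 0
    have h3 : |(e - y) 0| ≤ ‖e - y‖ := PiLp.norm_apply_le (e - y) 0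
    rw [hsub] at h3
    simp only [lens, hH, Set.mem_ofPred_eq, he1, Set.mem_union, Set.mem_preimage, Set.mem_Icc, hsub]
    constructor
    · rintro ⟨h4, h5⟩
      rcases le_total (1 / 2) (y 0) with h | h
      · exact Or.inl ⟨h4, h, (le_abs_self _).trans (h2.trans h4)⟩
      · exact Or.inr ⟨h5, by linarith, (le_abs_self _).trans (h3.trans h5)⟩
    · rintro (⟨h4, h5, h6⟩ | ⟨h4, h5, h6⟩)
      · refine ⟨h4, ?_⟩
        rw [← sq_le_one_iff₀ (norm_nonneg _)] at h4 ⊢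
        linarith
      · refine ⟨?_, h4⟩
        rw [← sq_le_one_iff₀ (norm_nonneg _)] at h4 ⊢
        linarith
  have hfin : volume H ≠ ⊤ := ((measure_mono fun y hy => mem_closedBall_zero_iff.2 hy.1).trans_lt
    (measure_closedBall_lt_top (x := (0 : EuclideanSpace ℝ (Fin (k + 1)))) (r := 1))).ne
  have hI : volume (H ∩ (fun y => e - y) ⁻¹' H) = 0 := by
    have h0 := real_volume_ball_slab k (a := 1 / 2) (b := 1 / 2) (by norm_num) le_rfl (by norm_num)
    rw [intervalIntegral.integral_same, zero_mul] at h0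
    have hss : H ∩ (fun y => e - y) ⁻¹' H ⊆ {y | ‖y‖ ≤ 1 ∧ y 0 ∈ Set.Icc (1 / 2 : ℝ) (1 / 2)} := by
      rintro y ⟨⟨h1, h2, h3⟩, h4, h5, h6⟩
      rw [hsub] at h5
      exact ⟨h1, h2, by linarith⟩
    refine measure_mono_null hss ((measureReal_eq_zero_iff ?_).1 h0)
    exact ((measure_mono fun y hy => mem_closedBall_zero_iff.2 hy.1).trans_lt
      (measure_closedBall_lt_top (x := (0 : EuclideanSpace ℝ (Fin (k + 1)))) (r := 1))).ne
  have hHv := real_volume_ball_slab k (a := 1 / 2) (b := 1) (by norm_num) (by norm_num) le_rfl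
  rw [hun, measureReal_def, measure_union₀ (hr.measurable hHm).nullMeasurableSet hI,
    hr.measure_preimage hHm.nullMeasurableSet, ENNReal.toReal_add hfin hfin, ← measureReal_def,
    hHv]
  ring

end Slices

section Monotone

theorem ballProb_succ_mul (k : ℕ) :
    ballProb (k + 1) * ∫ t in (0 : ℝ)..1, √(1 - t ^ 2) ^ k =
      3 / 2 * ∫ t in (1 / 2 : ℝ)..1, √(1 - t ^ 2) ^ k := by
  have h := ballProb_mul_eq_lens (u := EuclideanSpace.single (0 : Fin (k + 1)) (1 : ℝ)) (by simp)
  rw [real_volume_unit_ball_eq_integral, real_volume_lens_single] at h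
  have hV := real_volume_ball_pos k
  refine mul_right_cancel₀ (b := 2 * volume.real (Metric.ball (0 : EuclideanSpace ℝ (Fin k)) 1))
    (by positivity) ?_
  linarith

theorem integral_sqrt_pow_pos (k : ℕ) {a b : ℝ} (ha : 0 ≤ a) (hab : a < b) (hb : b ≤ 1) :
    0 < ∫ t in a..b, √(1 - t ^ 2) ^ k := by
  refine intervalIntegral.intervalIntegral_pos_of_pos_on
    ((continuous_sqrt_one_sub_sq_pow k).intervalIntegrable _ _) (fun t ht => ?_) hab
  exact pow_pos (Real.sqrt_pos.2 (by nlinarith [ht.1, ht.2])) k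

theorem ballProb_succ_lt (k : ℕ) : ballProb (k + 2) < ballProb (k + 1) := by
  have h1 := ballProb_succ_mul k
  have h2 := ballProb_succ_mul (k + 1)
  have hi : ∀ k a b, IntervalIntegrable (fun t : ℝ => √(1 - t ^ 2) ^ k) volume a b :=
    fun k a b => (continuous_sqrt_one_sub_sq_pow k).intervalIntegrable a b
  rw [← intervalIntegral.integral_add_adjacent_intervals (hi _ 0 (1 / 2)) (hi _ (1 / 2) 1)]
    at h1 h2
  have hA := integral_sqrt_pow_pos k (a := 1 / 2) (b := 1) (by norm_num) (by norm_num) le_rfl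
  have hB := integral_sqrt_pow_pos k (a := 0) (b := 1 / 2) le_rfl (by norm_num) (by norm_num)
  have hA' := integral_sqrt_pow_pos (k + 1) (a := 1 / 2) (b := 1) (by norm_num) (by norm_num) le_rfl
  have hB' := integral_sqrt_pow_pos (k + 1) (a := 0) (b := 1 / 2) le_rfl (by norm_num) (by norm_num)
  have hAA : ∫ t in (1 / 2 : ℝ)..1, √(1 - t ^ 2) ^ (k + 1) ≤
      √(3 / 4) * ∫ t in (1 / 2 : ℝ)..1, √(1 - t ^ 2) ^ k := by
    rw [← intervalIntegral.integral_const_mul]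
    refine intervalIntegral.integral_mono_on (by norm_num) (hi _ _ _) ((hi _ _ _).const_mul _)
      fun t ht => ?_
    rw [pow_succ, mul_comm]
    gcongr
    nlinarith [ht.1, ht.2]
  have hBB : √(3 / 4) * ∫ t in (0 : ℝ)..(1 / 2), √(1 - t ^ 2) ^ k <
      ∫ t in (0 : ℝ)..(1 / 2), √(1 - t ^ 2) ^ (k + 1) := by
    rw [← intervalIntegral.integral_const_mul]
    refine intervalIntegral.integral_lt_integral_of_continuousOn_of_le_of_exists_lt (by norm_num)
      (by fun_prop) (by fun_prop) (fun t ht => ?_) ⟨0, by norm_num, ?_⟩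
    · rw [pow_succ _ k, mul_comm]
      gcongr
      nlinarith [ht.1, ht.2]
    · have : √(3 / 4) < √1 := Real.sqrt_lt_sqrt (by norm_num) (by norm_num)
      simpa using this
  set A := ∫ t in (1 / 2 : ℝ)..1, √(1 - t ^ 2) ^ k
  set B := ∫ t in (0 : ℝ)..(1 / 2), √(1 - t ^ 2) ^ k
  set A' := ∫ t in (1 / 2 : ℝ)..1, √(1 - t ^ 2) ^ (k + 1)
  set B' := ∫ t in (0 : ℝ)..(1 / 2), √(1 - t ^ 2) ^ (k + 1)
  rw [← eq_div_iff (by positivity)] at h1 h2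
  rw [h1, h2, div_lt_div_iff₀ (by positivity) (by positivity)]
  nlinarith [mul_le_mul_of_nonneg_right hAA hB.le, mul_lt_mul_of_pos_left hBB hA]

theorem ballProb_strictAnti {m k : ℕ} (hm : 1 ≤ m) (hmk : m < k) : ballProb k < ballProb m := by
  have h : StrictAnti fun j => ballProb (j + 1) := strictAnti_nat_of_succ_lt ballProb_succ_lt
  have := h (show m - 1 < k - 1 by omega)
  simpa [Nat.sub_add_cancel hm, Nat.sub_add_cancel (hm.trans hmk.le)] using this

theorem exists_dist_ballProb_le {d : ℕ} (hd : 1 ≤ d) :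
    ∃ δ > 0, ∀ k, 1 ≤ k → k ≠ d → 2 * δ ≤ |ballProb k - ballProb d| := by
  have h1 := ballProb_strictAnti hd (Nat.lt_succ_self d)
  have hlow : ∀ k, 1 ≤ k → d < k → ballProb k ≤ ballProb (d + 1) := fun k _ hk => by
    rcases (Nat.succ_le_of_lt hk).eq_or_lt with h | h
    · rw [← h]
    · exact (ballProb_strictAnti (by omega) h).le
  rcases hd.eq_or_lt with rfl | hd2
  · refine ⟨(ballProb 1 - ballProb 2) / 2, by linarith, fun k hk hkd => ?_⟩
    have := hlow k hk (by omega)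
    rw [abs_sub_comm]
    exact le_trans (by linarith) (le_abs_self _)
  · have h2 := ballProb_strictAnti (m := d - 1) (k := d) (by omega) (by omega)
    refine ⟨min ((ballProb d - ballProb (d + 1)) / 2) ((ballProb (d - 1) - ballProb d) / 2),
      lt_min (by linarith) (by linarith), fun k hk hkd => ?_⟩
    rcases lt_or_gt_of_ne hkd with h | h
    · have h3 : ballProb (d - 1) ≤ ballProb k := by
        rcases (Nat.le_sub_one_of_lt h).eq_or_lt with h | h
        · rw [h]
        · exact (ballProb_strictAnti hk h).le
      refine le_trans ?_ (le_abs_self _)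
      linarith [min_le_right ((ballProb d - ballProb (d + 1)) / 2)
        ((ballProb (d - 1) - ballProb d) / 2)]
    · have := hlow k hk h
      rw [abs_sub_comm]
      refine le_trans ?_ (le_abs_self _)
      linarith [min_le_left ((ballProb d - ballProb (d + 1)) / 2)
        ((ballProb (d - 1) - ballProb d) / 2)]

/-- An estimate close to `w_d` has `d` as its only nearest dimension. -/
theorem exists_isDimensionEstimate_eq {d : ℕ} (hd : 1 ≤ d) :
    ∃ δ > 0, ∀ w D, |w - ballProb d| < δ → IsDimensionEstimate w D → D = d := by
  obtain ⟨δ, hδ, h⟩ := exists_dist_ballProb_le hd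
  refine ⟨δ, hδ, fun w D hw hD => ?_⟩
  have hfar : ∀ k, 1 ≤ k → k ≠ d → |w - ballProb d| < |w - ballProb k| := fun k hk hkd => by
    have h1 := h k hk hkd
    have h2 := abs_sub_le (ballProb k) w (ballProb d)
    rw [abs_sub_comm (ballProb k) w] at h2
    linarith
  have hmem : d ∈ dimensionArgmin w := ⟨hd, fun k hk => by
    rcases eq_or_ne k d with rfl | hkd
    · rfl
    · exact (hfar k hk hkd).le⟩
  obtain ⟨h1, h2⟩ := hD ⟨d, hmem⟩
  by_contra hne
  exact absurd (h2 d hd) (not_le.2 (hfar D h1 hne))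

end Monotone

section SlowVariation

/-- Differences `g (u + s) - g u` that vanish at infinity for every `s` do so uniformly for
`s ∈ [0, 1]`, if `g` is measurable. -/
theorem eventually_abs_sub_le_of_tendsto_sub {g : ℝ → ℝ} (hg : Measurable g)
    (h : ∀ s, Tendsto (fun u => g (u + s) - g u) atTop (𝓝 0)) {η : ℝ} (hη : 0 < η) :
    ∃ a, ∀ u, a ≤ u → ∀ s ∈ Set.Icc (0 : ℝ) 1, |g (u + s) - g u| ≤ η := by
  by_contra hcon
  push Not at hcon
  choose u hu s hs hus using fun n : ℕ => hcon n
  have hu_top : Tendsto u atTop atTop := tendsto_atTop_mono hu tendsto_natCast_atTop_atTop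
  set ν : Measure ℝ := volume.restrict (Set.Icc 0 2) with hν
  have key : ∀ v : ℕ → ℝ, Tendsto v atTop atTop →
      ∀ᶠ n in atTop, ν.real {t | η / 2 ≤ |g (v n + t) - g (v n)|} < 1 / 2 := by
    intro v hv
    have h1 : TendstoInMeasure ν (fun n t => g (v n + t) - g (v n)) atTop fun _ => (0 : ℝ) := by
      refine tendstoInMeasure_of_tendsto_ae (fun n => ?_) (Eventually.of_forall fun t => ?_)
      · exact ((hg.comp (measurable_const_add (v n))).sub_const _).aestronglyMeasurable
      · exact (h t).comp hv
    rw [tendstoInMeasure_iff_measureReal_norm] at h1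
    have h2 := h1 (η / 2) (by positivity)
    simp only [sub_zero, Real.norm_eq_abs] at h2
    exact h2.eventually_lt_const (by norm_num)
  have hus_top : Tendsto (fun n => u n + s n) atTop atTop :=
    tendsto_atTop_mono (fun n => by linarith [(hs n).1]) hu_top
  obtain ⟨n, h1, h2⟩ := ((key u hu_top).and (key _ hus_top)).exists
  have hm : ∀ v, MeasurableSet {t | η / 2 ≤ |g (v + t) - g v|} := fun v =>
    measurableSet_le measurable_const ((hg.comp (measurable_const_add v)).sub_const _).abs
  rw [hν, measureReal_restrict_apply (hm _)] at h1 h2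
  set B₁ := {t | η / 2 ≤ |g (u n + t) - g (u n)|} ∩ Set.Icc 0 2
  set B₂ := {t | η / 2 ≤ |g (u n + s n + t) - g (u n + s n)|} ∩ Set.Icc 0 2
  have hfin : ∀ S : Set ℝ, volume (S ∩ Set.Icc 0 2) ≠ ⊤ := fun S =>
    ((measure_mono Set.inter_subset_right).trans_lt measure_Icc_lt_top).ne
  have htr : volume.real ((fun t => s n + t) ⁻¹' B₁) = volume.real B₁ := by
    rw [measureReal_def, measure_preimage_add, ← measureReal_def]
  have hfin' : volume ((fun t => s n + t) ⁻¹' B₁) ≠ ⊤ := by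
    rw [measure_preimage_add]; exact hfin _
  have hnot : ¬ Set.Icc (0 : ℝ) 1 ⊆ ((fun t => s n + t) ⁻¹' B₁) ∪ B₂ := by
    intro hsub
    have h3 := measureReal_mono (μ := volume) hsub (measure_union_ne_top hfin' (hfin _))
    have h4 := measureReal_union_le (μ := volume) ((fun t => s n + t) ⁻¹' B₁) B₂
    rw [Real.volume_real_Icc] at h3
    norm_num at h3
    linarith
  obtain ⟨t, ht, htB⟩ := Set.not_subset.1 hnot
  rw [Set.mem_union, not_or] at htB
  have h3 : |g (u n + (s n + t)) - g (u n)| < η / 2 := by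
    by_contra h
    exact htB.1 ⟨not_lt.1 h, by linarith [(hs n).1, ht.1], by linarith [(hs n).2, ht.2]⟩
  have h4 : |g (u n + s n + t) - g (u n + s n)| < η / 2 := by
    by_contra h
    exact htB.2 ⟨not_lt.1 h, ht.1, by linarith [ht.2]⟩
  have h5 := hus n
  rw [← add_assoc] at h3
  rw [abs_lt] at h3 h4
  rcases lt_abs.1 h5 with h | h <;> linarith [h3.1, h3.2, h4.1, h4.2]

theorem sub_mul_le_of_abs_sub_le {g : ℝ → ℝ} {a η : ℝ} (hη : 0 ≤ η)
    (h : ∀ u, a ≤ u → ∀ s ∈ Set.Icc (0 : ℝ) 1, |g (u + s) - g u| ≤ η) (n : ℕ) :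
    ∀ u, a ≤ u → u ≤ a + n → g a - η * n ≤ g u := by
  induction n with
  | zero =>
    intro u h1 h2
    rw [le_antisymm h1 (by simpa using h2)]; simp
  | succ n ih =>
    intro u h1 h2
    push_cast at h2 ⊢
    rcases le_total (a + 1) u with h3 | h3
    · have h4 := ih (u - 1) (by linarith) (by linarith)
      have h5 := h (u - 1) (by linarith) 1 (by simp)
      rw [sub_add_cancel] at h5
      linarith [(abs_le.1 h5).1]
    · have h5 := h a le_rfl (u - a) ⟨by linarith, by linarith⟩
      rw [add_sub_cancel] at h5
      have : 0 ≤ η * n := by positivity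
      linarith [(abs_le.1 h5).1]

theorem IsSlowlyVarying.exists_mul_rpow_le {L : ℝ → ℝ} (hL : IsSlowlyVarying L) {η : ℝ}
    (hη : 0 < η) : ∃ C > 0, ∀ᶠ x in atTop, C * x ^ (-η) ≤ L x := by
  obtain ⟨⟨A, hpos, hmeas⟩, hlim⟩ := hL
  set b := Real.log (max A 1) with hb
  have hAb : ∀ u, b ≤ u → A ≤ Real.exp u := fun u hu => by
    have h1 : Real.exp b ≤ Real.exp u := Real.exp_le_exp.2 hu
    rw [hb, Real.exp_log (by positivity)] at h1
    exact (le_max_left _ _).trans h1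
  have hm : Measurable fun u : Set.Ici b => Real.log (L (Real.exp u)) :=
    Real.measurable_log.comp (hmeas.comp
      ((Real.measurable_exp.comp measurable_subtype_coe).subtype_mk
        (h := fun u : Set.Ici b => hAb u u.2)))
  set g : ℝ → ℝ := (Set.Ici b).indicator fun u => Real.log (L (Real.exp u)) with hg
  have hgu : ∀ u, b ≤ u → g u = Real.log (L (Real.exp u)) := fun u hu =>
    Set.indicator_of_mem (Set.mem_Ici.2 hu) _
  have hgu0 : ∀ u, u ∉ Set.Ici b → g u = 0 := fun u hu => Set.indicator_of_notMem hu _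
  have hgm : Measurable g := by
    refine measurable_of_restrict_of_restrict_compl (s := Set.Ici b) measurableSet_Ici ?_ ?_
    · convert hm using 1
      ext u
      exact hgu u.1 u.2
    · convert measurable_const (a := (0 : ℝ)) using 1
      ext u
      exact hgu0 u.1 u.2
  have hgs : ∀ s, Tendsto (fun u => g (u + s) - g u) atTop (𝓝 0) := by
    intro s
    have h1 := (hlim (Real.exp s) (Real.exp_pos s)).comp Real.tendsto_exp_atTop
    have h2 := (Real.continuousAt_log one_ne_zero).tendsto.comp h1
    rw [Real.log_one] at h2
    refine h2.congr' ?_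
    filter_upwards [eventually_ge_atTop b, eventually_ge_atTop (b - s)] with u hu hu2
    rw [hgu u hu, hgu (u + s) (by linarith)]
    simp only [Function.comp_apply]
    rw [← Real.exp_add, add_comm s u, Real.log_div (hpos _ (hAb _ (by linarith))).ne'
      (hpos _ (hAb _ hu)).ne']
  obtain ⟨a, ha⟩ := eventually_abs_sub_le_of_tendsto_sub hgm hgs hη
  refine ⟨Real.exp (g a + η * a - η), Real.exp_pos _, ?_⟩
  filter_upwards [eventually_ge_atTop (Real.exp a), eventually_ge_atTop (Real.exp b)] with x hx hx'
  have hx0 : 0 < x := (Real.exp_pos a).trans_le hx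
  have h1 : a ≤ Real.log x := (Real.le_log_iff_exp_le hx0).2 hx
  have h2 : b ≤ Real.log x := (Real.le_log_iff_exp_le hx0).2 hx'
  have h3 := sub_mul_le_of_abs_sub_le hη.le ha ⌈Real.log x - a⌉₊ _ h1
    (by linarith [Nat.le_ceil (Real.log x - a)])
  have h4 := Nat.ceil_lt_add_one (sub_nonneg.2 h1)
  rw [hgu _ h2, Real.exp_log hx0] at h3
  have hLx : 0 < L x := hpos x (by simpa [Real.exp_log hx0] using hAb _ h2)
  rw [← Real.log_le_log_iff (by positivity) hLx, Real.log_mul (Real.exp_pos _).ne' (by positivity),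
    Real.log_exp, Real.log_rpow hx0]
  have h5 : η * ⌈Real.log x - a⌉₊ ≤ η * (Real.log x - a + 1) := by gcongr
  linarith

end SlowVariation

section Rates

/-- A power lower bound for `n * r n ^ d` of every negative order gives the growth condition. -/
theorem tendsto_mul_rpow_atTop {d : ℕ} {r : ℕ → ℝ} (hr0 : ∀ n, 0 ≤ r n)
    (hr : ∀ n, r n ≤ 1 / 2) (hd : 1 ≤ d)
    (h : ∀ η : ℝ, 0 < η → ∃ C > 0, ∀ᶠ n : ℕ in atTop, C * (n : ℝ) ^ (-η) ≤ n * r n ^ d) {ε : ℝ}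
    (hε : 0 < ε) : Tendsto (fun n : ℕ => (n : ℝ) * r n ^ ((d : ℝ) * (1 - ε))) atTop atTop := by
  obtain ⟨C, hC, hCn⟩ := h (ε / 2) (by positivity)
  have hrpos : ∀ᶠ n : ℕ in atTop, 0 < r n := by
    filter_upwards [hCn, eventually_gt_atTop 0] with n hn hn0
    refine (hr0 n).lt_of_ne fun h0 => ?_
    rw [← h0, zero_pow (by omega), mul_zero] at hn
    have : (0 : ℝ) < n := by exact_mod_cast hn0
    exact absurd hn (not_le.2 (by positivity))
  rcases lt_or_ge ε 1 with hε1 | hε1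
  · have hex : 0 < ε - ε / 2 * (1 - ε) := by nlinarith
    have hlow : Tendsto (fun n : ℕ => C ^ (1 - ε) * (n : ℝ) ^ (ε - ε / 2 * (1 - ε))) atTop atTop :=
      ((tendsto_rpow_atTop hex).comp tendsto_natCast_atTop_atTop).const_mul_atTop (by positivity)
    refine tendsto_atTop_mono' _ ?_ hlow
    filter_upwards [hCn, eventually_gt_atTop 0, hrpos] with n hn hn0 hrn
    have hn1 : (0 : ℝ) < n := by exact_mod_cast hn0
    calc C ^ (1 - ε) * (n : ℝ) ^ (ε - ε / 2 * (1 - ε))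
        = (C * (n : ℝ) ^ (-(ε / 2))) ^ (1 - ε) * (n : ℝ) ^ ε := by
          rw [Real.mul_rpow hC.le (by positivity), ← Real.rpow_mul hn1.le, mul_assoc,
            ← Real.rpow_add hn1]
          congr 2; ring
      _ ≤ ((n : ℝ) * r n ^ d) ^ (1 - ε) * (n : ℝ) ^ ε := by gcongr
      _ = (n : ℝ) * r n ^ ((d : ℝ) * (1 - ε)) := by
          rw [Real.mul_rpow hn1.le (by positivity), ← Real.rpow_natCast, ← Real.rpow_mul hrn.le,
            mul_right_comm, ← Real.rpow_add hn1, sub_add_cancel, Real.rpow_one]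
  · refine tendsto_atTop_mono' _ ?_ tendsto_natCast_atTop_atTop
    filter_upwards [hrpos] with n hrn
    have h1 : (1 : ℝ) ≤ r n ^ ((d : ℝ) * (1 - ε)) :=
      Real.one_le_rpow_of_pos_of_le_one_of_nonpos hrn (by linarith [hr n])
        (mul_nonpos_of_nonneg_of_nonpos (Nat.cast_nonneg d) (by linarith))
    exact le_mul_of_one_le_right (Nat.cast_nonneg n) h1

/-- The growth condition bounds `n * r n ^ d` below by every negative power. -/
theorem eventually_rpow_neg_le {d : ℕ} {r : ℕ → ℝ} (hr0 : ∀ n, 0 ≤ r n)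
    (h : ∀ ε : ℝ, 0 < ε →
      Tendsto (fun n : ℕ => (n : ℝ) * r n ^ ((d : ℝ) * (1 - ε))) atTop atTop)
    {δ : ℝ} (hδ : 0 < δ) : ∀ᶠ n : ℕ in atTop, (n : ℝ) ^ (-δ) ≤ n * r n ^ d := by
  set ε := δ / (1 + δ) with hε
  have hε0 : 0 < ε := by positivity
  have h1ε : 1 - ε = (1 + δ)⁻¹ := by rw [hε]; field_simp; ring
  filter_upwards [(h ε hε0).eventually_ge_atTop 1, eventually_gt_atTop 0] with n hn hn0
  have hn1 : (0 : ℝ) < n := by exact_mod_cast hn0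
  rw [h1ε] at hn
  have h2 : (1 : ℝ) ≤ ((n : ℝ) * r n ^ ((d : ℝ) * (1 + δ)⁻¹)) ^ (1 + δ) :=
    Real.one_le_rpow hn (by positivity)
  rw [Real.mul_rpow hn1.le (Real.rpow_nonneg (hr0 n) _), ← Real.rpow_mul (hr0 n), mul_assoc,
    inv_mul_cancel₀ (by positivity), mul_one, Real.rpow_natCast, Real.rpow_add hn1,
    Real.rpow_one] at h2
  rw [Real.rpow_neg hn1.le, inv_le_iff_one_le_mul₀ (by positivity)]
  linarith

end Rates

section Sampling

variable {Ω : Type*} [MeasurableSpace Ω] {P : Measure Ω} [IsProbabilityMeasure P] {d : ℕ}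

theorem tendstoInMeasure_torusGraph {X : (n : ℕ) → Fin n → Ω → EuclideanSpace ℝ (Fin d)}
    (hX : ∀ n i, Measurable (X n i)) (hU : ∀ n i, pdf.IsUniform (X n i) (unitCube d) P volume)
    (hI : ∀ n, iIndepFun (X n) P) (f : ∀ n : ℕ, SimpleGraph (Fin n) → ℝ) (r : ℕ → ℝ) (w : ℝ)
    (h : ∀ ε : ℝ, 0 < ε → Tendsto (fun n =>
      (Measure.pi fun _ : Fin n => (volume : Measure (Fin d → UnitAddCircle))).real
        {x | ε < |f n (cayleyGraph (torusBall d (r n)) x) - w|}) atTop (𝓝 0)) :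
    TendstoInMeasure P (fun n ω => f n (torusGraph (r n) fun i => X n i ω)) atTop fun _ => w := by
  rw [tendstoInMeasure_iff_measureReal_norm]
  intro ε hε
  refine squeeze_zero (fun _ => measureReal_nonneg) (fun n => ?_) (h (ε / 2) (by positivity))
  have hm : MeasurableSet {x : Fin n → Fin d → UnitAddCircle |
      ε / 2 < |f n (cayleyGraph (torusBall d (r n)) x) - w|} :=
    measurableSet_cayleyGraph (measurableSet_torusBall (r n)) fun G => ε / 2 < |f n G - w|
  have hX' : Measurable fun ω i => toTorus (X n i ω) :=
    measurable_pi_lambda _ fun i => measurable_toTorus.comp (hX n i)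
  rw [← map_toTorus_sample (hX n) (hU n) (hI n), map_measureReal_apply hX' hm]
  refine measureReal_mono fun ω hω => ?_
  simp only [Set.mem_ofPred_eq, Real.norm_eq_abs, torusGraph_eq] at hω
  exact lt_of_lt_of_le (by linarith) hω

theorem tendstoInMeasure_dimensionEstimate (hd : 1 ≤ d) {W : ℕ → Ω → ℝ}
    (hW : TendstoInMeasure P W atTop fun _ => ballProb d) {Δ : ℕ → Ω → ℕ}
    (hΔ : ∀ n ω, IsDimensionEstimate (W n ω) (Δ n ω)) :
    TendstoInMeasure P (fun n ω => (Δ n ω : ℝ)) atTop fun _ => (d : ℝ) := by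
  obtain ⟨δ, hδ, h⟩ := exists_isDimensionEstimate_eq hd
  rw [tendstoInMeasure_iff_measureReal_norm] at hW ⊢
  intro ε hε
  refine squeeze_zero (fun _ => measureReal_nonneg) (fun n => measureReal_mono fun ω hω => ?_)
    (hW δ hδ)
  simp only [Set.mem_ofPred_eq, Real.norm_eq_abs] at hω ⊢
  by_contra hlt
  rw [h _ _ (not_le.1 hlt) (hΔ n ω), sub_self, abs_zero] at hω
  linarith

end Sampling

section MainTheorem

variable {d : ℕ} {r : ℕ → ℝ}

theorem tendsto_measureReal_maxDegreeClustering_torus (hd : 1 ≤ d) (hr0 : ∀ n, 0 ≤ r n)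
    (hr : ∀ᶠ n in atTop, r n ≤ 1 / 3)
    (h : ∀ δ : ℝ, 0 < δ → ∀ᶠ n : ℕ in atTop, (n : ℝ) ^ (-δ) ≤ n * r n ^ d) {ε : ℝ} (hε : 0 < ε) :
    Tendsto (fun n =>
      (Measure.pi fun _ : Fin n => (volume : Measure (Fin d → UnitAddCircle))).real
        {x | ε < |maxDegreeClustering (cayleyGraph (torusBall d (r n)) x) - ballProb d|})
      atTop (𝓝 0) := by
  have hV := real_volume_ball_pos d
  have hrpos : ∀ᶠ n : ℕ in atTop, 0 < r n := by
    filter_upwards [h 1 one_pos, eventually_gt_atTop 0] with n hn hn0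
    refine (hr0 n).lt_of_ne fun h0 => ?_
    rw [← h0, zero_pow (by omega), mul_zero] at hn
    have : (0 : ℝ) < n := by exact_mod_cast hn0
    exact absurd hn (not_le.2 (by positivity))
  refine tendsto_measureReal_maxDegreeClustering volume
    (K₂ := fun n => torusBall d (2 * r n)) (C := 2 ^ d)
    (fun n => measurableSet_torusBall _) (fun n => neg_mem_torusBall)
    (fun n => measurableSet_torusBall _) (fun n => torusBall_mono (by linarith [hr0 n]))
    (fun n => sub_mem_torusBall) ?_ (by positivity) ?_ ?_ hε
  · filter_upwards [hr, hrpos] with n h1 h2 using real_volume_torus_triangles hd h2 h1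
  · filter_upwards [hr] with n hn
    rw [real_volume_torusBall (hr0 n) (by linarith), ← mul_assoc, ← mul_pow]
    exact real_volume_torusBall_le (by linarith [hr0 n])
  · intro δ hδ
    have hlim : Tendsto (fun n : ℕ => (n : ℝ) ^ (δ / 2)) atTop atTop :=
      (tendsto_rpow_atTop (half_pos hδ)).comp tendsto_natCast_atTop_atTop
    filter_upwards [hr, h (δ / 2) (half_pos hδ), eventually_gt_atTop 0,
      hlim.eventually_ge_atTop (volume.real (Metric.ball (0 : EuclideanSpace ℝ (Fin d)) 1))⁻¹]
      with n h1 h2 h3 h4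
    have hn : (0 : ℝ) < n := by exact_mod_cast h3
    rw [real_volume_torusBall (hr0 n) (by linarith), ← mul_assoc]
    rw [inv_le_iff_one_le_mul₀ hV] at h4
    calc (n : ℝ) ^ (-δ) ≤ (n : ℝ) ^ (-δ) *
          ((n : ℝ) ^ (δ / 2) * volume.real (Metric.ball (0 : EuclideanSpace ℝ (Fin d)) 1)) :=
          le_mul_of_one_le_right (by positivity) h4
      _ = (n : ℝ) ^ (-(δ / 2)) * volume.real (Metric.ball (0 : EuclideanSpace ℝ (Fin d)) 1) := by
          rw [← mul_assoc, ← Real.rpow_add hn]; congr 2; ring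
      _ ≤ _ := by gcongr

theorem tendsto_measureReal_globalClustering_torus (hd : 1 ≤ d) (hr0 : ∀ n, 0 ≤ r n)
    (hr : Tendsto r atTop (𝓝 0))
    (h : Tendsto (fun n : ℕ => (n : ℝ) ^ (3 / 2 : ℝ) * r n ^ d) atTop atTop)
    {ε : ℝ} (hε : 0 < ε) :
    Tendsto (fun n =>
      (Measure.pi fun _ : Fin n => (volume : Measure (Fin d → UnitAddCircle))).real
        {x | ε < |globalClustering (cayleyGraph (torusBall d (r n)) x) - ballProb d|})
      atTop (𝓝 0) := by
  have hr3 : ∀ᶠ n in atTop, r n ≤ 1 / 3 := hr.eventually_le_const (by norm_num)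
  have hrpos : ∀ᶠ n : ℕ in atTop, 0 < r n := by
    filter_upwards [h.eventually_gt_atTop 0] with n hn
    refine (hr0 n).lt_of_ne fun h0 => ?_
    rw [← h0, zero_pow (by omega), mul_zero] at hn
    exact lt_irrefl _ hn
  refine tendsto_measureReal_globalClustering volume
    (fun n => measurableSet_torusBall _) (fun n => neg_mem_torusBall)
    (ballProb_nonneg d) (ballProb_le_one d) ?_ ?_ hε
  · filter_upwards [hr3, hrpos] with n h1 h2 using real_volume_torus_triangles hd h2 h1
  · refine (h.atTop_mul_const (real_volume_ball_pos d)).congr' ?_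
    filter_upwards [hr3] with n hn
    rw [real_volume_torusBall (hr0 n) (by linarith), mul_assoc]

end MainTheorem

theorem theorem3 {Ω : Type*} [MeasurableSpace Ω] (P : Measure Ω) [IsProbabilityMeasure P]
    (d : ℕ) (hd : 1 ≤ d) (r : ℕ → ℝ) (hr_nonneg : ∀ n, 0 ≤ r n) (hr_half : ∀ n, r n ≤ 1 / 2)
    (X : (n : ℕ) → Fin n → Ω → EuclideanSpace ℝ (Fin d))
    (hX_meas : ∀ n i, Measurable (X n i))
    (hX_unif : ∀ n i, pdf.IsUniform (X n i) (unitCube d) P volume)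
    (hX_indep : ∀ n, iIndepFun (X n) P) :
    -- part (i)
    ((∀ᶠ n in atTop, r n ≤ 1 / 3) →
      (∀ ε : ℝ, 0 < ε →
        Tendsto (fun n : ℕ => (n : ℝ) * r n ^ ((d : ℝ) * (1 - ε))) atTop atTop) →
      TendstoInMeasure P
          (fun n ω => maxDegreeClustering (torusGraph (r n) (fun i => X n i ω)))
          atTop (fun _ => ballProb d) ∧
        ∀ Δ : ℕ → Ω → ℕ,
          (∀ n ω, IsDimensionEstimate
            (maxDegreeClustering (torusGraph (r n) (fun i => X n i ω))) (Δ n ω)) →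
          TendstoInMeasure P (fun n ω => (Δ n ω : ℝ)) atTop (fun _ => (d : ℝ))) ∧
    -- the sufficient condition for the hypothesis of part (i)
    (∀ L : ℝ → ℝ, IsSlowlyVarying L →
      (∀ᶠ n : ℕ in atTop, L (n : ℝ) ≤ (n : ℝ) * r n ^ d) →
      ∀ ε : ℝ, 0 < ε →
        Tendsto (fun n : ℕ => (n : ℝ) * r n ^ ((d : ℝ) * (1 - ε))) atTop atTop) ∧
    -- part (ii)
    (Tendsto r atTop (𝓝 0) →
      Tendsto (fun n : ℕ => (n : ℝ) ^ (3 / 2 : ℝ) * r n ^ d) atTop atTop →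
      TendstoInMeasure P
          (fun n ω => globalClustering (torusGraph (r n) (fun i => X n i ω)))
          atTop (fun _ => ballProb d) ∧
        ∀ Δ : ℕ → Ω → ℕ,
          (∀ n ω, IsDimensionEstimate
            (globalClustering (torusGraph (r n) (fun i => X n i ω))) (Δ n ω)) →
          TendstoInMeasure P (fun n ω => (Δ n ω : ℝ)) atTop (fun _ => (d : ℝ))) := by
  refine ⟨fun hr3 hrate => ?_, fun L hL hLr ε hε => ?_, fun hr hrate => ?_⟩
  · have h := tendstoInMeasure_torusGraph hX_meas hX_unif hX_indep
      (fun _ => maxDegreeClustering) r (ballProb d) fun ε hε =>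
        tendsto_measureReal_maxDegreeClustering_torus hd hr_nonneg hr3
          (fun δ hδ => eventually_rpow_neg_le hr_nonneg hrate hδ) hε
    exact ⟨h, fun Δ hΔ => tendstoInMeasure_dimensionEstimate hd h hΔ⟩
  · refine tendsto_mul_rpow_atTop hr_nonneg hr_half hd (fun η hη => ?_) hε
    obtain ⟨C, hC, hCL⟩ := hL.exists_mul_rpow_le hη
    exact ⟨C, hC, (tendsto_natCast_atTop_atTop.eventually hCL).mp
      (hLr.mono fun n h1 h2 => h2.trans h1)⟩
  · have h := tendstoInMeasure_torusGraph hX_meas hX_unif hX_indep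
      (fun _ => globalClustering) r (ballProb d) fun ε hε =>
        tendsto_measureReal_globalClustering_torus hd hr_nonneg hr hrate hε
    exact ⟨h, fun Δ hΔ => tendstoInMeasure_dimensionEstimate hd h hΔ⟩
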